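/- Let $q:\mathbb{R}\to\mathbb{C}$ be $2\pi$-periodic and locally square-integrable, and let $H=-d^2/dx^2+q(x)$ act in $L^2(\mathbb{R})$ on its natural domain $\{y\in L^2(\mathbb{R}) : y,y' \text{ locally absolutely continuous},\ -y''+qy\in L^2(\mathbb{R})\}$, with spectrum $\sigma(H)$. For $\lambda\in\mathbb{C}$ let $u(\cdot;\lambda)$, $v(\cdot;\lambda)$ be the solutions of $-y''+qy=\lambda y$ with $u(0)=1$, $u'(0)=0$, $v(0)=0$, $v'(0)=1$; put $\Delta(\lambda)=u(2\pi;\lambda)+v'(2\pi;\lambda)$ and $\langle q\rangle=\frac1{2\pi}\int_0^{2\pi}q(x)\,dx$. A Floquet solution at $\lambda$ with multiplier $\rho$ is a nonzero solution $y$ with $y(x+2\pi)=\rho\,y(x)$ for all $x$; $\lambda$ is a periodic eigenvalue if there is a Floquet solution with $\rho=1$; there is coexistence at $\lambda$ if $\Delta(\lambda)=\pm2$ and there are two linearly independent Floquet solutions at $\lambda$. Suppose that $\sigma(H)$ is a single analytic arc, that is, $\sigma(H)=\gamma(I)$, where $I\subseteq\mathbb{R}$ is a nondegenerate interval (open, half-open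 or closed, bounded or unbounded) and $\gamma$ is a homeomorphism of $I$ onto its image which is real-analytic with nonvanishing derivative in the interior of $I$; the endpoints of the arc are the images of those endpoints of $I$ that belong to $I$. Then $\sigma(H)$ has exactly one endpoint $\lambda_0$, and 1. $\langle q\rangle=\lambda_0$; 2. $\Delta(\lambda)=2\cos\left(2\pi\sqrt{\lambda-\lambda_0}\right)$ for all $\lambda\in\mathbb{C}$ (for either value of the square root); 3. $\sigma(H)=\langle q\rangle+[0,\infty)=\{\langle q\rangle+x : x\ge 0\}$; 4. $\lambda_0$ is a periodic eigenvalue of $H$, and there is no coexistence at $\lambda_0$. -/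

import Mathlib

open MeasureTheory

/-- The Hilbert space `L²(ℝ)` of complex-valued functions. -/
abbrev HillL2 : Type := Lp ℂ 2 (volume : Measure ℝ)

/-- `y` is differentiable, `y'` is locally absolutely continuous, and `y'' = g` almost everywhere
(with `g` locally integrable). -/
def HasSecondDerivAC (y g : ℝ → ℂ) : Prop :=
  LocallyIntegrable g volume ∧ Differentiable ℝ y ∧
    ∀ x : ℝ, deriv y x = deriv y 0 + ∫ t in (0 : ℝ)..x, g t

/-- `y` is a solution on the real line of `-y'' + q y = lam y`. -/
def IsHillSolution (q : ℝ → ℂ) (lam : ℂ) (y : ℝ → ℂ) : Prop :=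
  ∃ g : ℝ → ℂ, HasSecondDerivAC y g ∧ ∀ᵐ x : ℝ, -g x + q x * y x = lam * y x

/-- The graph of the operator `H y = -y'' + q y` acting in `L²(ℝ)` on its natural domain: all
`y ∈ L²(ℝ)` such that `y` and `y'` are locally absolutely continuous and `-y'' + q y ∈ L²(ℝ)`. -/
def hillGraph (q : ℝ → ℂ) : Set (HillL2 × HillL2) :=
  {p | ∃ y g : ℝ → ℂ, HasSecondDerivAC y g ∧ (∀ᵐ x : ℝ, p.1 x = y x) ∧
    ∀ᵐ x : ℝ, p.2 x = -g x + q x * y x}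

/-- The resolvent set of `H`: those `lam` for which `H - lam` maps the domain of `H` bijectively
onto `L²(ℝ)`, with a bounded inverse `R`. -/
def hillResolventSet (q : ℝ → ℂ) : Set ℂ :=
  {lam | ∃ R : HillL2 →L[ℂ] HillL2, ∀ F Y : HillL2, R F = Y ↔ (Y, F + lam • Y) ∈ hillGraph q}

/-- The spectrum `σ(H)` of `H` in `L²(ℝ)`. -/
def hillSpectrum (q : ℝ → ℂ) : Set ℂ := (hillResolventSet q)ᶜ

/-- The solution `u(·; lam)` with `u(0) = 1`, `u'(0) = 0` (it exists and is unique when `q` is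
locally integrable). -/
noncomputable def hillU (q : ℝ → ℂ) (lam : ℂ) : ℝ → ℂ :=
  Classical.epsilon fun y => IsHillSolution q lam y ∧ y 0 = 1 ∧ deriv y 0 = 0

/-- The solution `v(·; lam)` with `v(0) = 0`, `v'(0) = 1` (it exists and is unique when `q` is
locally integrable). -/
noncomputable def hillV (q : ℝ → ℂ) (lam : ℂ) : ℝ → ℂ :=
  Classical.epsilon fun y => IsHillSolution q lam y ∧ y 0 = 0 ∧ deriv y 0 = 1

/-- The Hill discriminant `Δ(lam) = u(2π; lam) + v'(2π; lam)`. -/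
noncomputable def hillDiscriminant (q : ℝ → ℂ) (lam : ℂ) : ℂ :=
  hillU q lam (2 * Real.pi) + deriv (hillV q lam) (2 * Real.pi)

/-- `y` is a Floquet solution with multiplier `ρ`: a nonzero solution with
`y(x + 2π) = ρ y(x)`. -/
def IsFloquetSolution (q : ℝ → ℂ) (lam ρ : ℂ) (y : ℝ → ℂ) : Prop :=
  IsHillSolution q lam y ∧ y ≠ 0 ∧ ∀ x : ℝ, y (x + 2 * Real.pi) = ρ * y x

/-- `lam` is a periodic eigenvalue: `1` is a Floquet multiplier. -/
def IsPeriodicEigenvalue (q : ℝ → ℂ) (lam : ℂ) : Prop :=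
  ∃ y : ℝ → ℂ, IsFloquetSolution q lam 1 y

/-- Coexistence at `lam`: `Δ(lam) = ±2` and there are two linearly independent Floquet
solutions. -/
def HillCoexistence (q : ℝ → ℂ) (lam : ℂ) : Prop :=
  (hillDiscriminant q lam = 2 ∨ hillDiscriminant q lam = -2) ∧
    ∃ (ρ₁ ρ₂ : ℂ) (y₁ y₂ : ℝ → ℂ), IsFloquetSolution q lam ρ₁ y₁ ∧ IsFloquetSolution q lam ρ₂ y₂ ∧
      LinearIndependent ℂ ![y₁, y₂]

/-- The mean value `⟨q⟩ = (2π)⁻¹ ∫₀^{2π} q`. -/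
noncomputable def hillMean (q : ℝ → ℂ) : ℂ :=
  (1 / (2 * Real.pi)) * ∫ x in (0 : ℝ)..(2 * Real.pi), q x

/-- `s` is a single analytic arc whose set of endpoints is `E`: `s` is the homeomorphic image of a
nondegenerate interval `I` (of any kind: open, half-open or closed, bounded or not) under a map
which is real-analytic with nonvanishing derivative in the interior of `I`, and `E` is the image of
those endpoints of `I` that belong to `I`. -/
def IsAnalyticArc (s E : Set ℂ) : Prop :=
  ∃ (I : Set ℝ) (γ : ℝ → ℂ), I.OrdConnected ∧ (interior I).Nonempty ∧
    Topology.IsEmbedding (I.domRestrict γ) ∧ AnalyticOnNhd ℝ γ (interior I) ∧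
    (∀ t ∈ interior I, deriv γ t ≠ 0) ∧ γ '' I = s ∧ γ '' (I \ interior I) = E

/-!
Write `Δ` for the Hill discriminant. The theorem rests on four facts.

* `Δ` is entire (`differentiable_hillDiscriminant`), and, as `|k| → ∞`,
  `Δ(k²) = 2 cos (2πk) + (∫ q) sin (2πk) / k + O(exp (2π |Im k|) / |k|²)`
  (`exists_hillDiscriminant_asymptotics`).
* The spectrum is the set where `Δ` is real with values in `[-2, 2]`. On this set, a Floquet
  solution with unimodular multiplier yields a Weyl sequence (`mem_hillSpectrum_of_abs_le`);
  elsewhere Green's function, built from the two exponentially decaying Floquet solutions, is a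
  bounded inverse (`exists_abs_le_of_mem_hillSpectrum`).
* If the spectrum is an analytic arc `γ` and `Δ(γ(t)) = ±2` at an interior parameter `t`, the
  function `Δ ∘ γ` is real with an extremum at `t`; hence `Δ' = 0` there
  (`IsAnalyticArc.deriv_hillDiscriminant_eq_zero`). So `±2` is taken with multiplicity at least two
  off the endpoints. The spectrum is unbounded (`not_isBounded_hillSpectrum`), so the arc is not
  compact and has at most one endpoint (`IsAnalyticArc.subsingleton`).
* Let `lam₀` be such that `±2` is taken by `Δ` only with multiplicity off `lam₀`. Then
  `(Δ')² (lam - lam₀) / (4 - Δ²)` is entire, and by the asymptotics it tends to `π²` along the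
  boundaries of growing squares in the variable `√lam`, so that it is identically `π²`
  (`AsymptoticallyCosine.ode`). The only non-constant solutions of the resulting differential
  equation are `Δ = ±2 cos (2π √(lam - lam₀))` (`eq_two_cos_or_neg_of_ode`), the positive one
  of which is the discriminant of the constant potential `lam₀`. Comparison of the asymptotics excludes the negative
  sign and gives `⟨q⟩ = lam₀` (`hillMean_eq_and_hillDiscriminant_eq`).

An arc without endpoints would satisfy the last condition for every `lam₀`, and `⟨q⟩` would not be
determined; so there is exactly one endpoint. The spectrum is then read off from the formula for
`Δ`. Finally `Δ(lam₀) = 2` and `Δ'(lam₀) = -4π² ≠ 0`, whereas at a point of coexistence with `Δ = 2`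
the monodromy matrix is the identity, which forces `Δ' = 0`
(`deriv_hillDiscriminant_of_coexistence`).
-/

/-! ### Locally absolutely continuous functions -/

/-- `f` is locally absolutely continuous on the real line with almost everywhere derivative `f'`:
it is a primitive of the locally integrable function `f'`. -/
def HasACDeriv (f f' : ℝ → ℂ) : Prop :=
  LocallyIntegrable f' volume ∧ ∀ x : ℝ, f x = f 0 + ∫ t in (0 : ℝ)..x, f' t

theorem MeasureTheory.LocallyIntegrable.intervalIntegrable_real {f : ℝ → ℂ}
    (hf : LocallyIntegrable f volume) (a b : ℝ) : IntervalIntegrable f volume a b :=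
  intervalIntegrable_iff.mpr <|
    (hf.integrableOn_isCompact isCompact_uIcc).mono_set Set.uIoc_subset_uIcc

theorem locallyIntegrable_of_intervalIntegrable {f : ℝ → ℂ}
    (hf : ∀ a b : ℝ, IntervalIntegrable f volume a b) : LocallyIntegrable f volume := by
  rw [locallyIntegrable_iff]
  intro K hK
  obtain ⟨r, hr⟩ := hK.isBounded.subset_closedBall 0
  have h := (hf (-|r|) |r|).1
  rw [← integrableOn_Icc_iff_integrableOn_Ioc] at h
  refine h.mono_set (hr.trans ?_)
  rw [Real.closedBall_eq_Icc]
  exact Set.Icc_subset_Icc (by linarith [le_abs_self r]) (by linarith [le_abs_self r])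

namespace HasACDeriv

variable {f f' g g' : ℝ → ℂ}

theorem intervalIntegrable (hf : HasACDeriv f f') (a b : ℝ) : IntervalIntegrable f' volume a b :=
  hf.1.intervalIntegrable_real a b

theorem integral_eq_sub (hf : HasACDeriv f f') (a b : ℝ) : ∫ t in a..b, f' t = f b - f a := by
  rw [hf.2 b, hf.2 a, ← intervalIntegral.integral_add_adjacent_intervals
    (hf.intervalIntegrable a 0) (hf.intervalIntegrable 0 b), intervalIntegral.integral_symm]
  ring

theorem of_integral (h : LocallyIntegrable f' volume) (c : ℂ) :
    HasACDeriv (fun x => c + ∫ t in (0 : ℝ)..x, f' t) f' :=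
  ⟨h, fun x => by simp⟩

protected theorem continuous (hf : HasACDeriv f f') : Continuous f := by
  rw [show f = fun x => f 0 + ∫ t in (0 : ℝ)..x, f' t from funext hf.2]
  exact continuous_const.add
    (intervalIntegral.continuous_primitive (fun a b => hf.intervalIntegrable a b) 0)

theorem ae_hasDerivAt (hf : HasACDeriv f f') : ∀ᵐ x, HasDerivAt f (f' x) x := by
  filter_upwards [LocallyIntegrable.ae_hasDerivAt_integral hf.1] with x hx
  rw [show f = fun x => f 0 + ∫ t in (0 : ℝ)..x, f' t from funext hf.2]
  exact (hx 0).const_add _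

/-- The distances `‖f d - f c‖` are dominated by the increments of the real primitive of `‖f'‖`,
which is absolutely continuous. -/
theorem absolutelyContinuousOnInterval (hf : HasACDeriv f f') (a b : ℝ) :
    AbsolutelyContinuousOnInterval f a b := by
  have hn : IntervalIntegrable (fun t => ‖f' t‖) volume a b := (hf.intervalIntegrable a b).norm
  have hac := hn.absolutelyContinuousOnInterval_intervalIntegral (c := a) Set.left_mem_uIcc
  unfold AbsolutelyContinuousOnInterval at hac ⊢
  refine squeeze_zero (fun E => Finset.sum_nonneg fun i _ => dist_nonneg) (fun E => ?_) hac
  refine Finset.sum_le_sum fun i _ => ?_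
  have hi : ∀ c d : ℝ, IntervalIntegrable (fun t => ‖f' t‖) volume c d :=
    fun c d => (hf.intervalIntegrable c d).norm
  rw [dist_comm, dist_eq_norm, ← hf.integral_eq_sub, dist_comm, Real.dist_eq,
    intervalIntegral.integral_interval_sub_left (hi _ _) (hi _ _)]
  exact intervalIntegral.norm_integral_le_abs_integral_norm

protected theorem mul (hf : HasACDeriv f f') (hg : HasACDeriv g g') :
    HasACDeriv (fun x => f x * g x) (fun x => f' x * g x + f x * g' x) := by
  have hint : LocallyIntegrable (fun x => f' x * g x + f x * g' x) volume :=
    (hf.1.mul_continuous hg.continuous).add (hg.1.continuous_mul hf.continuous)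
  refine ⟨hint, fun x => ?_⟩
  -- the difference of the two sides is absolutely continuous with vanishing derivative
  set P := fun x => (0 : ℂ) + ∫ t in (0 : ℝ)..x, (f' t * g t + f t * g' t) with hP
  have hPd : HasACDeriv P (fun x => f' x * g x + f x * g' x) := of_integral hint 0
  have hac : AbsolutelyContinuousOnInterval (fun x => f x * g x - P x) 0 x := by
    have h1 := (hf.absolutelyContinuousOnInterval 0 x).fun_smul
      (hg.absolutelyContinuousOnInterval 0 x)
    exact h1.fun_sub (hPd.absolutelyContinuousOnInterval 0 x)
  obtain ⟨C, hC⟩ := hac.const_of_ae_hasDerivAt_zero (by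
    filter_upwards [hf.ae_hasDerivAt, hg.ae_hasDerivAt, hPd.ae_hasDerivAt] with t h1 h2 h3 _
    have h := (h1.mul h2).sub h3
    rw [sub_self] at h
    exact h)
  have h0 := hC 0 Set.left_mem_uIcc
  have h1 := hC x Set.right_mem_uIcc
  simp only [hP, intervalIntegral.integral_same, zero_add] at h0 h1
  rw [← h0] at h1
  linear_combination h1

protected theorem add (hf : HasACDeriv f f') (hg : HasACDeriv g g') :
    HasACDeriv (fun x => f x + g x) (fun x => f' x + g' x) := by
  refine ⟨hf.1.add hg.1, fun x => ?_⟩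
  rw [intervalIntegral.integral_add (hf.intervalIntegrable 0 x) (hg.intervalIntegrable 0 x)]
  linear_combination hf.2 x + hg.2 x

protected theorem sub (hf : HasACDeriv f f') (hg : HasACDeriv g g') :
    HasACDeriv (fun x => f x - g x) (fun x => f' x - g' x) := by
  refine ⟨hf.1.sub hg.1, fun x => ?_⟩
  rw [intervalIntegral.integral_sub (hf.intervalIntegrable 0 x) (hg.intervalIntegrable 0 x)]
  linear_combination hf.2 x - hg.2 x

protected theorem congr_ae (hf : HasACDeriv f f') (h : f' =ᵐ[volume] g') : HasACDeriv f g' := by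
  refine ⟨hf.1.congr h, fun x => ?_⟩
  rw [hf.2 x, intervalIntegral.integral_congr_ae (h.mono fun t ht _ => ht)]

protected theorem congr (hf : HasACDeriv f f') (h : ∀ x, f' x = g' x) : HasACDeriv f g' :=
  (funext h : f' = g') ▸ hf

theorem of_hasDerivAt (h : ∀ x, HasDerivAt f (f' x) x) (hc : Continuous f') : HasACDeriv f f' := by
  refine ⟨hc.locallyIntegrable, fun x => ?_⟩
  rw [intervalIntegral.integral_eq_sub_of_hasDerivAt (fun t _ => h t) (hc.intervalIntegrable _ _)]
  ring

theorem hasDerivAt (hf : HasACDeriv f f') (hc : Continuous f') (x : ℝ) :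
    HasDerivAt f (f' x) x := by
  rw [show f = fun x => f 0 + ∫ t in (0 : ℝ)..x, f' t from funext hf.2]
  exact (intervalIntegral.integral_hasDerivAt_right (hf.intervalIntegrable 0 x)
    (hc.stronglyMeasurableAtFilter _ _) hc.continuousAt).const_add _

theorem const (c : ℂ) : HasACDeriv (fun _ => c) (fun _ => 0) :=
  of_hasDerivAt (fun x => hasDerivAt_const x c) continuous_const

theorem const_mul (c : ℂ) (hf : HasACDeriv f f') :
    HasACDeriv (fun x => c * f x) (fun x => c * f' x) :=
  ((const c).mul hf).congr fun x => by simp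

theorem comp_add_right (hf : HasACDeriv f f') (T : ℝ) :
    HasACDeriv (fun x => f (x + T)) (fun x => f' (x + T)) := by
  refine ⟨locallyIntegrable_of_intervalIntegrable fun a b => ?_, fun x => ?_⟩
  · simpa using (hf.intervalIntegrable (a + T) (b + T)).comp_add_right T
  · rw [intervalIntegral.integral_comp_add_right, hf.integral_eq_sub]
    ring

/-- Lagrange's identity. -/
theorem lagrange {φ φ₁ φ₂ y y₁ y₂ : ℝ → ℂ} (hφ : HasACDeriv φ φ₁) (hφ₁ : HasACDeriv φ₁ φ₂)
    (hy : HasACDeriv y y₁) (hy₁ : HasACDeriv y₁ y₂) :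
    HasACDeriv (fun x => φ x * y₁ x - φ₁ x * y x) (fun x => φ x * y₂ x - φ₂ x * y x) :=
  ((hφ.mul hy₁).sub (hφ₁.mul hy)).congr fun x => by ring

end HasACDeriv

/-! ### Solutions of Hill's equation -/

theorem HasSecondDerivAC.hasACDeriv_deriv {y g : ℝ → ℂ} (h : HasSecondDerivAC y g) :
    HasACDeriv (deriv y) g := ⟨h.1, h.2.2⟩

theorem HasSecondDerivAC.hasACDeriv {y g : ℝ → ℂ} (h : HasSecondDerivAC y g) :
    HasACDeriv y (deriv y) :=
  .of_hasDerivAt (fun x => (h.2.1 x).hasDerivAt) h.hasACDeriv_deriv.continuous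

theorem HasACDeriv.deriv_eq {y p g : ℝ → ℂ} (hy : HasACDeriv y p) (hp : HasACDeriv p g) :
    deriv y = p := funext fun x => (hy.hasDerivAt hp.continuous x).deriv

theorem HasACDeriv.hasSecondDerivAC {y p g : ℝ → ℂ} (hy : HasACDeriv y p) (hp : HasACDeriv p g) :
    HasSecondDerivAC y g := by
  refine ⟨hp.1, fun x => (hy.hasDerivAt hp.continuous x).differentiableAt, ?_⟩
  rw [hy.deriv_eq hp]
  exact hp.2

/-- Hill's equation as the first order system `y' = p`, `p' = (q - lam) y`. -/
theorem isHillSolution_iff {q : ℝ → ℂ} {lam : ℂ} {y : ℝ → ℂ} :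
    IsHillSolution q lam y ↔
      HasACDeriv y (deriv y) ∧ HasACDeriv (deriv y) (fun x => (q x - lam) * y x) := by
  constructor
  · rintro ⟨g, hg, h⟩
    refine ⟨hg.hasACDeriv, hg.hasACDeriv_deriv.congr_ae ?_⟩
    filter_upwards [h] with x hx
    linear_combination -hx
  · rintro ⟨h1, h2⟩
    exact ⟨_, h1.hasSecondDerivAC h2, .of_forall fun x => by ring⟩

theorem HasACDeriv.isHillSolution {q : ℝ → ℂ} {lam : ℂ} {y p : ℝ → ℂ} (hy : HasACDeriv y p)
    (hp : HasACDeriv p (fun x => (q x - lam) * y x)) : IsHillSolution q lam y :=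
  ⟨_, hy.hasSecondDerivAC hp, .of_forall fun x => by ring⟩

namespace IsHillSolution

variable {q : ℝ → ℂ} {lam : ℂ} {y z : ℝ → ℂ}

theorem hasACDeriv (h : IsHillSolution q lam y) : HasACDeriv y (deriv y) :=
  (isHillSolution_iff.1 h).1

theorem hasACDeriv_deriv (h : IsHillSolution q lam y) :
    HasACDeriv (deriv y) (fun x => (q x - lam) * y x) :=
  (isHillSolution_iff.1 h).2

protected theorem continuous (h : IsHillSolution q lam y) : Continuous y := h.hasACDeriv.continuous

theorem continuous_deriv (h : IsHillSolution q lam y) : Continuous (deriv y) :=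
  h.hasACDeriv_deriv.continuous

theorem hasDerivAt (h : IsHillSolution q lam y) (x : ℝ) : HasDerivAt y (deriv y x) x :=
  h.hasACDeriv.hasDerivAt h.continuous_deriv x

theorem linComb (hy : IsHillSolution q lam y) (hz : IsHillSolution q lam z) (a b : ℂ) :
    IsHillSolution q lam (fun x => a * y x + b * z x) :=
  ((hy.hasACDeriv.const_mul a).add (hz.hasACDeriv.const_mul b)).isHillSolution
    (((hy.hasACDeriv_deriv.const_mul a).add (hz.hasACDeriv_deriv.const_mul b)).congr
      fun x => by ring)

theorem deriv_linComb (hy : IsHillSolution q lam y) (hz : IsHillSolution q lam z) (a b : ℂ)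
    (x : ℝ) : deriv (fun x => a * y x + b * z x) x = a * deriv y x + b * deriv z x :=
  (((hy.hasDerivAt x).const_mul a).add ((hz.hasDerivAt x).const_mul b)).deriv

/-- The Wronskian of two solutions is constant. -/
theorem wronskian_eq (hy : IsHillSolution q lam y) (hz : IsHillSolution q lam z) (x : ℝ) :
    y x * deriv z x - deriv y x * z x = y 0 * deriv z 0 - deriv y 0 * z 0 := by
  have h := (hy.hasACDeriv.lagrange hy.hasACDeriv_deriv hz.hasACDeriv hz.hasACDeriv_deriv).2 x
  have h0 : ∀ t : ℝ, y t * ((q t - lam) * z t) - (q t - lam) * y t * z t = 0 := fun t => by ring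
  simp only [h0, intervalIntegral.integral_zero, add_zero] at h
  exact h

theorem comp_add_right (hy : IsHillSolution q lam y) {T : ℝ} (hq : Function.Periodic q T) :
    IsHillSolution q lam (fun x => y (x + T)) :=
  (hy.hasACDeriv.comp_add_right T).isHillSolution
    ((hy.hasACDeriv_deriv.comp_add_right T).congr fun x => by rw [hq x])

theorem deriv_comp_add_right (hy : IsHillSolution q lam y) (T x : ℝ) :
    deriv (fun x => y (x + T)) x = deriv y (x + T) :=
  ((hy.hasDerivAt (x + T)).comp_add_const x T).deriv

end IsHillSolution

/-! ### The Volterra equation -/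

theorem norm_integral_zero_le {p f : ℝ → ℂ} (hp : LocallyIntegrable p volume) {N x C : ℝ}
    (hx : |x| ≤ N) (hC : 0 ≤ C) (h : ∀ t ∈ Set.uIoc 0 x, ‖f t‖ ≤ C * ‖p t‖) :
    ‖∫ t in (0 : ℝ)..x, f t‖ ≤ C * ∫ t in -N..N, ‖p t‖ := by
  obtain ⟨h1, h2⟩ := abs_le.1 hx
  have hN : 0 ≤ N := (abs_nonneg x).trans hx
  have hsub : Set.uIoc 0 x ⊆ Set.Ioc (-N) N := by
    intro t ht
    rcases Set.mem_uIoc.1 ht with h | h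
    · exact ⟨by linarith [h.1], by linarith [h.2]⟩
    · exact ⟨by linarith [h.1], by linarith [h.2]⟩
  have hpn : IntegrableOn (fun t => ‖p t‖) (Set.Ioc (-N) N) :=
    (hp.intervalIntegrable_real (-N) N).1.norm
  rw [intervalIntegral.norm_intervalIntegral_eq, intervalIntegral.integral_of_le (by linarith),
    ← integral_const_mul]
  refine (norm_integral_le_of_norm_le ((hpn.mono_set hsub).const_mul C) ?_).trans ?_
  · exact (ae_restrict_iff' measurableSet_uIoc).2 (.of_forall h)
  · exact setIntegral_mono_set (hpn.const_mul C)
      (.of_forall fun t => mul_nonneg hC (norm_nonneg _)) (.of_forall hsub)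

theorem abs_sub_mul_exp_le {κ x t : ℝ} (hκ : 0 < κ) (ht : t ∈ Set.uIoc 0 x) :
    |x - t| * Real.exp (κ * |t|) ≤ κ⁻¹ * Real.exp (κ * |x|) := by
  have h : |x| = |x - t| + |t| := by
    rcases Set.mem_uIoc.1 ht with h | h
    · rw [abs_of_pos (h.1.trans_le h.2), abs_of_nonneg (sub_nonneg.2 h.2), abs_of_pos h.1]; ring
    · rw [abs_of_nonpos (h.1.trans_le h.2).le, abs_of_nonpos (sub_nonpos.2 h.1.le),
        abs_of_nonpos h.2]; ring
  rw [h, mul_add, Real.exp_add, ← mul_assoc]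
  refine mul_le_mul_of_nonneg_right ?_ (Real.exp_pos _).le
  rw [inv_mul_eq_div, le_div_iff₀ hκ]
  linarith [Real.add_one_le_exp (κ * |x - t|)]

/-- Uniqueness for the Volterra equation, by a weighted supremum estimate. -/
theorem volterra_eq_zero {p w : ℝ → ℂ} (hp : LocallyIntegrable p volume) (hw : Continuous w)
    {N : ℝ} (h : ∀ x ∈ Set.Icc (-N) N, w x = ∫ t in (0 : ℝ)..x, (x - t) * (p t * w t)) :
    ∀ x ∈ Set.Icc (-N) N, w x = 0 := by
  intro x hx
  set P := ∫ t in -N..N, ‖p t‖ with hP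
  have hN : 0 ≤ N := by linarith [hx.1, hx.2]
  have hP0 : 0 ≤ P := intervalIntegral.integral_nonneg (by linarith) fun t _ => norm_nonneg _
  set κ := P + 1 with hκd
  have hκ : 0 < κ := by linarith
  obtain ⟨x₀, hx₀, hmax⟩ := isCompact_Icc.exists_isMaxOn ⟨x, hx⟩
    (f := fun x => Real.exp (-(κ * |x|)) * ‖w x‖) (by fun_prop)
  set M := Real.exp (-(κ * |x₀|)) * ‖w x₀‖ with hM
  have hM0 : 0 ≤ M := by positivity
  have hle : ∀ t ∈ Set.Icc (-N) N, ‖w t‖ ≤ Real.exp (κ * |t|) * M := fun t ht => by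
    have := hmax ht
    simp only [Set.mem_ofPred_eq, Real.exp_neg] at this
    rwa [inv_mul_le_iff₀ (Real.exp_pos _), ← Real.exp_neg, ← hM] at this
  have hb : ‖w x₀‖ ≤ κ⁻¹ * Real.exp (κ * |x₀|) * M * P := by
    rw [h x₀ hx₀]
    refine norm_integral_zero_le hp (abs_le.2 hx₀) (by positivity) fun t ht => ?_
    have htN : t ∈ Set.Icc (-N) N := by
      rcases Set.mem_uIoc.1 ht with h | h
      · exact ⟨by linarith [h.1], h.2.trans hx₀.2⟩
      · exact ⟨hx₀.1.trans h.1.le, by linarith [h.2]⟩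
    rw [norm_mul, norm_mul, ← Complex.ofReal_sub, Complex.norm_real, Real.norm_eq_abs]
    calc |x₀ - t| * (‖p t‖ * ‖w t‖) ≤ |x₀ - t| * (‖p t‖ * (Real.exp (κ * |t|) * M)) := by
          gcongr; exact hle t htN
      _ = |x₀ - t| * Real.exp (κ * |t|) * (M * ‖p t‖) := by ring
      _ ≤ κ⁻¹ * Real.exp (κ * |x₀|) * (M * ‖p t‖) := by
          gcongr ?_ * _; exact abs_sub_mul_exp_le hκ ht
      _ = _ := by ring
  have hM2 : M ≤ κ⁻¹ * P * M := by
    rw [hM, Real.exp_neg, inv_mul_le_iff₀ (Real.exp_pos _), ← Real.exp_neg, ← hM]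
    linarith
  have hM3 : M = 0 := by
    rw [mul_assoc, le_inv_mul_iff₀ hκ] at hM2
    nlinarith
  have := hle x hx
  rw [hM3, mul_zero] at this
  exact norm_le_zero_iff.1 this

section VolterraOperator

variable {N : ℝ} (hN : 0 ≤ N)

/-- A continuous function `z` on `[-N, N]`, continued by constants and multiplied by the weight
`exp (κ |t|)`. -/
noncomputable def weightedExtend (κ : ℝ) (z : C(Set.Icc (-N) N, ℂ)) (t : ℝ) : ℂ :=
  Real.exp (κ * |t|) * Set.IccExtend (neg_le_self hN) z t

theorem continuous_weightedExtend (κ : ℝ) (z : C(Set.Icc (-N) N, ℂ)) :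
    Continuous (weightedExtend hN κ z) := by
  have : Continuous (Set.IccExtend (neg_le_self hN) z) := z.continuous.Icc_extend'
  unfold weightedExtend
  fun_prop

theorem norm_weightedExtend_le (κ : ℝ) (z : C(Set.Icc (-N) N, ℂ)) (t : ℝ) :
    ‖weightedExtend hN κ z t‖ ≤ Real.exp (κ * |t|) * ‖z‖ := by
  rw [weightedExtend, norm_mul, Complex.norm_real, Real.norm_of_nonneg (Real.exp_pos _).le]
  gcongr
  exact z.norm_coe_le_norm _

theorem weightedExtend_of_mem (κ : ℝ) (z : C(Set.Icc (-N) N, ℂ)) {t : ℝ}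
    (ht : t ∈ Set.Icc (-N) N) : weightedExtend hN κ z t = Real.exp (κ * |t|) * z ⟨t, ht⟩ := by
  rw [weightedExtend, Set.IccExtend_of_mem _ _ ht]

theorem weightedExtend_add (κ : ℝ) (z w : C(Set.Icc (-N) N, ℂ)) (t : ℝ) :
    weightedExtend hN κ (z + w) t = weightedExtend hN κ z t + weightedExtend hN κ w t := by
  simp [weightedExtend, Set.IccExtend, mul_add]

theorem weightedExtend_smul (κ : ℝ) (c : ℂ) (z : C(Set.Icc (-N) N, ℂ)) (t : ℝ) :
    weightedExtend hN κ (c • z) t = c * weightedExtend hN κ z t := by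
  simp [weightedExtend, Set.IccExtend]; ring

variable {p : ℝ → ℂ} (hp : LocallyIntegrable p volume)

theorem continuous_volterra_integral {y : ℝ → ℂ} (hp : LocallyIntegrable p volume)
    (hy : Continuous y) :
    Continuous fun x : ℝ => ∫ t in (0 : ℝ)..x, ((x : ℂ) - t) * (p t * y t) := by
  have h1 : LocallyIntegrable (fun t => p t * y t) volume := hp.mul_continuous hy
  have h2 : LocallyIntegrable (fun t : ℝ => (t : ℂ) * (p t * y t)) volume :=
    h1.continuous_mul Complex.continuous_ofReal
  have e : (fun x : ℝ => ∫ t in (0 : ℝ)..x, ((x : ℂ) - t) * (p t * y t)) = fun x : ℝ =>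
      x * (∫ t in (0 : ℝ)..x, p t * y t) - ∫ t in (0 : ℝ)..x, ((t : ℝ) : ℂ) * (p t * y t) := by
    funext x
    rw [← intervalIntegral.integral_const_mul, ← intervalIntegral.integral_sub
      ((h1.intervalIntegrable_real 0 x).const_mul _) (h2.intervalIntegrable_real 0 x)]
    simp only [sub_mul]
  rw [e]
  exact (Complex.continuous_ofReal.mul (intervalIntegral.continuous_primitive
    (fun a b => h1.intervalIntegrable_real a b) 0)).sub
    (intervalIntegral.continuous_primitive (fun a b => h2.intervalIntegrable_real a b) 0)

theorem norm_volterra_integral_le (hp : LocallyIntegrable p volume) {κ : ℝ} (hκ : 0 < κ)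
    (z : C(Set.Icc (-N) N, ℂ)) {x : ℝ} (hx : |x| ≤ N) :
    ‖∫ t in (0 : ℝ)..x, (x - t) * (p t * weightedExtend hN κ z t)‖ ≤
      κ⁻¹ * Real.exp (κ * |x|) * ‖z‖ * ∫ t in -N..N, ‖p t‖ := by
  refine norm_integral_zero_le hp hx (by positivity) fun t ht => ?_
  rw [norm_mul, norm_mul, ← Complex.ofReal_sub, Complex.norm_real, Real.norm_eq_abs]
  calc |x - t| * (‖p t‖ * ‖weightedExtend hN κ z t‖)
      ≤ |x - t| * (‖p t‖ * (Real.exp (κ * |t|) * ‖z‖)) := by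
        gcongr; exact norm_weightedExtend_le hN κ z t
    _ = |x - t| * Real.exp (κ * |t|) * (‖z‖ * ‖p t‖) := by ring
    _ ≤ κ⁻¹ * Real.exp (κ * |x|) * (‖z‖ * ‖p t‖) := by
        gcongr ?_ * _; exact abs_sub_mul_exp_le hκ ht
    _ = _ := by ring

/-- The Volterra operator `y ↦ ∫₀ˣ (x - t) p(t) y(t) dt` on `[-N, N]`, conjugated with the weight
`exp (κ |x|)`. -/
noncomputable def volterraOp {κ : ℝ} (hκ : 0 < κ) :
    C(Set.Icc (-N) N, ℂ) →L[ℂ] C(Set.Icc (-N) N, ℂ) :=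
  LinearMap.mkContinuous
    { toFun := fun z =>
        ⟨fun x => Real.exp (-(κ * |(x : ℝ)|)) *
          ∫ t in (0 : ℝ)..x, (x - t) * (p t * weightedExtend hN κ z t), by
          have := (continuous_volterra_integral hp (continuous_weightedExtend hN κ z)).comp
            (continuous_subtype_val (p := (· ∈ Set.Icc (-N) N)))
          refine Continuous.mul (by fun_prop) this⟩
      map_add' := fun z w => by
        ext x
        have hi : ∀ z : C(Set.Icc (-N) N, ℂ), IntervalIntegrable
            (fun t : ℝ => ((x : ℝ) - t : ℂ) * (p t * weightedExtend hN κ z t)) volume 0 x :=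
          fun z => ((hp.mul_continuous (continuous_weightedExtend hN κ z)).continuous_mul
            (by fun_prop)).intervalIntegrable_real 0 x
        simp only [ContinuousMap.coe_mk, ContinuousMap.add_apply, weightedExtend_add, mul_add]
        rw [intervalIntegral.integral_add (hi z) (hi w)]
        ring
      map_smul' := fun c z => by
        ext x
        simp only [ContinuousMap.coe_mk, ContinuousMap.smul_apply, weightedExtend_smul,
          RingHom.id_apply, smul_eq_mul]
        have h : ∀ t : ℝ, ((x : ℝ) - t : ℂ) * (p t * (c * weightedExtend hN κ z t)) =
            c * (((x : ℝ) - t : ℂ) * (p t * weightedExtend hN κ z t)) := fun t => by ring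
        simp only [h]
        rw [intervalIntegral.integral_const_mul]
        ring }
    (κ⁻¹ * ∫ t in -N..N, ‖p t‖) fun z => by
      have hP : 0 ≤ ∫ t in -N..N, ‖p t‖ :=
        intervalIntegral.integral_nonneg (by linarith) fun t _ => norm_nonneg _
      rw [ContinuousMap.norm_le _ (by positivity)]
      intro x
      simp only [LinearMap.coe_mk, AddHom.coe_mk, ContinuousMap.coe_mk]
      rw [norm_mul, Complex.norm_real, Real.norm_of_nonneg (Real.exp_pos _).le, Real.exp_neg,
        inv_mul_le_iff₀ (Real.exp_pos _)]
      refine (norm_volterra_integral_le hN hp hκ z (abs_le.2 x.2)).trans (le_of_eq ?_)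
      ring

theorem volterraOp_apply {κ : ℝ} (hκ : 0 < κ) (z : C(Set.Icc (-N) N, ℂ)) (x : Set.Icc (-N) N) :
    volterraOp hN hp hκ z x = Real.exp (-(κ * |(x : ℝ)|)) *
      ∫ t in (0 : ℝ)..x, (x - t) * (p t * weightedExtend hN κ z t) := rfl

theorem norm_volterraOp_le {κ : ℝ} (hκ : 0 < κ) :
    ‖volterraOp hN hp hκ‖ ≤ κ⁻¹ * ∫ t in -N..N, ‖p t‖ :=
  LinearMap.mkContinuous_norm_le _ (mul_nonneg (inv_nonneg.2 hκ.le)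
    (intervalIntegral.integral_nonneg (by linarith) fun t _ => norm_nonneg _)) _

/-- The functional `y ↦ ∫₀ˣ p(t) y(t) dt` in terms of the weighted function. -/
noncomputable def integralFunctional (κ : ℝ) (x : ℝ) (hx : |x| ≤ N) (hκ : 0 < κ) :
    C(Set.Icc (-N) N, ℂ) →L[ℂ] ℂ :=
  LinearMap.mkContinuous
    { toFun := fun z => ∫ t in (0 : ℝ)..x, p t * weightedExtend hN κ z t
      map_add' := fun z w => by
        have hi : ∀ z : C(Set.Icc (-N) N, ℂ), IntervalIntegrable
            (fun t : ℝ => p t * weightedExtend hN κ z t) volume 0 x :=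
          fun z => (hp.mul_continuous
            (continuous_weightedExtend hN κ z)).intervalIntegrable_real 0 x
        simp only [weightedExtend_add, mul_add]
        rw [intervalIntegral.integral_add (hi z) (hi w)]
      map_smul' := fun c z => by
        simp only [weightedExtend_smul, RingHom.id_apply, smul_eq_mul]
        rw [← intervalIntegral.integral_const_mul]
        congr 1
        funext t
        ring }
    (Real.exp (κ * |x|) * ∫ t in -N..N, ‖p t‖) fun z => by
      simp only [LinearMap.coe_mk, AddHom.coe_mk]
      refine (norm_integral_zero_le hp hx (C := Real.exp (κ * |x|) * ‖z‖) (by positivity)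
        fun t ht => ?_).trans (le_of_eq (by ring))
      have htx : |t| ≤ |x| := by
        rcases Set.mem_uIoc.1 ht with h | h
        · exact abs_le_abs h.2 (by linarith [h.1])
        · exact abs_le_abs_of_nonpos h.2 h.1.le
      rw [norm_mul, mul_comm]
      gcongr
      refine (norm_weightedExtend_le hN κ z t).trans ?_
      gcongr

theorem integralFunctional_apply (κ : ℝ) (x : ℝ) (hx : |x| ≤ N) (hκ : 0 < κ)
    (z : C(Set.Icc (-N) N, ℂ)) : integralFunctional hN hp κ x hx hκ z =
      ∫ t in (0 : ℝ)..x, p t * weightedExtend hN κ z t := rfl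

/-- The affine function `a + b x` with the weight `exp (κ |x|)` divided out. -/
noncomputable def weightedAffine (N κ : ℝ) (a b : ℂ) : C(Set.Icc (-N) N, ℂ) :=
  ⟨fun x => Real.exp (-(κ * |(x : ℝ)|)) * (a + b * (x : ℝ)), by fun_prop⟩

/-- Where the weighted Volterra operator is a contraction, the Neumann series solves the Volterra
equation. -/
theorem weightedExtend_inverse_eq {κ : ℝ} (hκ : 0 < κ) (hT : ‖volterraOp hN hp hκ‖ < 1)
    (a b : ℂ) {x : ℝ} (hx : x ∈ Set.Icc (-N) N) :
    let y := weightedExtend hN κ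
      (Ring.inverse (1 - volterraOp hN hp hκ) (weightedAffine N κ a b))
    y x = a + b * x + ∫ t in (0 : ℝ)..x, (x - t) * (p t * y t) := by
  intro y
  set z := Ring.inverse (1 - volterraOp hN hp hκ) (weightedAffine N κ a b) with hz
  have hu : IsUnit (1 - volterraOp hN hp hκ) :=
    isUnit_one_sub_of_norm_lt_one (x := volterraOp hN hp hκ) hT
  have h1 : (1 - volterraOp hN hp hκ) z = weightedAffine N κ a b := by
    rw [hz, ← mul_apply_eq_comp, Ring.mul_inverse_cancel _ hu]
    rfl
  have h2 := congrArg (fun f : C(Set.Icc (-N) N, ℂ) => f ⟨x, hx⟩) h1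
  simp only [sub_apply, one_apply_eq_self,
    ContinuousMap.sub_apply, volterraOp_apply, weightedAffine, ContinuousMap.coe_mk] at h2
  have h3 : y x = Real.exp (κ * |x|) * z ⟨x, hx⟩ := weightedExtend_of_mem hN κ z hx
  have h4 : (Real.exp (κ * |x|) : ℂ) * Real.exp (-(κ * |x|)) = 1 := by
    rw [← Complex.ofReal_mul, ← Real.exp_add]; simp
  rw [h3]
  linear_combination (Real.exp (κ * |x|) : ℂ) * h2 +
    (a + b * x + ∫ t in (0 : ℝ)..x, (x - t) * (p t * y t)) * h4

end VolterraOperator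

/-- Existence for the Volterra equation on a bounded interval. -/
theorem exists_volterra_Icc {p : ℝ → ℂ} (hp : LocallyIntegrable p volume) (a b : ℂ) {N : ℝ}
    (hN : 0 ≤ N) : ∃ y : ℝ → ℂ, Continuous y ∧ ∀ x ∈ Set.Icc (-N) N,
      y x = a + b * x + ∫ t in (0 : ℝ)..x, (x - t) * (p t * y t) := by
  set P := ∫ t in -N..N, ‖p t‖ with hP
  have hP0 : 0 ≤ P := intervalIntegral.integral_nonneg (by linarith) fun t _ => norm_nonneg _
  have hκ : 0 < P + 1 := by linarith
  have hT : ‖volterraOp hN hp hκ‖ < 1 := by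
    refine (norm_volterraOp_le hN hp hκ).trans_lt ?_
    rw [inv_mul_lt_iff₀ hκ]
    linarith
  exact ⟨_, continuous_weightedExtend hN _ _, fun x hx =>
    weightedExtend_inverse_eq hN hp hκ hT a b hx⟩

theorem volterra_unique {p : ℝ → ℂ} (hp : LocallyIntegrable p volume) {a b : ℂ} {N : ℝ}
    {y z : ℝ → ℂ} (hy : Continuous y) (hz : Continuous z)
    (h1 : ∀ x ∈ Set.Icc (-N) N, y x = a + b * x + ∫ t in (0 : ℝ)..x, (x - t) * (p t * y t))
    (h2 : ∀ x ∈ Set.Icc (-N) N, z x = a + b * x + ∫ t in (0 : ℝ)..x, (x - t) * (p t * z t)) :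
    ∀ x ∈ Set.Icc (-N) N, y x = z x := by
  have hi : ∀ {y : ℝ → ℂ}, Continuous y → ∀ x : ℝ,
      IntervalIntegrable (fun t : ℝ => ((x : ℂ) - t) * (p t * y t)) volume 0 x := fun hy x =>
    ((hp.mul_continuous hy).continuous_mul (by fun_prop)).intervalIntegrable_real 0 x
  intro x hx
  refine sub_eq_zero.1 (volterra_eq_zero (w := fun x => y x - z x) hp (hy.sub hz)
    (fun x hx => ?_) x hx)
  simp only [mul_sub]
  rw [intervalIntegral.integral_sub (hi hy x) (hi hz x)]
  linear_combination h1 x hx - h2 x hx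

/-- Existence for the Volterra equation on the real line: the solutions on the intervals
`[-n, n]` agree where they overlap. -/
theorem exists_volterra {p : ℝ → ℂ} (hp : LocallyIntegrable p volume) (a b : ℂ) :
    ∃ y : ℝ → ℂ, Continuous y ∧ ∀ x : ℝ,
      y x = a + b * x + ∫ t in (0 : ℝ)..x, (x - t) * (p t * y t) := by
  choose Y hYc hY using fun n : ℕ => exists_volterra_Icc hp a b (Nat.cast_nonneg (α := ℝ) n)
  have hmono : ∀ {m n : ℕ}, m ≤ n → ∀ x ∈ Set.Icc (-(m : ℝ)) m, Y m x = Y n x := by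
    intro m n hmn
    have hmn' : (m : ℝ) ≤ n := Nat.cast_le.2 hmn
    exact volterra_unique hp (hYc m) (hYc n) (hY m)
      fun x hx => hY n x ⟨by linarith [hx.1], by linarith [hx.2]⟩
  set y : ℝ → ℂ := fun x => Y ⌈|x|⌉₊ x with hy
  have heq : ∀ n : ℕ, ∀ x ∈ Set.Icc (-(n : ℝ)) n, y x = Y n x := fun n x hx =>
    hmono (Nat.ceil_le.2 (abs_le.2 hx)) x (abs_le.1 (Nat.le_ceil _))
  refine ⟨y, continuous_iff_continuousAt.2 fun x => ?_, fun x => ?_⟩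
  · set n : ℕ := ⌈|x|⌉₊ + 1 with hn
    have hx : |x| < n := by
      have := Nat.le_ceil |x|
      rw [hn]; push_cast; linarith
    refine (hYc n).continuousAt.congr ?_
    filter_upwards [Ioo_mem_nhds (abs_lt.1 hx).1 (abs_lt.1 hx).2] with t ht
    exact (heq n t ⟨ht.1.le, ht.2.le⟩).symm
  · set n : ℕ := ⌈|x|⌉₊ with hn
    have hx : x ∈ Set.Icc (-(n : ℝ)) n := abs_le.1 (Nat.le_ceil _)
    rw [heq n x hx, hY n x hx]
    congr 1
    refine intervalIntegral.integral_congr fun t ht => ?_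
    have h0 : (0 : ℝ) ∈ Set.Icc (-(n : ℝ)) n := by constructor <;> simp
    rw [heq n t (Set.uIcc_subset_Icc h0 hx ht)]

/-! ### Fundamental solutions and their dependence on the spectral parameter -/

section FundamentalSolutions

variable {q : ℝ → ℂ}

theorem locallyIntegrable_sub_const (hq : LocallyIntegrable q volume) (lam : ℂ) :
    LocallyIntegrable (fun x => q x - lam) volume :=
  hq.sub (locallyIntegrable_const lam)

/-- Solutions of Hill's equation satisfy the Volterra equation. -/
theorem IsHillSolution.volterra_eq {lam : ℂ} {y : ℝ → ℂ} (h : IsHillSolution q lam y) (x : ℝ) :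
    y x = y 0 + deriv y 0 * x + ∫ t in (0 : ℝ)..x, (x - t) * ((q t - lam) * y t) := by
  have h1 : HasACDeriv (fun t : ℝ => (x : ℂ) - t) (fun _ => -1) :=
    .of_hasDerivAt (fun t => by
      simpa using (Complex.ofRealCLM.hasDerivAt (x := t)).const_sub (x : ℂ)) continuous_const
  have h2 := (h1.lagrange (.const (-1)) h.hasACDeriv h.hasACDeriv_deriv).2 x
  simp only [sub_self, zero_mul, sub_zero, Complex.ofReal_zero, zero_sub] at h2
  linear_combination h2

/-- Continuous solutions of the Volterra equation solve Hill's equation. -/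
theorem isHillSolution_of_volterra_eq (hq : LocallyIntegrable q volume) {lam a b : ℂ} {y : ℝ → ℂ}
    (hy : Continuous y)
    (h : ∀ x : ℝ, y x = a + b * x + ∫ t in (0 : ℝ)..x, (x - t) * ((q t - lam) * y t)) :
    IsHillSolution q lam y ∧ y 0 = a ∧ deriv y 0 = b := by
  have hg : LocallyIntegrable (fun t => (q t - lam) * y t) volume :=
    (locallyIntegrable_sub_const hq lam).mul_continuous hy
  have hx : HasACDeriv (fun x : ℝ => (x : ℂ)) (fun _ => 1) :=
    .of_hasDerivAt (fun t => Complex.ofRealCLM.hasDerivAt (x := t)) continuous_const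
  have htg : LocallyIntegrable (fun t : ℝ => (t : ℂ) * ((q t - lam) * y t)) volume :=
    hg.continuous_mul Complex.continuous_ofReal
  have hP := HasACDeriv.of_integral hg b
  have hY : HasACDeriv y (fun x : ℝ => b + ∫ t in (0 : ℝ)..x, (q t - lam) * y t) := by
    have h1 := ((HasACDeriv.const a).add ((hx.mul hP).sub (.of_integral htg 0))).congr
      (g' := fun x : ℝ => b + ∫ t in (0 : ℝ)..x, (q t - lam) * y t) fun x => by ring
    convert! h1 using 1
    funext x
    rw [h x]
    simp only [sub_mul]
    simp only [sub_mul] at hg htg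
    rw [intervalIntegral.integral_sub (by
      simpa only [← sub_mul] using (hg.intervalIntegrable_real 0 x).const_mul (x : ℂ))
      (htg.intervalIntegrable_real 0 x), intervalIntegral.integral_const_mul]
    ring
  refine ⟨hY.isHillSolution hP, by simpa using h 0, ?_⟩
  rw [hY.deriv_eq hP]
  simp

/-- The solution of Hill's equation with `y(0) = a`, `y'(0) = b`. -/
noncomputable def hillSol (q : ℝ → ℂ) (lam a b : ℂ) : ℝ → ℂ :=
  Classical.epsilon fun y => IsHillSolution q lam y ∧ y 0 = a ∧ deriv y 0 = b

theorem hillSol_spec (hq : LocallyIntegrable q volume) (lam a b : ℂ) :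
    IsHillSolution q lam (hillSol q lam a b) ∧ hillSol q lam a b 0 = a ∧
      deriv (hillSol q lam a b) 0 = b := by
  obtain ⟨y, hy, h⟩ := exists_volterra (locallyIntegrable_sub_const hq lam) a b
  exact Classical.epsilon_spec
    (p := fun y => IsHillSolution q lam y ∧ y 0 = a ∧ deriv y 0 = b)
    ⟨y, isHillSolution_of_volterra_eq hq hy h⟩

theorem IsHillSolution.eq_of_initial (hq : LocallyIntegrable q volume) {lam : ℂ} {y z : ℝ → ℂ}
    (hy : IsHillSolution q lam y) (hz : IsHillSolution q lam z) (h0 : y 0 = z 0)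
    (h1 : deriv y 0 = deriv z 0) : y = z := by
  funext x
  refine volterra_unique (N := |x|) (locallyIntegrable_sub_const hq lam) hy.continuous
    hz.continuous (fun t _ => hy.volterra_eq t) (fun t _ => ?_) x (abs_le.1 le_rfl)
  rw [h0, h1]
  exact hz.volterra_eq t

theorem volterraOp_sub_const {N κ : ℝ} (hN : 0 ≤ N) (hκ : 0 < κ)
    (hq : LocallyIntegrable q volume) (lam : ℂ) :
    volterraOp hN (locallyIntegrable_sub_const hq lam) hκ =
      volterraOp hN hq hκ - lam • volterraOp hN (locallyIntegrable_const (1 : ℂ)) hκ := by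
  ext z x
  have hi : ∀ {p : ℝ → ℂ}, LocallyIntegrable p volume → IntervalIntegrable
      (fun t : ℝ => ((x : ℝ) - t : ℂ) * (p t * weightedExtend hN κ z t)) volume 0 x :=
    fun hp => ((hp.mul_continuous (continuous_weightedExtend hN κ z)).continuous_mul
      (by fun_prop)).intervalIntegrable_real 0 x
  have h : ∀ t : ℝ, ((x : ℝ) - t : ℂ) * ((q t - lam) * weightedExtend hN κ z t) =
      ((x : ℝ) - t : ℂ) * (q t * weightedExtend hN κ z t) -
        lam * (((x : ℝ) - t : ℂ) * (1 * weightedExtend hN κ z t)) := fun t => by ring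
  simp only [volterraOp_apply, sub_apply, ContinuousMap.sub_apply,
    smul_apply, ContinuousMap.smul_apply, smul_eq_mul, h]
  rw [intervalIntegral.integral_sub (hi hq) ((hi (locallyIntegrable_const 1)).const_mul lam),
    intervalIntegral.integral_const_mul]
  ring

theorem differentiableAt_inverse_one_sub {R : Type*} [NormedRing R] [NormedAlgebra ℂ R]
    [HasSummableGeomSeries R] (A B : R) {lam₀ : ℂ} (h : ‖A - lam₀ • B‖ < 1) :
    DifferentiableAt ℂ (fun lam : ℂ => Ring.inverse (1 - (A - lam • B))) lam₀ := by
  have h1 : DifferentiableAt ℂ (fun lam : ℂ => 1 - (A - lam • B)) lam₀ := by fun_prop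
  exact (differentiableAt_inverse (isUnit_one_sub_of_norm_lt_one h)).comp
    (f := fun lam : ℂ => 1 - (A - lam • B)) lam₀ h1

/-- Near a given spectral parameter the solutions and their derivatives are obtained by applying
fixed continuous functionals to the resolvent of an affine family of contractions. -/
theorem differentiableAt_hillSol (hq : LocallyIntegrable q volume) (a b : ℂ) (x : ℝ) (lam₀ : ℂ) :
    DifferentiableAt ℂ (fun lam => hillSol q lam a b x) lam₀ ∧
      DifferentiableAt ℂ (fun lam => deriv (hillSol q lam a b) x) lam₀ := by
  set N := |x| with hNd
  have hN : 0 ≤ N := abs_nonneg x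
  have hxN : x ∈ Set.Icc (-N) N := abs_le.1 le_rfl
  set P := ∫ t in -N..N, ‖q t‖ with hP
  have hP0 : 0 ≤ P := intervalIntegral.integral_nonneg (by linarith) fun t _ => norm_nonneg _
  set κ := P + (‖lam₀‖ + 1) * (2 * N) + 1 with hκd
  have hκ : 0 < κ := by positivity
  set A := volterraOp hN hq hκ
  set B := volterraOp hN (locallyIntegrable_const (1 : ℂ)) hκ
  set T : ℂ → (C(Set.Icc (-N) N, ℂ) →L[ℂ] C(Set.Icc (-N) N, ℂ)) := fun lam => A - lam • B with hTd
  have hTe : ∀ lam, volterraOp hN (locallyIntegrable_sub_const hq lam) hκ = T lam :=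
    volterraOp_sub_const hN hκ hq
  have hT : ∀ lam ∈ Metric.ball lam₀ 1, ‖T lam‖ < 1 := by
    intro lam hlam
    have hlam' : ‖lam‖ ≤ ‖lam₀‖ + 1 := by
      have := norm_le_norm_add_norm_sub' lam lam₀
      rw [mem_ball_iff_norm] at hlam
      linarith
    rw [← hTe]
    refine (norm_volterraOp_le hN _ hκ).trans_lt ?_
    rw [inv_mul_lt_iff₀ hκ, mul_one]
    have hqi : IntervalIntegrable (fun t => ‖q t‖) volume (-N) N :=
      (hq.intervalIntegrable_real (-N) N).norm
    have : ∫ t in -N..N, ‖q t - lam‖ ≤ ∫ t in -N..N, (‖q t‖ + ‖lam‖) :=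
      intervalIntegral.integral_mono_on (by linarith)
        ((locallyIntegrable_sub_const hq lam).intervalIntegrable_real _ _).norm
        (hqi.add intervalIntegrable_const) fun t _ => norm_sub_le _ _
    rw [intervalIntegral.integral_add hqi intervalIntegrable_const,
      intervalIntegral.integral_const, smul_eq_mul] at this
    have h2 : (N - -N) * ‖lam‖ ≤ (‖lam₀‖ + 1) * (2 * N) := by
      rw [mul_comm, sub_neg_eq_add, ← two_mul]
      gcongr
    linarith
  set Z : ℂ → C(Set.Icc (-N) N, ℂ) := fun lam => Ring.inverse (1 - T lam) (weightedAffine N κ a b)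
    with hZ
  have hsol : ∀ lam ∈ Metric.ball lam₀ 1, ∀ t ∈ Set.Icc (-N) N,
      hillSol q lam a b t = weightedExtend hN κ (Z lam) t := by
    intro lam hlam
    obtain ⟨h1, h2, h3⟩ := hillSol_spec hq lam a b
    refine volterra_unique (locallyIntegrable_sub_const hq lam) h1.continuous
      (continuous_weightedExtend hN κ _) (fun t _ => ?_) (a := a) (b := b) (fun t ht => ?_)
    · have := h1.volterra_eq t
      rwa [h2, h3] at this
    · have h := weightedExtend_inverse_eq hN (locallyIntegrable_sub_const hq lam) hκ
        (by rw [hTe]; exact hT lam hlam) a b ht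
      rw [hTe] at h
      exact h
  have hZd : DifferentiableAt ℂ Z lam₀ := by
    have h3 := differentiableAt_inverse_one_sub
      (R := C(Set.Icc (-N) N, ℂ) →L[ℂ] C(Set.Icc (-N) N, ℂ)) A B
      (hT lam₀ (Metric.mem_ball_self one_pos))
    exact h3.clm_apply (differentiableAt_const _)
  constructor
  · have h1 : DifferentiableAt ℂ (fun lam => (Real.exp (κ * |x|) : ℂ) *
        ContinuousMap.evalCLM ℂ ⟨x, hxN⟩ (Z lam)) lam₀ := by fun_prop
    refine h1.congr_of_eventuallyEq ?_
    filter_upwards [Metric.ball_mem_nhds lam₀ one_pos] with lam hlam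
    rw [hsol lam hlam x hxN, weightedExtend_of_mem hN κ _ hxN]
    rfl
  · set F := integralFunctional hN hq κ x le_rfl hκ
    set G := integralFunctional hN (locallyIntegrable_const (1 : ℂ)) κ x le_rfl hκ
    have h1 : DifferentiableAt ℂ (fun lam => b + (F (Z lam) - lam * G (Z lam))) lam₀ := by fun_prop
    refine h1.congr_of_eventuallyEq ?_
    filter_upwards [Metric.ball_mem_nhds lam₀ one_pos] with lam hlam
    obtain ⟨h1, h2, h3⟩ := hillSol_spec hq lam a b
    have hF : ∀ {p : ℝ → ℂ}, LocallyIntegrable p volume → IntervalIntegrable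
        (fun t : ℝ => p t * weightedExtend hN κ (Z lam) t) volume 0 x := fun hp =>
      (hp.mul_continuous (continuous_weightedExtend hN κ _)).intervalIntegrable_real 0 x
    rw [h1.hasACDeriv_deriv.2 x, h3, integralFunctional_apply, integralFunctional_apply,
      ← intervalIntegral.integral_const_mul, ← intervalIntegral.integral_sub (hF hq)
        ((hF (locallyIntegrable_const 1)).const_mul lam)]
    congr 1
    refine intervalIntegral.integral_congr fun t ht => ?_
    have h0 : (0 : ℝ) ∈ Set.Icc (-N) N := ⟨by linarith, hN⟩
    rw [hsol lam hlam t (Set.uIcc_subset_Icc h0 hxN ht)]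
    ring

end FundamentalSolutions

/-! ### Floquet theory -/

section Floquet

variable {q : ℝ → ℂ} {lam : ℂ}

theorem locallyIntegrable_of_periodic (hper : Function.Periodic q (2 * Real.pi))
    (hq : MemLp q 2 (volume.restrict (Set.Ioc 0 (2 * Real.pi)))) :
    LocallyIntegrable q volume := by
  have h1 : IntervalIntegrable q volume 0 (0 + 2 * Real.pi) := by
    rw [zero_add, intervalIntegrable_iff_integrableOn_Ioc_of_le Real.two_pi_pos.le]
    exact hq.integrable one_le_two
  exact locallyIntegrable_of_intervalIntegrable fun a b =>
    hper.intervalIntegrable Real.two_pi_pos.ne' h1 a b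

theorem isHillSolution_hillU (hq : LocallyIntegrable q volume) (lam : ℂ) :
    IsHillSolution q lam (hillU q lam) ∧ hillU q lam 0 = 1 ∧ deriv (hillU q lam) 0 = 0 :=
  hillSol_spec hq lam 1 0

theorem isHillSolution_hillV (hq : LocallyIntegrable q volume) (lam : ℂ) :
    IsHillSolution q lam (hillV q lam) ∧ hillV q lam 0 = 0 ∧ deriv (hillV q lam) 0 = 1 :=
  hillSol_spec hq lam 0 1

theorem differentiable_hillDiscriminant (hq : LocallyIntegrable q volume) :
    Differentiable ℂ (hillDiscriminant q) := fun lam =>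
  (differentiableAt_hillSol hq 1 0 (2 * Real.pi) lam).1.add
    (differentiableAt_hillSol hq 0 1 (2 * Real.pi) lam).2

theorem IsHillSolution.eq_fundamental (hq : LocallyIntegrable q volume) {y : ℝ → ℂ}
    (hy : IsHillSolution q lam y) (x : ℝ) :
    y x = y 0 * hillU q lam x + deriv y 0 * hillV q lam x ∧
      deriv y x = y 0 * deriv (hillU q lam) x + deriv y 0 * deriv (hillV q lam) x := by
  obtain ⟨hu, hu0, hu1⟩ := isHillSolution_hillU hq lam
  obtain ⟨hv, hv0, hv1⟩ := isHillSolution_hillV hq lam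
  have h := hy.eq_of_initial hq (hu.linComb hv (y 0) (deriv y 0)) (by simp [hu0, hv0])
    (by rw [hu.deriv_linComb hv, hu1, hv1]; ring)
  constructor
  · exact congrFun h x
  · rw [← hu.deriv_linComb hv, ← h]

/-- The monodromy matrix at `x = 2π`, and the fundamental matrix at every `x`, has
determinant one. -/
theorem det_monodromy (hq : LocallyIntegrable q volume) (lam : ℂ) (x : ℝ) :
    hillU q lam x * deriv (hillV q lam) x - deriv (hillU q lam) x * hillV q lam x = 1 := by
  obtain ⟨hu, hu0, hu1⟩ := isHillSolution_hillU hq lam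
  obtain ⟨hv, hv0, hv1⟩ := isHillSolution_hillV hq lam
  rw [hu.wronskian_eq hv, hu0, hu1, hv0, hv1]
  ring

theorem IsHillSolution.initial_ne_zero (hq : LocallyIntegrable q volume) {y : ℝ → ℂ}
    (hy : IsHillSolution q lam y) (h : y ≠ 0) : y 0 ≠ 0 ∨ deriv y 0 ≠ 0 := by
  by_contra! h0
  refine h (funext fun x => ?_)
  rw [(hy.eq_fundamental hq x).1, h0.1, h0.2]
  simp

/-- Solutions with vanishing Wronskian are proportional. -/
theorem IsHillSolution.exists_eq_const_mul (hq : LocallyIntegrable q volume) {y z : ℝ → ℂ}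
    (hy : IsHillSolution q lam y) (hz : IsHillSolution q lam z) (h : y ≠ 0)
    (hW : y 0 * deriv z 0 - deriv y 0 * z 0 = 0) : ∃ c : ℂ, ∀ x, z x = c * y x := by
  rcases hy.initial_ne_zero hq h with h0 | h0
  · refine ⟨z 0 / y 0, fun x => ?_⟩
    have h1 : deriv z 0 = z 0 / y 0 * deriv y 0 := by field_simp; linear_combination hW
    have h2 : z 0 = z 0 / y 0 * y 0 := by field_simp
    rw [(hz.eq_fundamental hq x).1, (hy.eq_fundamental hq x).1, h1]
    linear_combination (hillU q lam x) * h2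
  · refine ⟨deriv z 0 / deriv y 0, fun x => ?_⟩
    have h1 : z 0 = deriv z 0 / deriv y 0 * y 0 := by field_simp; linear_combination -hW
    have h2 : deriv z 0 = deriv z 0 / deriv y 0 * deriv y 0 := by field_simp
    rw [(hz.eq_fundamental hq x).1, (hy.eq_fundamental hq x).1, h1]
    linear_combination (hillV q lam x) * h2

/-- A root of the characteristic polynomial of the monodromy matrix is a Floquet multiplier. -/
theorem exists_isFloquetSolution (hq : LocallyIntegrable q volume)
    (hper : Function.Periodic q (2 * Real.pi)) {ρ : ℂ}
    (hρ : ρ ^ 2 - hillDiscriminant q lam * ρ + 1 = 0) :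
    ∃ y, IsFloquetSolution q lam ρ y := by
  set u := hillU q lam (2 * Real.pi) with hu
  set v := hillV q lam (2 * Real.pi) with hv
  set u' := deriv (hillU q lam) (2 * Real.pi) with hu'
  set v' := deriv (hillV q lam) (2 * Real.pi) with hv'
  have hdet : u * v' - u' * v = 1 := det_monodromy hq lam _
  have hchar : (u - ρ) * (v' - ρ) - u' * v = 0 := by
    have : hillDiscriminant q lam = u + v' := rfl
    rw [this] at hρ
    linear_combination hρ + hdet
  obtain ⟨a, b, hab, h1, h2⟩ : ∃ a b : ℂ, (a ≠ 0 ∨ b ≠ 0) ∧ a * u + b * v = ρ * a ∧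
      a * u' + b * v' = ρ * b := by
    by_cases hvu : v = 0 ∧ ρ - u = 0
    · by_cases hvu' : ρ - v' = 0 ∧ u' = 0
      · refine ⟨1, 0, Or.inl one_ne_zero, ?_, ?_⟩
        · linear_combination -hvu.2
        · linear_combination hvu'.2
      · refine ⟨ρ - v', u', by tauto, ?_, ?_⟩
        · linear_combination -(ρ - v') * hvu.2 + u' * hvu.1
        · ring
    · refine ⟨v, ρ - u, by tauto, by ring, ?_⟩
      linear_combination -hchar
  obtain ⟨hy, hy0, hy1⟩ := hillSol_spec hq lam a b
  refine ⟨hillSol q lam a b, hy, ?_, ?_⟩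
  · intro h
    rw [h] at hy0 hy1
    rcases hab with h | h
    · exact h hy0.symm
    · exact h (by rw [← hy1]; exact deriv_const _ _)
  · intro x
    obtain ⟨e1, e2⟩ := hy.eq_fundamental hq (2 * Real.pi)
    rw [hy0, hy1] at e1 e2
    have h := (hy.comp_add_right hper).eq_of_initial hq (hy.linComb hy ρ 0)
      (by simp only [zero_add]; rw [e1, hy0]; linear_combination h1)
      (by rw [hy.deriv_comp_add_right, hy.deriv_linComb hy, zero_add, e2, hy1]
          linear_combination h2)
    have := congrFun h x
    simpa using this

/-- The Cayley–Hamilton identity for the monodromy. -/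
theorem IsHillSolution.cayley_hamilton (hq : LocallyIntegrable q volume)
    (hper : Function.Periodic q (2 * Real.pi)) {y : ℝ → ℂ} (hy : IsHillSolution q lam y) (x : ℝ) :
    y (x + 2 * Real.pi + 2 * Real.pi) = hillDiscriminant q lam * y (x + 2 * Real.pi) - y x := by
  have hy1 := hy.comp_add_right hper
  have hy2 := hy1.comp_add_right hper
  have hdet := det_monodromy hq lam (2 * Real.pi)
  obtain ⟨a1, b1⟩ := hy.eq_fundamental hq (2 * Real.pi)
  obtain ⟨a2, b2⟩ := hy1.eq_fundamental hq (2 * Real.pi)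
  simp only [hy.deriv_comp_add_right, zero_add] at a2 b2
  have h := hy2.eq_of_initial hq (hy1.linComb hy (hillDiscriminant q lam) (-1))
    (by
      simp only [zero_add]
      rw [a2, b1, a1, hillDiscriminant]
      linear_combination -(y 0) * hdet)
    (by
      rw [hy1.deriv_comp_add_right, hy1.deriv_linComb hy, hy.deriv_comp_add_right,
        hy.deriv_comp_add_right, zero_add, b2, b1, a1, hillDiscriminant]
      linear_combination -(deriv y 0) * hdet)
  rw [congrFun h x]
  ring

theorem IsFloquetSolution.multiplier_eq (hq : LocallyIntegrable q volume)
    (hper : Function.Periodic q (2 * Real.pi)) {ρ : ℂ} {y : ℝ → ℂ}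
    (hy : IsFloquetSolution q lam ρ y) : ρ ^ 2 - hillDiscriminant q lam * ρ + 1 = 0 := by
  obtain ⟨h1, h2, h3⟩ := hy
  obtain ⟨x, hx⟩ := Function.ne_iff.1 h2
  have := h1.cayley_hamilton hq hper x
  rw [h3, h3] at this
  exact (mul_eq_zero.1 (by linear_combination this :
    (ρ ^ 2 - hillDiscriminant q lam * ρ + 1) * y x = 0)).resolve_right hx

/-- Floquet solutions with different multipliers are linearly independent. -/
theorem IsFloquetSolution.wronskian_ne_zero (hq : LocallyIntegrable q volume) {ρ σ : ℂ}
    (hρσ : ρ ≠ σ) {y z : ℝ → ℂ} (hy : IsFloquetSolution q lam ρ y)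
    (hz : IsFloquetSolution q lam σ z) : y 0 * deriv z 0 - deriv y 0 * z 0 ≠ 0 := by
  intro hW
  obtain ⟨c, hc⟩ := hy.1.exists_eq_const_mul hq hz.1 hy.2.1 hW
  obtain ⟨x, hx⟩ := Function.ne_iff.1 hz.2.1
  have h1 := hz.2.2 x
  rw [hc (x + 2 * Real.pi), hy.2.2, mul_left_comm, ← hc] at h1
  exact hρσ (mul_right_cancel₀ hx h1)

/-- Coexistence makes the monodromy matrix scalar. As its determinant is constant, its trace is
then critical. -/
theorem deriv_hillDiscriminant_of_coexistence (hq : LocallyIntegrable q volume)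
    (hper : Function.Periodic q (2 * Real.pi)) (hD : hillDiscriminant q lam = 2)
    (hco : HillCoexistence q lam) : deriv (hillDiscriminant q) lam = 0 := by
  obtain ⟨-, ρ₁, ρ₂, y₁, y₂, h1, h2, hli⟩ := hco
  have hρ : ∀ {ρ : ℂ} {y : ℝ → ℂ}, IsFloquetSolution q lam ρ y → ρ = 1 := fun h => by
    have := h.multiplier_eq hq hper
    rw [hD] at this
    exact sub_eq_zero.1 (pow_eq_zero_iff two_ne_zero |>.1 (by linear_combination this))
  obtain rfl := hρ h1
  obtain rfl := hρ h2
  have hW : y₁ 0 * deriv y₂ 0 - deriv y₁ 0 * y₂ 0 ≠ 0 := by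
    intro hW
    obtain ⟨c, hc⟩ := h1.1.exists_eq_const_mul hq h2.1 h1.2.1 hW
    have := (LinearIndependent.pair_iff.1 hli c (-1) (by ext x; simp [hc])).2
    norm_num at this
  have hfix : ∀ {y : ℝ → ℂ}, IsFloquetSolution q lam 1 y → y (2 * Real.pi) = y 0 ∧
      deriv y (2 * Real.pi) = deriv y 0 := fun {y} h => by
    constructor
    · simpa using h.2.2 0
    · have e := h.1.deriv_comp_add_right (2 * Real.pi) 0
      rw [zero_add] at e
      rw [← e]
      congr 1
      funext x
      simpa using h.2.2 x
  obtain ⟨a1, b1⟩ := h1.1.eq_fundamental hq (2 * Real.pi)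
  obtain ⟨a2, b2⟩ := h2.1.eq_fundamental hq (2 * Real.pi)
  rw [(hfix h1).1] at a1
  rw [(hfix h1).2] at b1
  rw [(hfix h2).1] at a2
  rw [(hfix h2).2] at b2
  have hu : hillU q lam (2 * Real.pi) = 1 := mul_left_cancel₀ hW (by
    linear_combination deriv y₁ 0 * a2 - deriv y₂ 0 * a1)
  have hv : hillV q lam (2 * Real.pi) = 0 := mul_left_cancel₀ hW (by
    linear_combination y₂ 0 * a1 - y₁ 0 * a2)
  have hu' : deriv (hillU q lam) (2 * Real.pi) = 0 := mul_left_cancel₀ hW (by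
    linear_combination deriv y₁ 0 * b2 - deriv y₂ 0 * b1)
  have hv' : deriv (hillV q lam) (2 * Real.pi) = 1 := mul_left_cancel₀ hW (by
    linear_combination y₂ 0 * b1 - y₁ 0 * b2)
  have du := (differentiableAt_hillSol hq 1 0 (2 * Real.pi) lam).1.hasDerivAt
  have du' := (differentiableAt_hillSol hq 1 0 (2 * Real.pi) lam).2.hasDerivAt
  have dv := (differentiableAt_hillSol hq 0 1 (2 * Real.pi) lam).1.hasDerivAt
  have dv' := (differentiableAt_hillSol hq 0 1 (2 * Real.pi) lam).2.hasDerivAt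
  have hdet := ((du.mul dv').sub (du'.mul dv)).unique
    ((hasDerivAt_const lam (1 : ℂ)).congr_of_eventuallyEq
      (.of_forall fun μ => det_monodromy hq μ (2 * Real.pi)))
  have e1 : hillSol q lam 1 0 (2 * Real.pi) = 1 := hu
  have e2 : hillSol q lam 0 1 (2 * Real.pi) = 0 := hv
  have e3 : deriv (hillSol q lam 1 0) (2 * Real.pi) = 0 := hu'
  have e4 : deriv (hillSol q lam 0 1) (2 * Real.pi) = 1 := hv'
  rw [e1, e2, e3, e4] at hdet
  have hs : deriv (hillDiscriminant q) lam = _ := (du.add dv').deriv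
  rw [hs]
  linear_combination hdet

theorem exists_multiplier_of_norm_eq_one {D : ℝ} (hD : |D| ≤ 2) :
    ∃ ρ : ℂ, ‖ρ‖ = 1 ∧ ρ ^ 2 - D * ρ + 1 = 0 := by
  obtain ⟨h1, h2⟩ := abs_le.1 hD
  refine ⟨Complex.exp (Real.arccos (D / 2) * Complex.I), Complex.norm_exp_ofReal_mul_I _, ?_⟩
  have hc : Real.cos (Real.arccos (D / 2)) = D / 2 :=
    Real.cos_arccos (by linarith) (by linarith)
  have hc' : Complex.cos (Real.arccos (D / 2)) = D / 2 := by
    rw [← Complex.ofReal_cos, hc]; push_cast; rfl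
  have hs := Complex.sin_sq_add_cos_sq (Real.arccos (D / 2))
  rw [Complex.exp_mul_I, hc']
  rw [hc'] at hs
  linear_combination -hs + Complex.sin (Real.arccos (D / 2)) ^ 2 * Complex.I_sq

/-- The roots `ρ`, `ρ⁻¹` of `ρ² - D ρ + 1` are unimodular only if `D = ρ + ρ⁻¹ = 2 Re ρ`. -/
theorem exists_multiplier_of_norm_lt_one {D : ℂ} (hD : ∀ x : ℝ, |x| ≤ 2 → D ≠ x) :
    ∃ ρ : ℂ, ρ ≠ 0 ∧ ‖ρ‖ < 1 ∧ ρ ^ 2 - D * ρ + 1 = 0 ∧ ρ⁻¹ ^ 2 - D * ρ⁻¹ + 1 = 0 := by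
  obtain ⟨s, hs⟩ := IsAlgClosed.exists_pow_nat_eq (D ^ 2 - 4) two_pos
  have hroot : ∃ ρ : ℂ, ρ ^ 2 - D * ρ + 1 = 0 := ⟨(D + s) / 2, by linear_combination hs / 4⟩
  have hne : ∀ ρ : ℂ, ρ ^ 2 - D * ρ + 1 = 0 → ρ ≠ 0 := by
    rintro ρ h rfl
    norm_num at h
  have hinv : ∀ ρ : ℂ, ρ ^ 2 - D * ρ + 1 = 0 → ρ⁻¹ ^ 2 - D * ρ⁻¹ + 1 = 0 := by
    intro ρ h
    have := hne ρ h
    field_simp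
    linear_combination h
  have hn1 : ∀ ρ : ℂ, ρ ^ 2 - D * ρ + 1 = 0 → ‖ρ‖ ≠ 1 := by
    intro ρ h hn
    have h0 := hne ρ h
    refine hD (2 * ρ.re) ?_ ?_
    · have := Complex.abs_re_le_norm ρ
      rw [hn] at this
      rw [abs_mul, abs_two]
      linarith
    · have h1 : D = ρ + ρ⁻¹ := by field_simp; linear_combination -h
      rw [h1, Complex.inv_eq_conj hn, Complex.add_conj]
  obtain ⟨ρ, h⟩ := hroot
  rcases lt_or_gt_of_ne (hn1 ρ h) with hlt | hgt
  · exact ⟨ρ, hne ρ h, hlt, h, hinv ρ h⟩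
  · refine ⟨ρ⁻¹, inv_ne_zero (hne ρ h), ?_, hinv ρ h, by rwa [inv_inv]⟩
    rw [norm_inv]
    exact inv_lt_one_of_one_lt₀ hgt

end Floquet

/-! ### Asymptotics of the discriminant -/

section Asymptotics

variable {q : ℝ → ℂ}

theorem norm_exp_mul_I_le (k : ℂ) {s : ℝ} (hs : 0 ≤ s) :
    ‖Complex.exp (k * s * Complex.I)‖ ≤ Real.exp (|k.im| * s) ∧
      ‖Complex.exp (-(k * s) * Complex.I)‖ ≤ Real.exp (|k.im| * s) := by
  rw [Complex.norm_exp, Complex.norm_exp]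
  constructor
  · refine Real.exp_le_exp.2 ?_
    simp
    nlinarith [neg_abs_le k.im]
  · refine Real.exp_le_exp.2 ?_
    simp
    nlinarith [le_abs_self k.im]

theorem norm_cos_mul_le (k : ℂ) {s : ℝ} (hs : 0 ≤ s) :
    ‖Complex.cos (k * s)‖ ≤ Real.exp (|k.im| * s) := by
  obtain ⟨h1, h2⟩ := norm_exp_mul_I_le k hs
  rw [Complex.cos, norm_div, Complex.norm_ofNat]
  linarith [norm_add_le (Complex.exp (k * s * Complex.I)) (Complex.exp (-(k * s) * Complex.I))]

theorem norm_sin_mul_le (k : ℂ) {s : ℝ} (hs : 0 ≤ s) :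
    ‖Complex.sin (k * s)‖ ≤ Real.exp (|k.im| * s) := by
  obtain ⟨h1, h2⟩ := norm_exp_mul_I_le k hs
  rw [Complex.sin, norm_div, Complex.norm_ofNat, norm_mul, Complex.norm_I, mul_one]
  linarith [norm_sub_le (Complex.exp (-(k * s) * Complex.I)) (Complex.exp (k * s * Complex.I))]

theorem hasDerivAt_sin_mul_sub (k : ℂ) (x t : ℝ) :
    HasDerivAt (fun t : ℝ => Complex.sin (k * (x - t))) (-k * Complex.cos (k * (x - t))) t := by
  have h := ((Complex.ofRealCLM.hasDerivAt (x := t)).const_sub (x : ℂ)).const_mul k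
  have h2 := (Complex.hasDerivAt_sin (k * (x - t))).comp t h
  refine h2.congr_deriv ?_
  simp only [Complex.ofRealCLM_apply, Complex.ofReal_one]
  ring

theorem hasDerivAt_cos_mul_sub (k : ℂ) (x t : ℝ) :
    HasDerivAt (fun t : ℝ => Complex.cos (k * (x - t))) (k * Complex.sin (k * (x - t))) t := by
  have h := ((Complex.ofRealCLM.hasDerivAt (x := t)).const_sub (x : ℂ)).const_mul k
  have h2 := (Complex.hasDerivAt_cos (k * (x - t))).comp t h
  refine h2.congr_deriv ?_
  simp only [Complex.ofRealCLM_apply, Complex.ofReal_one]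
  ring

theorem hasACDeriv_sin_mul_sub (k : ℂ) (x : ℝ) : HasACDeriv
    (fun t : ℝ => Complex.sin (k * (x - t))) (fun t : ℝ => -k * Complex.cos (k * (x - t))) :=
  .of_hasDerivAt (hasDerivAt_sin_mul_sub k x) (by fun_prop)

theorem hasACDeriv_cos_mul_sub (k : ℂ) (x : ℝ) : HasACDeriv
    (fun t : ℝ => Complex.cos (k * (x - t))) (fun t : ℝ => k * Complex.sin (k * (x - t))) :=
  .of_hasDerivAt (hasDerivAt_cos_mul_sub k x) (by fun_prop)

/-- Variation of constants relative to `-y'' = k² y`. -/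
theorem IsHillSolution.variation_of_constants {k : ℂ} (hk : k ≠ 0) {y : ℝ → ℂ}
    (hy : IsHillSolution q (k ^ 2) y) (x : ℝ) :
    y x = y 0 * Complex.cos (k * x) + deriv y 0 * (Complex.sin (k * x) / k) +
      k⁻¹ * ∫ t in (0 : ℝ)..x, Complex.sin (k * (x - t)) * (q t * y t) := by
  have h := ((hasACDeriv_sin_mul_sub k x).lagrange ((hasACDeriv_cos_mul_sub k x).const_mul (-k))
    hy.hasACDeriv hy.hasACDeriv_deriv).congr
    (g' := fun t => Complex.sin (k * (x - t)) * (q t * y t)) fun t => by ring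
  have h2 := h.2 x
  simp only [sub_self, mul_zero, Complex.sin_zero, Complex.cos_zero, Complex.ofReal_zero,
    sub_zero, zero_mul, mul_one, zero_sub] at h2
  generalize (∫ t in (0 : ℝ)..x, Complex.sin (k * (x - t)) * (q t * y t)) = J at h2 ⊢
  field_simp
  linear_combination h2

theorem IsHillSolution.variation_of_constants_deriv {k : ℂ} {y : ℝ → ℂ}
    (hy : IsHillSolution q (k ^ 2) y) (x : ℝ) :
    deriv y x = deriv y 0 * Complex.cos (k * x) - k * (y 0 * Complex.sin (k * x)) +
      ∫ t in (0 : ℝ)..x, Complex.cos (k * (x - t)) * (q t * y t) := by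
  have h := ((hasACDeriv_cos_mul_sub k x).lagrange ((hasACDeriv_sin_mul_sub k x).const_mul k)
    hy.hasACDeriv hy.hasACDeriv_deriv).congr
    (g' := fun t => Complex.cos (k * (x - t)) * (q t * y t)) fun t => by ring
  have h2 := h.2 x
  simp only [sub_self, mul_zero, Complex.sin_zero, Complex.cos_zero, Complex.ofReal_zero,
    sub_zero, zero_mul, one_mul] at h2
  linear_combination h2

/-- A weighted bound for the integral terms in the variation of constants formulas, where `f` is
sine or cosine and `w` grows at most like `exp (|Im k| t)`. -/
theorem norm_integral_trig_le (hq : LocallyIntegrable q volume) {f : ℂ → ℂ} {k : ℂ}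
    (hf : ∀ s : ℝ, 0 ≤ s → ‖f (k * s)‖ ≤ Real.exp (|k.im| * s)) {w : ℝ → ℂ} {x T B : ℝ}
    (hx : x ∈ Set.Icc 0 T) (hB : 0 ≤ B)
    (hw : ∀ t ∈ Set.Icc 0 T, ‖w t‖ ≤ B * Real.exp (|k.im| * t)) :
    ‖∫ t in (0 : ℝ)..x, f (k * (x - t)) * (q t * w t)‖ ≤
      B * Real.exp (|k.im| * x) * ∫ t in -T..T, ‖q t‖ := by
  refine norm_integral_zero_le hq (abs_le.2 ⟨by linarith [hx.1, hx.2], hx.2⟩) (by positivity)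
    fun t ht => ?_
  rw [Set.uIoc_of_le hx.1] at ht
  have h1 := hf (x - t) (by linarith [ht.2])
  have h2 := hw t ⟨ht.1.le, ht.2.trans hx.2⟩
  push_cast at h1
  rw [norm_mul, norm_mul]
  calc ‖f (k * (x - t))‖ * (‖q t‖ * ‖w t‖)
      ≤ Real.exp (|k.im| * (x - t)) * (‖q t‖ * (B * Real.exp (|k.im| * t))) := by gcongr
    _ = B * (Real.exp (|k.im| * (x - t)) * Real.exp (|k.im| * t)) * ‖q t‖ := by ring
    _ = _ := by rw [← Real.exp_add]; ring_nf

/-- For large `k` the solutions are close to those of `-y'' = k² y`. -/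
theorem IsHillSolution.norm_sub_free_le (hq : LocallyIntegrable q volume) {k : ℂ} {T B : ℝ}
    (hT : 0 ≤ T) (hk : 2 * (∫ t in -T..T, ‖q t‖) + 1 ≤ ‖k‖) (hB : 0 ≤ B) {y : ℝ → ℂ}
    (hy : IsHillSolution q (k ^ 2) y)
    (hfree : ∀ x ∈ Set.Icc 0 T, ‖y 0 * Complex.cos (k * x) +
      deriv y 0 * (Complex.sin (k * x) / k)‖ ≤ B * Real.exp (|k.im| * x)) :
    ∀ x ∈ Set.Icc 0 T,
      ‖y x - (y 0 * Complex.cos (k * x) + deriv y 0 * (Complex.sin (k * x) / k))‖ ≤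
        2 * B * (∫ t in -T..T, ‖q t‖) / ‖k‖ * Real.exp (|k.im| * x) := by
  set P := ∫ t in -T..T, ‖q t‖ with hP
  have hP0 : 0 ≤ P := intervalIntegral.integral_nonneg (by linarith) fun t _ => norm_nonneg _
  have hk1 : 0 < ‖k‖ := by linarith
  have hk0 : k ≠ 0 := norm_pos_iff.1 hk1
  have key : ∀ M : ℝ, 0 ≤ M → (∀ t ∈ Set.Icc 0 T, ‖y t‖ ≤ M * Real.exp (|k.im| * t)) →
      ∀ x ∈ Set.Icc 0 T,
      ‖y x - (y 0 * Complex.cos (k * x) + deriv y 0 * (Complex.sin (k * x) / k))‖ ≤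
        M * P / ‖k‖ * Real.exp (|k.im| * x) := by
    intro M hM hMt x hx
    rw [hy.variation_of_constants hk0 x, add_sub_cancel_left, norm_mul, norm_inv,
      inv_mul_le_iff₀ hk1]
    refine (norm_integral_trig_le hq (fun s hs => norm_sin_mul_le k hs) hx hM hMt).trans
      (le_of_eq ?_)
    rw [← hP]
    field_simp
  -- the weighted supremum `M` of `y` satisfies `M ≤ B + M / 2`
  obtain ⟨x₀, hx₀, hmax⟩ := isCompact_Icc.exists_isMaxOn (Set.nonempty_Icc.2 hT)
    (f := fun x => Real.exp (-(|k.im| * x)) * ‖y x‖)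
    (by have := hy.continuous; fun_prop)
  set M := Real.exp (-(|k.im| * x₀)) * ‖y x₀‖ with hM
  have hM0 : 0 ≤ M := by positivity
  have hle : ∀ t ∈ Set.Icc 0 T, ‖y t‖ ≤ M * Real.exp (|k.im| * t) := fun t ht => by
    have := hmax ht
    simp only [Set.mem_ofPred_eq, Real.exp_neg] at this
    rwa [inv_mul_le_iff₀ (Real.exp_pos _), ← Real.exp_neg, ← hM, mul_comm] at this
  have h1 := key M hM0 hle x₀ hx₀
  have h2 := hfree x₀ hx₀
  have h3 : ‖y x₀‖ ≤ (M * P / ‖k‖ + B) * Real.exp (|k.im| * x₀) := by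
    rw [add_mul]
    refine le_trans ?_ (add_le_add h1 h2)
    exact norm_le_norm_sub_add _ _
  have h4 : M ≤ M * P / ‖k‖ + B := by
    rw [hM, Real.exp_neg, inv_mul_le_iff₀ (Real.exp_pos _), ← Real.exp_neg, ← hM, mul_comm]
    exact h3
  have h5 : M * P / ‖k‖ ≤ M / 2 := by
    rw [div_le_div_iff₀ hk1 two_pos]
    nlinarith
  refine key (2 * B) (by positivity) fun t ht => (hle t ht).trans ?_
  gcongr
  linarith

/-- The discriminant up to second order, `Δ(k²) = 2 cos (2πk) + (∫ q) sin (2πk) / k + O(k⁻²)` with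
exponential weights: the free solutions are inserted into the variation of constants formulas. -/
theorem exists_hillDiscriminant_asymptotics (hq : LocallyIntegrable q volume) :
    ∃ C K : ℝ, 0 ≤ C ∧ 1 ≤ K ∧ ∀ k : ℂ, K ≤ ‖k‖ →
      ‖hillDiscriminant q (k ^ 2) - 2 * Complex.cos (2 * Real.pi * k) -
        (∫ t in (0 : ℝ)..(2 * Real.pi), q t) * (Complex.sin (2 * Real.pi * k) / k)‖ ≤
        C * Real.exp (2 * Real.pi * |k.im|) / ‖k‖ ^ 2 := by
  set T : ℝ := 2 * Real.pi with hT
  have hT0 : 0 ≤ T := Real.two_pi_pos.le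
  set P := ∫ t in -T..T, ‖q t‖ with hP
  have hP0 : 0 ≤ P := intervalIntegral.integral_nonneg (by linarith) fun t _ => norm_nonneg _
  refine ⟨4 * P ^ 2, 2 * P + 1, by positivity, by linarith, fun k hk => ?_⟩
  have hk1 : 0 < ‖k‖ := by linarith
  have hk0 : k ≠ 0 := norm_pos_iff.1 hk1
  obtain ⟨hu, hu0, hu1⟩ := isHillSolution_hillU hq (k ^ 2)
  obtain ⟨hv, hv0, hv1⟩ := isHillSolution_hillV hq (k ^ 2)
  set u := hillU q (k ^ 2)
  set v := hillV q (k ^ 2)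
  have hTT : T ∈ Set.Icc 0 T := ⟨hT0, le_rfl⟩
  have bu := hu.norm_sub_free_le hq hT0 hk zero_le_one (fun x hx => by
    rw [hu0, hu1, one_mul, zero_mul, add_zero, one_mul]
    exact norm_cos_mul_le k hx.1)
  have bv := hv.norm_sub_free_le hq hT0 hk (B := ‖k‖⁻¹) (by positivity) (fun x hx => by
    rw [hv0, hv1, one_mul, zero_mul, zero_add, norm_div, div_eq_inv_mul]
    gcongr
    exact norm_sin_mul_le k hx.1)
  simp only [hu0, hu1, hv0, hv1, one_mul, zero_mul, add_zero, zero_add] at bu bv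
  have hu2 := hu.variation_of_constants hk0 T
  have hv2 := hv.variation_of_constants_deriv T
  rw [hu0, hu1] at hu2
  rw [hv0, hv1] at hv2
  have I1 := norm_integral_trig_le hq (fun s hs => norm_sin_mul_le k hs) hTT
    (w := fun t => u t - Complex.cos (k * t)) (by positivity) bu
  have I2 := norm_integral_trig_le hq (fun s hs => norm_cos_mul_le k hs) hTT
    (w := fun t => v t - Complex.sin (k * t) / k) (by positivity) bv
  have hint : ∀ {f w : ℝ → ℂ}, Continuous f → Continuous w →
      IntervalIntegrable (fun t => f t * (q t * w t)) volume 0 T := fun hf hw =>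
    ((hq.mul_continuous hw).continuous_mul hf).intervalIntegrable_real 0 T
  have cu := hu.continuous
  have cv := hv.continuous
  have e1 : ∫ t in (0 : ℝ)..T, Complex.sin (k * (T - t)) * (q t * (u t - Complex.cos (k * t))) =
      (∫ t in (0 : ℝ)..T, Complex.sin (k * (T - t)) * (q t * u t)) -
      ∫ t in (0 : ℝ)..T, Complex.sin (k * (T - t)) * (q t * Complex.cos (k * t)) := by
    rw [← intervalIntegral.integral_sub (hint (by fun_prop) cu) (hint (by fun_prop) (by fun_prop))]
    simp only [mul_sub]
  have e2 : ∫ t in (0 : ℝ)..T, Complex.cos (k * (T - t)) *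
        (q t * (v t - Complex.sin (k * t) / k)) =
      (∫ t in (0 : ℝ)..T, Complex.cos (k * (T - t)) * (q t * v t)) -
      ∫ t in (0 : ℝ)..T, Complex.cos (k * (T - t)) * (q t * (Complex.sin (k * t) / k)) := by
    rw [← intervalIntegral.integral_sub (hint (by fun_prop) cv) (hint (by fun_prop) (by fun_prop))]
    simp only [mul_sub]
  have e3 : k⁻¹ * (∫ t in (0 : ℝ)..T, Complex.sin (k * (T - t)) * (q t * Complex.cos (k * t))) +
      (∫ t in (0 : ℝ)..T, Complex.cos (k * (T - t)) * (q t * (Complex.sin (k * t) / k))) =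
      (∫ t in (0 : ℝ)..T, q t) * (Complex.sin (k * T) / k) := by
    rw [← intervalIntegral.integral_const_mul, ← intervalIntegral.integral_add
      ((hint (by fun_prop) (by fun_prop)).const_mul _) (hint (by fun_prop) (by fun_prop)),
      ← intervalIntegral.integral_mul_const]
    congr 1
    funext t
    have : k * T = k * (T - t) + k * t := by ring
    rw [this, Complex.sin_add]
    field_simp
  have hD : hillDiscriminant q (k ^ 2) = u T + deriv v T := rfl
  have e4 : hillDiscriminant q (k ^ 2) - 2 * Complex.cos (T * k) -
      (∫ t in (0 : ℝ)..T, q t) * (Complex.sin (T * k) / k) =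
      k⁻¹ * (∫ t in (0 : ℝ)..T, Complex.sin (k * (T - t)) * (q t * (u t - Complex.cos (k * t)))) +
      ∫ t in (0 : ℝ)..T, Complex.cos (k * (T - t)) * (q t * (v t - Complex.sin (k * t) / k)) := by
    rw [hD, hu2, hv2, e1, e2, mul_comm (T : ℂ) k, ← e3]
    ring
  have hTc : (2 * Real.pi : ℂ) = (T : ℂ) := by rw [hT]; push_cast; rfl
  rw [hTc, e4]
  refine (norm_add_le _ _).trans ?_
  rw [norm_mul, norm_inv]
  calc _ ≤ ‖k‖⁻¹ * (2 * 1 * P / ‖k‖ * Real.exp (|k.im| * T) * P) +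
        2 * ‖k‖⁻¹ * P / ‖k‖ * Real.exp (|k.im| * T) * P := by gcongr
    _ = _ := by
      rw [mul_comm T]
      field_simp
      ring

end Asymptotics

/-! ### Weyl sequences from Floquet solutions with unimodular multiplier -/

section WeylSequence

variable {q : ℝ → ℂ} {lam : ℂ}

theorem IsFloquetSolution.deriv_add {ρ : ℂ} {y : ℝ → ℂ} (hy : IsFloquetSolution q lam ρ y)
    (x : ℝ) : deriv y (x + 2 * Real.pi) = ρ * deriv y x := by
  rw [← hy.1.deriv_comp_add_right, funext hy.2.2]
  exact ((hy.1.hasDerivAt x).const_mul ρ).deriv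

theorem exists_norm_le_of_periodic {f : ℝ → ℂ} (hf : Continuous f) {T : ℝ} (hT : 0 < T)
    (h : ∀ x, ‖f (x + T)‖ = ‖f x‖) : ∃ K : ℝ, 0 < K ∧ ∀ x, ‖f x‖ ≤ K := by
  have hp : Function.Periodic (fun x => ‖f x‖) T := h
  obtain ⟨K, hK⟩ := isCompact_Icc.bddAbove_image (K := Set.Icc 0 T) (f := fun x => ‖f x‖)
    (by fun_prop)
  refine ⟨max K 1, by positivity, fun x => le_trans ?_ (le_max_left K 1)⟩
  obtain ⟨t, ht, hxt⟩ := hp.exists_mem_Ico₀ hT x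
  have hK' := hK ⟨t, ⟨ht.1, ht.2.le⟩, rfl⟩
  simp only at hxt hK'
  rwa [hxt]

/-- The cut-off `1 / (1 + ε² x²)`, slowly varying for small `ε`. -/
noncomputable def cutoff (ε x : ℝ) : ℝ := (1 + ε ^ 2 * x ^ 2)⁻¹

/-- The derivative of `cutoff`. -/
noncomputable def cutoff₁ (ε x : ℝ) : ℝ := -(2 * ε ^ 2 * x) * cutoff ε x ^ 2

/-- The second derivative of `cutoff`. -/
noncomputable def cutoff₂ (ε x : ℝ) : ℝ :=
  -(2 * ε ^ 2) * cutoff ε x ^ 2 - 2 * (2 * ε ^ 2 * x) * (cutoff ε x * cutoff₁ ε x)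

theorem cutoff_pos (ε x : ℝ) : 0 < cutoff ε x := by unfold cutoff; positivity

theorem cutoff_le_one (ε x : ℝ) : cutoff ε x ≤ 1 :=
  inv_le_one_of_one_le₀ (by nlinarith [sq_nonneg (ε * x)])

theorem hasDerivAt_cutoff (ε x : ℝ) : HasDerivAt (cutoff ε) (cutoff₁ ε x) x := by
  have h0 : (1 + ε ^ 2 * x ^ 2) ≠ 0 := by positivity
  have h := ((((hasDerivAt_id x).pow 2).const_mul (ε ^ 2)).const_add 1).inv h0
  refine h.congr_deriv ?_
  simp only [cutoff₁, cutoff, id, Pi.pow_apply]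
  field_simp
  norm_num
  ring

theorem hasDerivAt_cutoff₁ (ε x : ℝ) : HasDerivAt (cutoff₁ ε) (cutoff₂ ε x) x := by
  have h := (((hasDerivAt_id x).const_mul (2 * ε ^ 2)).neg).mul ((hasDerivAt_cutoff ε x).pow 2)
  refine h.congr_deriv ?_
  simp only [cutoff₂, id]
  simp
  ring

theorem abs_cutoff₁_le {ε : ℝ} (hε : 0 ≤ ε) (x : ℝ) : |cutoff₁ ε x| ≤ ε * cutoff ε x := by
  have h0 := cutoff_pos ε x
  have h1 : (1 + ε ^ 2 * x ^ 2) * cutoff ε x = 1 := mul_inv_cancel₀ (by positivity)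
  have h2 : |ε * x| * cutoff ε x ≤ 1 / 2 := by
    nlinarith [sq_nonneg (|ε * x| - 1), sq_abs (ε * x)]
  rw [cutoff₁, abs_mul, abs_neg, abs_of_nonneg (sq_nonneg (cutoff ε x))]
  rw [abs_mul] at h2
  rw [abs_mul, abs_of_nonneg (by positivity : 0 ≤ 2 * ε ^ 2)]
  rw [abs_of_nonneg hε] at h2
  nlinarith [mul_le_mul_of_nonneg_left h2 (by positivity : 0 ≤ 2 * ε * cutoff ε x)]

theorem abs_cutoff₂_le {ε : ℝ} (hε : 0 ≤ ε) (x : ℝ) : |cutoff₂ ε x| ≤ 6 * ε ^ 2 * cutoff ε x := by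
  have h0 := cutoff_pos ε x
  have h1 : (1 + ε ^ 2 * x ^ 2) * cutoff ε x = 1 := mul_inv_cancel₀ (by positivity)
  have h2 : |ε * x| * cutoff ε x ≤ 1 / 2 := by
    nlinarith [sq_nonneg (|ε * x| - 1), sq_abs (ε * x)]
  rw [abs_mul, abs_of_nonneg hε] at h2
  have h3 := abs_cutoff₁_le hε x
  have h4 := cutoff_le_one ε x
  have e1 : |-(2 * ε ^ 2) * cutoff ε x ^ 2| = 2 * ε ^ 2 * cutoff ε x ^ 2 := by
    rw [neg_mul, abs_neg, abs_of_nonneg (by positivity)]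
  have e2 : |2 * (2 * ε ^ 2 * x) * (cutoff ε x * cutoff₁ ε x)| =
      4 * ε * (ε * |x| * cutoff ε x) * |cutoff₁ ε x| := by
    simp only [abs_mul, abs_of_pos h0, abs_two, abs_pow, abs_of_nonneg hε]
    ring
  rw [cutoff₂]
  refine (abs_sub _ _).trans ?_
  rw [e1, e2]
  have a1 : 2 * ε ^ 2 * cutoff ε x ^ 2 ≤ 2 * ε ^ 2 * cutoff ε x := by
    have : cutoff ε x ^ 2 ≤ cutoff ε x := by nlinarith
    gcongr
  have a2 : 4 * ε * (ε * |x| * cutoff ε x) * |cutoff₁ ε x| ≤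
      4 * ε * (1 / 2) * (ε * cutoff ε x) := by
    gcongr
  nlinarith [mul_nonneg (sq_nonneg ε) h0.le]

theorem integrable_cutoff {ε : ℝ} (hε : 0 < ε) :
    Integrable (cutoff ε) ∧ ∫ x, cutoff ε x = Real.pi / ε := by
  have h : cutoff ε = fun x => (1 + (ε * x) ^ 2)⁻¹ := by
    funext x; rw [cutoff, mul_pow]
  constructor
  · rw [h]
    exact integrable_inv_one_add_sq.comp_mul_left' hε.ne'
  · rw [h, Measure.integral_comp_mul_left (fun x => (1 + x ^ 2)⁻¹) ε,
      integral_univ_inv_one_add_sq, abs_of_pos (inv_pos.2 hε), smul_eq_mul, inv_mul_eq_div]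

theorem HillL2.norm_sq_eq (F : HillL2) : ‖F‖ ^ 2 = ∫ x, ‖F x‖ ^ 2 := by
  have h := inner_self_eq_norm_sq_to_K (𝕜 := ℂ) F
  rw [L2.inner_def] at h
  have h2 : ∀ x, inner ℂ (F x) (F x) = ((‖F x‖ ^ 2 : ℝ) : ℂ) := fun x => by
    rw [inner_self_eq_norm_sq_to_K]; push_cast; rfl
  simp only [h2] at h
  have h3 : ∫ x, ((‖F x‖ ^ 2 : ℝ) : ℂ) = ((∫ x, ‖F x‖ ^ 2 : ℝ) : ℂ) := integral_ofReal
  rw [h3] at h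
  refine Complex.ofReal_injective ?_
  rw [Complex.ofReal_pow]
  exact h.symm

theorem norm_toLp_sq {f : ℝ → ℂ} (hf : MemLp f 2 volume) : ‖hf.toLp f‖ ^ 2 = ∫ x, ‖f x‖ ^ 2 := by
  rw [HillL2.norm_sq_eq]
  refine integral_congr_ae ?_
  filter_upwards [hf.coeFn_toLp] with x hx
  rw [hx]

/-- A Floquet solution with unimodular multiplier, multiplied by slowly varying cut-offs, is a
Weyl sequence: `-2 y' φ' - y φ''` is small compared to `y φ` in `L²`. -/
theorem mem_hillSpectrum_of_isFloquetSolution {ρ : ℂ} (hρ : ‖ρ‖ = 1) {y : ℝ → ℂ}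
    (hy : IsFloquetSolution q lam ρ y) : lam ∈ hillSpectrum q := by
  rintro ⟨R, hR⟩
  have hT : (0 : ℝ) < 2 * Real.pi := Real.two_pi_pos
  have hyn : ∀ x, ‖y (x + 2 * Real.pi)‖ = ‖y x‖ := fun x => by
    rw [hy.2.2, norm_mul, hρ, one_mul]
  have cy := hy.1.continuous
  have cy' := hy.1.continuous_deriv
  obtain ⟨K₁, hK₁, hyK⟩ := exists_norm_le_of_periodic cy hT hyn
  obtain ⟨K₂, hK₂, hyK'⟩ := exists_norm_le_of_periodic cy' hT fun x => by
    rw [hy.deriv_add, norm_mul, hρ, one_mul]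
  set K := 6 * K₁ + 2 * K₂ with hK
  have hK0 : 0 < K := by positivity
  set c := ∫ x in (0 : ℝ)..(2 * Real.pi), ‖y x‖ ^ 2 with hc
  have hc0 : 0 < c := by
    obtain ⟨x, hx⟩ := Function.ne_iff.1 hy.2.1
    have hp : Function.Periodic (fun x => ‖y x‖ ^ 2) (2 * Real.pi) := fun x => by
      simp only [hyn]
    obtain ⟨t, ht, hxt⟩ := hp.exists_mem_Ico₀ hT x
    refine intervalIntegral.integral_pos hT (by fun_prop) (fun x _ => by positivity)
      ⟨t, ⟨ht.1, ht.2.le⟩, ?_⟩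
    rw [← hxt]
    have : 0 < ‖y x‖ := norm_pos_iff.2 hx
    positivity
  -- the two norm estimates for `N` periods
  have key : ∀ N : ℕ, 0 < N → N * (c / 4) ≤ ‖R‖ ^ 2 * (K ^ 2 * (1 / (N * 2))) := by
    intro N hN
    have hN0 : (0 : ℝ) < N := Nat.cast_pos.2 hN
    have hN1 : (1 : ℝ) ≤ N := Nat.one_le_cast.2 hN
    set ε : ℝ := 1 / (N * (2 * Real.pi)) with hε
    have hε0 : 0 < ε := by positivity
    have hε1 : ε ≤ 1 := by
      rw [hε, div_le_one (by positivity)]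
      nlinarith [Real.pi_gt_three]
    set φ : ℝ → ℂ := fun x => (cutoff ε x : ℂ) with hφ
    set φ₁ : ℝ → ℂ := fun x => (cutoff₁ ε x : ℂ) with hφ₁
    set φ₂ : ℝ → ℂ := fun x => (cutoff₂ ε x : ℂ) with hφ₂
    have c0 : Continuous (cutoff ε) :=
      continuous_iff_continuousAt.2 fun x => (hasDerivAt_cutoff ε x).continuousAt
    have c1 : Continuous (cutoff₁ ε) :=
      continuous_iff_continuousAt.2 fun x => (hasDerivAt_cutoff₁ ε x).continuousAt
    have c2 : Continuous (cutoff₂ ε) := by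
      unfold cutoff₂; fun_prop
    have hφd : HasACDeriv φ φ₁ :=
      .of_hasDerivAt (fun x => (hasDerivAt_cutoff ε x).ofReal_comp) (by fun_prop)
    have hφ₁d : HasACDeriv φ₁ φ₂ :=
      .of_hasDerivAt (fun x => (hasDerivAt_cutoff₁ ε x).ofReal_comp) (by fun_prop)
    set Y : ℝ → ℂ := fun x => y x * φ x with hY
    set F : ℝ → ℂ := fun x => -(2 * deriv y x * φ₁ x) - y x * φ₂ x with hF
    have hYd := hy.1.hasACDeriv.mul hφd
    have hYdd := (hy.1.hasACDeriv_deriv.mul hφd).add (hy.1.hasACDeriv.mul hφ₁d)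
    have hYs := hYd.hasSecondDerivAC hYdd
    have hYle : ∀ x, ‖Y x‖ ≤ K₁ * cutoff ε x := fun x => by
      rw [hY, norm_mul, Complex.norm_real, Real.norm_of_nonneg (cutoff_pos ε x).le]
      have := (cutoff_pos ε x).le
      gcongr
      exact hyK x
    have hFle : ∀ x, ‖F x‖ ≤ ε * K * cutoff ε x := fun x => by
      have h1 := abs_cutoff₁_le hε0.le x
      have h2 := abs_cutoff₂_le hε0.le x
      have h0 := cutoff_pos ε x
      refine (norm_sub_le _ _).trans ?_
      rw [norm_neg, norm_mul, norm_mul, norm_mul, Complex.norm_ofNat, Complex.norm_real,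
        Complex.norm_real, Real.norm_eq_abs, Real.norm_eq_abs]
      calc _ ≤ 2 * K₂ * (ε * cutoff ε x) + K₁ * (6 * ε ^ 2 * cutoff ε x) := by
            gcongr
            · exact hyK' x
            · exact hyK x
        _ ≤ 2 * K₂ * (ε * cutoff ε x) + K₁ * (6 * (ε * 1) * cutoff ε x) := by
            rw [sq]; gcongr
        _ = _ := by rw [hK]; ring
    have hL2 : MemLp (cutoff ε) 2 volume := by
      rw [memLp_two_iff_integrable_sq c0.aestronglyMeasurable]
      refine (integrable_cutoff hε0).1.mono' (by fun_prop) (.of_forall fun x => ?_)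
      rw [Real.norm_of_nonneg (by positivity)]
      nlinarith [cutoff_pos ε x, cutoff_le_one ε x]
    have hYL : MemLp Y 2 volume := hL2.of_le_mul (c := K₁)
      (by simp only [hY, hφ]; fun_prop) (.of_forall fun x => by
        rw [Real.norm_of_nonneg (cutoff_pos ε x).le]; exact hYle x)
    have hFL : MemLp F 2 volume := hL2.of_le_mul (c := ε * K)
      (by simp only [hF, hφ₁, hφ₂]; fun_prop) (.of_forall fun x => by
        rw [Real.norm_of_nonneg (cutoff_pos ε x).le]; exact hFle x)
    have hRF : R (hFL.toLp F) = hYL.toLp Y := by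
      rw [hR]
      refine ⟨_, _, hYs, hYL.coeFn_toLp, ?_⟩
      filter_upwards [Lp.coeFn_add (hFL.toLp F) (lam • hYL.toLp Y),
        Lp.coeFn_smul lam (hYL.toLp Y), hYL.coeFn_toLp, hFL.coeFn_toLp] with x h1 h2 h3 h4
      rw [h1, Pi.add_apply, h2, Pi.smul_apply, h3, h4, smul_eq_mul]
      simp only [hF, hY]
      ring
    have hnorm : ‖hYL.toLp Y‖ ≤ ‖R‖ * ‖hFL.toLp F‖ := hRF ▸ R.le_opNorm _
    have hF2 : ‖hFL.toLp F‖ ^ 2 ≤ K ^ 2 * (1 / (N * 2)) := by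
      rw [norm_toLp_sq]
      calc ∫ x, ‖F x‖ ^ 2 ≤ ∫ x, (ε * K) ^ 2 * cutoff ε x := by
            refine integral_mono_of_nonneg (.of_forall fun x => by positivity)
              ((integrable_cutoff hε0).1.const_mul _) (.of_forall fun x => ?_)
            calc ‖F x‖ ^ 2 ≤ (ε * K * cutoff ε x) ^ 2 := by gcongr; exact hFle x
              _ = (ε * K) ^ 2 * (cutoff ε x * cutoff ε x) := by ring
              _ ≤ (ε * K) ^ 2 * (cutoff ε x * 1) := by
                  have := (cutoff_pos ε x).le
                  gcongr
                  exact cutoff_le_one ε x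
              _ = _ := by simp
        _ = K ^ 2 * (1 / (N * 2)) := by
            rw [integral_const_mul, (integrable_cutoff hε0).2, hε]
            field_simp
    have hY2 : N * (c / 4) ≤ ‖hYL.toLp Y‖ ^ 2 := by
      rw [norm_toLp_sq]
      have hp : Function.Periodic (fun x => ‖y x‖ ^ 2) (2 * Real.pi) := fun x => by
        simp only [hyn]
      have h1 := hp.intervalIntegral_add_zsmul_eq N 0
      simp only [zero_add, natCast_zsmul, nsmul_eq_mul] at h1
      replace h1 := h1 fun a b => Continuous.intervalIntegrable (by fun_prop) a b
      have hNT : (0 : ℝ) ≤ N * (2 * Real.pi) := by positivity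
      have hYi : Integrable (fun x => ‖Y x‖ ^ 2) volume := hYL.integrable_norm_pow (by norm_num)
      calc N * (c / 4) = ∫ x in (0 : ℝ)..(N * (2 * Real.pi)), 4⁻¹ * ‖y x‖ ^ 2 := by
            rw [intervalIntegral.integral_const_mul, h1]; ring
        _ ≤ ∫ x in (0 : ℝ)..(N * (2 * Real.pi)), ‖Y x‖ ^ 2 := by
            refine intervalIntegral.integral_mono_on hNT (Continuous.intervalIntegrable
              (by fun_prop) _ _) hYi.intervalIntegrable fun x hx => ?_
            have hφx : 1 / 2 ≤ cutoff ε x := by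
              have : ε * x ≤ 1 := by
                rw [hε, one_div, inv_mul_le_iff₀ (by positivity)]; linarith [hx.2]
              have h0 : 0 ≤ ε * x := mul_nonneg hε0.le hx.1
              rw [cutoff, one_div]
              apply inv_anti₀ (by positivity)
              nlinarith
            rw [hY, norm_mul, Complex.norm_real, Real.norm_of_nonneg (cutoff_pos ε x).le, mul_pow]
            have h4 : (4 : ℝ)⁻¹ ≤ cutoff ε x ^ 2 := by nlinarith
            rw [mul_comm]
            gcongr
        _ ≤ ∫ x, ‖Y x‖ ^ 2 := by
            rw [intervalIntegral.integral_of_le hNT]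
            exact setIntegral_le_integral hYi (.of_forall fun x => by positivity)
    calc N * (c / 4) ≤ ‖hYL.toLp Y‖ ^ 2 := hY2
      _ ≤ (‖R‖ * ‖hFL.toLp F‖) ^ 2 := by gcongr
      _ = ‖R‖ ^ 2 * ‖hFL.toLp F‖ ^ 2 := mul_pow _ _ _
      _ ≤ _ := by gcongr
  obtain ⟨N, hN⟩ := exists_nat_gt (‖R‖ ^ 2 * K ^ 2 * 4 / c)
  have h1 := key (N + 1) N.succ_pos
  have hN1 : (1 : ℝ) ≤ ((N + 1 : ℕ) : ℝ) := Nat.one_le_cast.2 N.succ_pos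
  have hN2 : (N : ℝ) < ((N + 1 : ℕ) : ℝ) := by push_cast; linarith
  have h2 : ‖R‖ ^ 2 * (K ^ 2 * (1 / (((N + 1 : ℕ) : ℝ) * 2))) ≤ ‖R‖ ^ 2 * (K ^ 2 * 1) := by
    gcongr
    rw [div_le_one (by positivity)]
    linarith
  rw [div_lt_iff₀ hc0] at hN
  nlinarith

/-- The conditional stability set, on which the discriminant is real with values in `[-2, 2]`,
belongs to the spectrum. -/
theorem mem_hillSpectrum_of_abs_le (hq : LocallyIntegrable q volume)
    (hper : Function.Periodic q (2 * Real.pi)) {D : ℝ} (hD : |D| ≤ 2)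
    (h : hillDiscriminant q lam = D) : lam ∈ hillSpectrum q := by
  obtain ⟨ρ, hρ, hρD⟩ := exists_multiplier_of_norm_eq_one hD
  rw [← h] at hρD
  obtain ⟨y, hy⟩ := exists_isFloquetSolution hq hper hρD
  exact mem_hillSpectrum_of_isFloquetSolution hρ hy

end WeylSequence

/-! ### The resolvent off the conditional stability set -/

section Resolvent

open scoped ENNReal

variable {q : ℝ → ℂ} {lam : ℂ}

/-- The square of Young's inequality `‖k ⋆ f‖₂ ≤ ‖k‖₁ ‖f‖₂`, by Schur's test. -/
theorem lintegral_convolution_sq_le {k f : ℝ → ℝ≥0∞} (hk : Measurable k) (hf : Measurable f) :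
    ∫⁻ x, (∫⁻ t, k (x - t) * f t) ^ (2 : ℝ) ≤ (∫⁻ s, k s) ^ (2 : ℝ) * ∫⁻ t, f t ^ (2 : ℝ) := by
  set κ := ∫⁻ s, k s with hκ
  have hpt : ∀ x, (∫⁻ t, k (x - t) * f t) ^ (2 : ℝ) ≤ κ * ∫⁻ t, k (x - t) * f t ^ (2 : ℝ) := by
    intro x
    have h := ENNReal.lintegral_mul_le_Lp_mul_Lq volume Real.HolderConjugate.two_two
      (f := fun t => k (x - t) ^ (1 / 2 : ℝ)) (g := fun t => k (x - t) ^ (1 / 2 : ℝ) * f t)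
      (by fun_prop) (by fun_prop)
    have e1 : ∀ t, ((fun t => k (x - t) ^ (1 / 2 : ℝ)) * fun t => k (x - t) ^ (1 / 2 : ℝ) * f t) t =
        k (x - t) * f t := fun t => by
      simp only [Pi.mul_apply]
      rw [← mul_assoc, ← ENNReal.rpow_add_of_nonneg _ _ (by norm_num) (by norm_num)]
      norm_num
    have e2 : ∀ t, (k (x - t) ^ (1 / 2 : ℝ)) ^ (2 : ℝ) = k (x - t) := fun t => by
      rw [← ENNReal.rpow_mul]; norm_num
    have e3 : ∀ t, (k (x - t) ^ (1 / 2 : ℝ) * f t) ^ (2 : ℝ) = k (x - t) * f t ^ (2 : ℝ) :=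
      fun t => by rw [ENNReal.mul_rpow_of_nonneg _ _ (by norm_num), e2]
    simp only [e1, e2, e3] at h
    rw [lintegral_sub_left_eq_self k x, ← hκ] at h
    calc _ ≤ (κ ^ (1 / 2 : ℝ) * (∫⁻ t, k (x - t) * f t ^ (2 : ℝ)) ^ (1 / 2 : ℝ)) ^ (2 : ℝ) :=
          ENNReal.rpow_le_rpow h (by norm_num)
      _ = _ := by
        rw [ENNReal.mul_rpow_of_nonneg _ _ (by norm_num), ← ENNReal.rpow_mul, ← ENNReal.rpow_mul]
        norm_num
  calc _ ≤ ∫⁻ x, κ * ∫⁻ t, k (x - t) * f t ^ (2 : ℝ) := lintegral_mono hpt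
    _ = κ * ∫⁻ x, ∫⁻ t, k (x - t) * f t ^ (2 : ℝ) := by
        rw [lintegral_const_mul]
        exact Measurable.lintegral_prod_right (by fun_prop)
    _ = κ * ∫⁻ t, ∫⁻ x, k (x - t) * f t ^ (2 : ℝ) := by
        rw [lintegral_lintegral_swap]
        exact Measurable.aemeasurable (by fun_prop)
    _ = κ * (κ * ∫⁻ t, f t ^ (2 : ℝ)) := by
        congr 1
        rw [← lintegral_const_mul _ (by fun_prop)]
        congr 1
        funext t
        rw [lintegral_mul_const _ (by fun_prop), lintegral_sub_right_eq_self k t]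
    _ = _ := by
        rw [← mul_assoc, ENNReal.rpow_two, sq]

theorem integrable_exp_neg_mul_abs {c : ℝ} (hc : 0 < c) :
    Integrable (fun s : ℝ => Real.exp (-(c * |s|))) := by
  rw [← integrableOn_univ, ← Set.Iic_union_Ioi (a := (0 : ℝ)), integrableOn_union]
  constructor
  · refine (integrableOn_exp_mul_Iic hc 0).congr_fun (fun s hs => ?_) measurableSet_Iic
    rw [Set.mem_Iic] at hs
    simp only [abs_of_nonpos hs]
    ring_nf
  · refine (integrableOn_exp_mul_Ioi (neg_lt_zero.2 hc) 0).congr_fun (fun s hs => ?_)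
      measurableSet_Ioi
    rw [Set.mem_Ioi] at hs
    simp only [abs_of_pos hs]
    ring_nf

theorem integrable_exp_neg_mul_abs_sub_mul {c : ℝ} (hc : 0 < c) (F : HillL2) (x : ℝ) :
    Integrable (fun t : ℝ => Real.exp (-(c * |x - t|)) * ‖F t‖) := by
  have h1 : MemLp (fun t : ℝ => Real.exp (-(c * |x - t|))) 2 volume := by
    rw [memLp_two_iff_integrable_sq (Continuous.aestronglyMeasurable (by fun_prop))]
    refine ((integrable_exp_neg_mul_abs (by positivity : 0 < 2 * c)).comp_sub_left x).congr
      (.of_forall fun t => ?_)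
    simp only
    rw [← Real.exp_nat_mul]
    push_cast
    ring_nf
  exact h1.integrable_mul (Lp.memLp F).norm

/-- Convolution with `exp (-c |x|)` is bounded on `L²`. -/
theorem memLp_of_le_convolution {c C : ℝ} (hc : 0 < c) (hC : 0 ≤ C) (F : HillL2) {Y : ℝ → ℂ}
    (hY : Continuous Y)
    (h : ∀ x, ‖Y x‖ ≤ C * ∫ t, Real.exp (-(c * |x - t|)) * ‖F t‖) :
    ∃ hL : MemLp Y 2 volume,
      ‖hL.toLp Y‖ ≤ (C * ∫ s, Real.exp (-(c * |s|))) * ‖F‖ := by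
  set k : ℝ → ℝ≥0∞ := fun s => ENNReal.ofReal (Real.exp (-(c * |s|))) with hk
  set I := ∫ s, Real.exp (-(c * |s|)) with hI
  have hI0 : 0 ≤ I := integral_nonneg fun s => (Real.exp_pos _).le
  have hkI : ∫⁻ s, k s = ENNReal.ofReal I :=
    (ofReal_integral_eq_lintegral_ofReal (integrable_exp_neg_mul_abs hc)
      (.of_forall fun s => (Real.exp_pos _).le)).symm
  have hFm : Measurable fun t => ‖F t‖ₑ := (Lp.stronglyMeasurable F).measurable.enorm
  have hpt : ∀ x, ‖Y x‖ₑ ≤ ENNReal.ofReal C * ∫⁻ t, k (x - t) * ‖F t‖ₑ := by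
    intro x
    have e : ∫⁻ t, k (x - t) * ‖F t‖ₑ =
        ENNReal.ofReal (∫ t, Real.exp (-(c * |x - t|)) * ‖F t‖) := by
      rw [ofReal_integral_eq_lintegral_ofReal (integrable_exp_neg_mul_abs_sub_mul hc F x)
        (.of_forall fun s => by positivity)]
      congr 1
      funext t
      rw [ENNReal.ofReal_mul (Real.exp_pos _).le, ofReal_norm]
    rw [e, ← ENNReal.ofReal_mul hC, ← ofReal_norm]
    exact ENNReal.ofReal_le_ofReal (h x)
  have hsq : ∫⁻ x, ‖Y x‖ₑ ^ (2 : ℝ) ≤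
      (ENNReal.ofReal (C * I)) ^ (2 : ℝ) * ∫⁻ t, ‖F t‖ₑ ^ (2 : ℝ) := by
    calc ∫⁻ x, ‖Y x‖ₑ ^ (2 : ℝ)
        ≤ ∫⁻ x, (ENNReal.ofReal C * ∫⁻ t, k (x - t) * ‖F t‖ₑ) ^ (2 : ℝ) :=
          lintegral_mono fun x => ENNReal.rpow_le_rpow (hpt x) (by norm_num)
      _ = ENNReal.ofReal C ^ (2 : ℝ) * ∫⁻ x, (∫⁻ t, k (x - t) * ‖F t‖ₑ) ^ (2 : ℝ) := by
          rw [← lintegral_const_mul' _ _ (by finiteness)]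
          simp only [ENNReal.mul_rpow_of_nonneg _ _ (by norm_num : (0 : ℝ) ≤ 2)]
      _ ≤ ENNReal.ofReal C ^ (2 : ℝ) * ((∫⁻ s, k s) ^ (2 : ℝ) * ∫⁻ t, ‖F t‖ₑ ^ (2 : ℝ)) := by
          gcongr
          exact lintegral_convolution_sq_le (by fun_prop) hFm
      _ = _ := by
          rw [hkI, ← mul_assoc, ← ENNReal.mul_rpow_of_nonneg _ _ (by norm_num),
            ENNReal.ofReal_mul hC]
  have hn : eLpNorm Y 2 volume ≤ ENNReal.ofReal (C * I) * eLpNorm F 2 volume := by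
    rw [eLpNorm_eq_lintegral_rpow_enorm_toReal two_ne_zero ENNReal.ofNat_ne_top,
      eLpNorm_eq_lintegral_rpow_enorm_toReal two_ne_zero ENNReal.ofNat_ne_top, ENNReal.toReal_ofNat]
    calc _ ≤ ((ENNReal.ofReal (C * I)) ^ (2 : ℝ) * ∫⁻ t, ‖F t‖ₑ ^ (2 : ℝ)) ^ (1 / 2 : ℝ) :=
          ENNReal.rpow_le_rpow hsq (by norm_num)
      _ = _ := by
          rw [ENNReal.mul_rpow_of_nonneg _ _ (by norm_num), ← ENNReal.rpow_mul]
          norm_num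
  have hfin : ENNReal.ofReal (C * I) * eLpNorm F 2 volume < ∞ :=
    ENNReal.mul_lt_top ENNReal.ofReal_lt_top (Lp.memLp F).2
  have hL : MemLp Y 2 volume := ⟨hY.aestronglyMeasurable, hn.trans_lt hfin⟩
  refine ⟨hL, ?_⟩
  rw [Lp.norm_toLp, Lp.norm_def, ← ENNReal.toReal_ofReal (mul_nonneg hC hI0), ← ENNReal.toReal_mul]
  exact ENNReal.toReal_mono hfin.ne hn

/-- A square integrable continuous function which is multiplied by a non-unimodular constant
under a translation vanishes. -/
theorem eq_zero_of_memLp_of_translate {y : ℝ → ℂ} (hc : Continuous y) (hy : MemLp y 2 volume)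
    {T : ℝ} {σ : ℂ} (hσ : ‖σ‖ ≠ 1) (h : ∀ x, y (x + T) = σ * y x) : y = 0 := by
  have h1 : eLpNorm (y ∘ fun x => x + T) 2 volume = eLpNorm y 2 volume :=
    eLpNorm_comp_measurePreserving hc.aestronglyMeasurable (measurePreserving_add_right volume T)
  have h2 : (y ∘ fun x => x + T) = σ • y := funext h
  rw [h2, eLpNorm_const_smul] at h1
  have h3 := congrArg ENNReal.toReal h1
  rw [ENNReal.toReal_mul, toReal_enorm] at h3
  have h4 : (eLpNorm y 2 volume).toReal = 0 := by
    by_contra h0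
    exact hσ (mul_right_cancel₀ h0 (by rw [h3, one_mul]))
  have h5 : eLpNorm y 2 volume = 0 :=
    ((ENNReal.toReal_eq_zero_iff _).1 h4).resolve_right hy.2.ne
  rw [eLpNorm_eq_zero_iff hc.aestronglyMeasurable two_ne_zero] at h5
  exact hc.ae_eq_iff_eq volume continuous_zero |>.1 h5

/-- Where the multipliers are not unimodular, there are no square integrable solutions. -/
theorem IsHillSolution.eq_zero_of_memLp (hq : LocallyIntegrable q volume)
    (hper : Function.Periodic q (2 * Real.pi)) {ρ : ℂ} (hρ0 : ρ ≠ 0) (hρ : ‖ρ‖ ≠ 1)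
    (hD : ρ ^ 2 - hillDiscriminant q lam * ρ + 1 = 0) {y : ℝ → ℂ} (hy : IsHillSolution q lam y)
    (hL : MemLp y 2 volume) : y = 0 := by
  have hρ' : ‖ρ⁻¹‖ ≠ 1 := by rwa [norm_inv, ne_eq, inv_eq_one]
  have hL' : MemLp (fun x => y (x + 2 * Real.pi)) 2 volume :=
    hL.comp_measurePreserving (measurePreserving_add_right volume _)
  have cy := hy.continuous
  have hD' : hillDiscriminant q lam = ρ + ρ⁻¹ := by field_simp; linear_combination -hD
  have hz : (fun x => y (x + 2 * Real.pi) - ρ⁻¹ * y x) = 0 := by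
    refine eq_zero_of_memLp_of_translate (σ := ρ) (T := 2 * Real.pi) (by fun_prop)
      (hL'.sub (hL.const_mul ρ⁻¹)) hρ fun x => ?_
    rw [hy.cayley_hamilton hq hper, hD']
    field_simp
    ring
  exact eq_zero_of_memLp_of_translate cy hL hρ' fun x =>
    sub_eq_zero.1 (congrFun hz x)

/-- `exp (-s x) |y x|` is periodic, hence bounded, if `|ρ| = exp (2π s)`. -/
theorem IsFloquetSolution.exists_norm_le_exp {ρ : ℂ} {y : ℝ → ℂ} (hy : IsFloquetSolution q lam ρ y)
    {s : ℝ} (hs : ‖ρ‖ = Real.exp (s * (2 * Real.pi))) :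
    ∃ K : ℝ, 0 < K ∧ ∀ x, ‖y x‖ ≤ K * Real.exp (s * x) := by
  have cy := hy.1.continuous
  obtain ⟨K, hK, h⟩ := exists_norm_le_of_periodic (f := fun x => (Real.exp (-(s * x)) : ℂ) * y x)
    (by fun_prop) Real.two_pi_pos fun x => by
      simp only [norm_mul, Complex.norm_real, Real.norm_of_nonneg (Real.exp_pos _).le]
      rw [hy.2.2, norm_mul, hs, ← mul_assoc, ← Real.exp_add]
      ring_nf
  refine ⟨K, hK, fun x => ?_⟩
  have := h x
  rw [norm_mul, Complex.norm_real, Real.norm_of_nonneg (Real.exp_pos _).le, Real.exp_neg,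
    inv_mul_le_iff₀ (Real.exp_pos _)] at this
  rwa [mul_comm]

/-- Solvability of `(H - lam) Y = F` with a bound, by Green's function
`G(x, t) = ψ₊(max x t) ψ₋(min x t) / W` built from the Floquet solutions `ψ₊`, `ψ₋` which decay at
`+∞` and `-∞`. -/
theorem exists_solution_of_multiplier (hq : LocallyIntegrable q volume)
    (hper : Function.Periodic q (2 * Real.pi)) {ρ : ℂ} (hρ0 : ρ ≠ 0) (hρ : ‖ρ‖ < 1)
    (hD : ρ ^ 2 - hillDiscriminant q lam * ρ + 1 = 0)
    (hD' : ρ⁻¹ ^ 2 - hillDiscriminant q lam * ρ⁻¹ + 1 = 0) :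
    ∃ M : ℝ, ∀ F : HillL2, ∃ Y : HillL2, (Y, F + lam • Y) ∈ hillGraph q ∧ ‖Y‖ ≤ M * ‖F‖ := by
  obtain ⟨P, hP⟩ := exists_isFloquetSolution hq hper hD
  obtain ⟨Q, hQ⟩ := exists_isFloquetSolution hq hper hD'
  have hne : ρ ≠ ρ⁻¹ := by
    intro h
    have h1 := congrArg (‖·‖) h
    simp only [norm_inv] at h1
    have : 1 < ‖ρ‖⁻¹ := (one_lt_inv₀ (norm_pos_iff.2 hρ0)).2 hρ
    linarith
  set W := P 0 * deriv Q 0 - deriv P 0 * Q 0 with hW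
  have hW0 : W ≠ 0 := hP.wronskian_ne_zero hq hne hQ
  have hWx : ∀ x, P x * deriv Q x - deriv P x * Q x = W := hP.1.wronskian_eq hQ.1
  set c : ℝ := -Real.log ‖ρ‖ / (2 * Real.pi) with hcd
  have hc : 0 < c := div_pos (neg_pos.2 (Real.log_neg (norm_pos_iff.2 hρ0) hρ)) Real.two_pi_pos
  have hcT : c * (2 * Real.pi) = -Real.log ‖ρ‖ := div_mul_cancel₀ _ Real.two_pi_pos.ne'
  have hρc : ‖ρ‖ = Real.exp (-c * (2 * Real.pi)) := by
    rw [neg_mul, hcT, neg_neg, Real.exp_log (norm_pos_iff.2 hρ0)]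
  have hρc' : ‖ρ⁻¹‖ = Real.exp (c * (2 * Real.pi)) := by
    rw [norm_inv, hcT, Real.exp_neg, Real.exp_log (norm_pos_iff.2 hρ0)]
  obtain ⟨K₁, hK₁, hPK⟩ := hP.exists_norm_le_exp hρc
  obtain ⟨K₂, hK₂, hQK⟩ := hQ.exists_norm_le_exp hρc'
  have cP := hP.1.continuous
  have cQ := hQ.1.continuous
  set C := ‖W⁻¹‖ * (K₁ * K₂) with hC
  refine ⟨C * ∫ s, Real.exp (-(c * |s|)), fun F => ?_⟩
  have hFl : LocallyIntegrable F volume := (Lp.memLp F).locallyIntegrable one_le_two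
  have hfl : LocallyIntegrable (fun t => Q t * F t) volume := hFl.continuous_mul cQ
  have hgl : LocallyIntegrable (fun t => P t * F t) volume := hFl.continuous_mul cP
  have hJ := integrable_exp_neg_mul_abs_sub_mul hc F
  have hfb : ∀ x, ∀ t ∈ Set.Iic x, ‖Q t * F t‖ ≤
      K₂ * Real.exp (c * x) * (Real.exp (-(c * |x - t|)) * ‖F t‖) := by
    intro x t ht
    rw [Set.mem_Iic] at ht
    have e : Real.exp (c * t) = Real.exp (c * x) * Real.exp (-(c * |x - t|)) := by
      rw [abs_of_nonneg (sub_nonneg.2 ht), ← Real.exp_add]; ring_nf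
    calc ‖Q t * F t‖ ≤ K₂ * Real.exp (c * t) * ‖F t‖ := by
          rw [norm_mul]; gcongr; exact hQK t
      _ = _ := by rw [e]; ring
  have hgb : ∀ x, ∀ t ∈ Set.Ioi x, ‖P t * F t‖ ≤
      K₁ * Real.exp (-c * x) * (Real.exp (-(c * |x - t|)) * ‖F t‖) := by
    intro x t ht
    rw [Set.mem_Ioi] at ht
    have e : Real.exp (-c * t) = Real.exp (-c * x) * Real.exp (-(c * |x - t|)) := by
      rw [abs_of_neg (sub_neg.2 ht), ← Real.exp_add]; ring_nf
    calc ‖P t * F t‖ ≤ K₁ * Real.exp (-c * t) * ‖F t‖ := by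
          rw [norm_mul]; gcongr; exact hPK t
      _ = _ := by rw [e]; ring
  have hfi : ∀ x, IntegrableOn (fun t => Q t * F t) (Set.Iic x) := fun x =>
    ((hJ x).const_mul _).integrableOn.mono' hfl.aestronglyMeasurable.restrict
      ((ae_restrict_iff' measurableSet_Iic).2 (.of_forall (hfb x)))
  have hgi : ∀ x, IntegrableOn (fun t => P t * F t) (Set.Ioi x) := fun x =>
    ((hJ x).const_mul _).integrableOn.mono' hgl.aestronglyMeasurable.restrict
      ((ae_restrict_iff' measurableSet_Ioi).2 (.of_forall (hgb x)))
  set A : ℝ → ℂ := fun x => ∫ t in Set.Iic x, Q t * F t with hA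
  set B : ℝ → ℂ := fun x => ∫ t in Set.Ioi x, P t * F t with hB
  have hAd : HasACDeriv A (fun t => Q t * F t) := ⟨hfl, fun x => by
    rw [← intervalIntegral.integral_Iic_sub_Iic (hfi 0) (hfi x)]; ring⟩
  have hBd : HasACDeriv B (fun t => -(P t * F t)) := ⟨hgl.neg, fun x => by
    rw [intervalIntegral.integral_neg, ← intervalIntegral.integral_Ioi_sub_Ioi' (hgi 0) (hgi x)]
    ring⟩
  set y : ℝ → ℂ := fun x => W⁻¹ * (P x * A x + Q x * B x) with hy
  have hy1 : HasACDeriv y (fun x => W⁻¹ * (deriv P x * A x + deriv Q x * B x)) :=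
    (((hP.1.hasACDeriv.mul hAd).add (hQ.1.hasACDeriv.mul hBd)).const_mul W⁻¹).congr
      fun x => by ring
  have hy2 : HasACDeriv (fun x => W⁻¹ * (deriv P x * A x + deriv Q x * B x))
      (fun x => (q x - lam) * y x - F x) :=
    (((hP.1.hasACDeriv_deriv.mul hAd).add (hQ.1.hasACDeriv_deriv.mul hBd)).const_mul W⁻¹).congr
      fun x => by
        have h1 : W⁻¹ * (P x * deriv Q x - deriv P x * Q x) = 1 := by
          rw [hWx, inv_mul_cancel₀ hW0]
        simp only [hy]
        linear_combination -(F x) * h1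
  have hbound : ∀ x, ‖y x‖ ≤ C * ∫ t, Real.exp (-(c * |x - t|)) * ‖F t‖ := by
    intro x
    have hA1 : ‖A x‖ ≤ K₂ * Real.exp (c * x) *
        ∫ t in Set.Iic x, Real.exp (-(c * |x - t|)) * ‖F t‖ := by
      rw [← integral_const_mul]
      exact norm_integral_le_of_norm_le ((hJ x).const_mul _).integrableOn
        ((ae_restrict_iff' measurableSet_Iic).2 (.of_forall (hfb x)))
    have hB1 : ‖B x‖ ≤ K₁ * Real.exp (-c * x) *
        ∫ t in Set.Ioi x, Real.exp (-(c * |x - t|)) * ‖F t‖ := by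
      rw [← integral_const_mul]
      exact norm_integral_le_of_norm_le ((hJ x).const_mul _).integrableOn
        ((ae_restrict_iff' measurableSet_Ioi).2 (.of_forall (hgb x)))
    have hsum := intervalIntegral.integral_Iic_add_Ioi (hJ x).integrableOn (hJ x).integrableOn
      (b := x)
    have he : Real.exp (-c * x) * Real.exp (c * x) = 1 := by
      rw [← Real.exp_add]; simp
    rw [hy, norm_mul, hC, mul_assoc ‖W⁻¹‖, ← hsum]
    gcongr
    refine (norm_add_le _ _).trans ?_
    rw [norm_mul, norm_mul]
    calc _ ≤ K₁ * Real.exp (-c * x) * (K₂ * Real.exp (c * x) *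
              ∫ t in Set.Iic x, Real.exp (-(c * |x - t|)) * ‖F t‖) +
            K₂ * Real.exp (c * x) * (K₁ * Real.exp (-c * x) *
              ∫ t in Set.Ioi x, Real.exp (-(c * |x - t|)) * ‖F t‖) := by
          gcongr
          · exact hPK x
          · exact hQK x
      _ = _ := by linear_combination (K₁ * K₂ *
            ((∫ t in Set.Iic x, Real.exp (-(c * |x - t|)) * ‖F t‖) +
              ∫ t in Set.Ioi x, Real.exp (-(c * |x - t|)) * ‖F t‖)) * he
  obtain ⟨hL, hLn⟩ := memLp_of_le_convolution hc (by positivity) F hy1.continuous hbound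
  refine ⟨hL.toLp y, ⟨y, _, hy1.hasSecondDerivAC hy2, hL.coeFn_toLp, ?_⟩, hLn⟩
  filter_upwards [Lp.coeFn_add F (lam • hL.toLp y), Lp.coeFn_smul lam (hL.toLp y),
    hL.coeFn_toLp] with x h1 h2 h3
  rw [h1, Pi.add_apply, h2, Pi.smul_apply, h3, smul_eq_mul]
  ring

theorem hillGraph_add {p r : HillL2 × HillL2} (hp : p ∈ hillGraph q) (hr : r ∈ hillGraph q) :
    p + r ∈ hillGraph q := by
  obtain ⟨y, g, h1, h2, h3⟩ := hp
  obtain ⟨z, k, h4, h5, h6⟩ := hr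
  refine ⟨_, _, (h1.hasACDeriv.add h4.hasACDeriv).hasSecondDerivAC
    (h1.hasACDeriv_deriv.add h4.hasACDeriv_deriv), ?_, ?_⟩
  · filter_upwards [h2, h5, Lp.coeFn_add p.1 r.1] with x e1 e2 e3
    rw [Prod.fst_add, e3, Pi.add_apply, e1, e2]
  · filter_upwards [h3, h6, Lp.coeFn_add p.2 r.2] with x e1 e2 e3
    rw [Prod.snd_add, e3, Pi.add_apply, e1, e2]
    ring

theorem hillGraph_smul (a : ℂ) {p : HillL2 × HillL2} (hp : p ∈ hillGraph q) :
    a • p ∈ hillGraph q := by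
  obtain ⟨y, g, h1, h2, h3⟩ := hp
  refine ⟨_, _, (h1.hasACDeriv.const_mul a).hasSecondDerivAC (h1.hasACDeriv_deriv.const_mul a),
    ?_, ?_⟩
  · filter_upwards [h2, Lp.coeFn_smul a p.1] with x e1 e3
    rw [Prod.smul_fst, e3, Pi.smul_apply, e1, smul_eq_mul]
  · filter_upwards [h3, Lp.coeFn_smul a p.2] with x e1 e3
    rw [Prod.smul_snd, e3, Pi.smul_apply, e1, smul_eq_mul]
    ring

/-- Off the set where the discriminant lies in `[-2, 2]`, Green's function gives a bounded
inverse of `H - lam`, which is unique as `lam` is not an eigenvalue. -/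
theorem exists_abs_le_of_mem_hillSpectrum (hq : LocallyIntegrable q volume)
    (hper : Function.Periodic q (2 * Real.pi)) (hlam : lam ∈ hillSpectrum q) :
    ∃ D : ℝ, |D| ≤ 2 ∧ hillDiscriminant q lam = D := by
  by_contra! hD
  refine hlam ?_
  obtain ⟨ρ, hρ0, hρ, h1, h2⟩ := exists_multiplier_of_norm_lt_one hD
  obtain ⟨M, hM⟩ := exists_solution_of_multiplier hq hper hρ0 hρ h1 h2
  have huniq : ∀ Y : HillL2, (Y, lam • Y) ∈ hillGraph q → Y = 0 := by
    rintro Y ⟨y, g, hy, e1, e2⟩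
    simp only at e1 e2
    have hs : IsHillSolution q lam y := by
      refine ⟨g, hy, ?_⟩
      filter_upwards [e1, e2, Lp.coeFn_smul lam Y] with x a1 a2 a3
      rw [a3, Pi.smul_apply, a1, smul_eq_mul] at a2
      exact a2.symm
    have hL : MemLp y 2 volume := (Lp.memLp Y).ae_eq e1
    have hz := hs.eq_zero_of_memLp hq hper hρ0 hρ.ne h1 hL
    rw [Lp.eq_zero_iff_ae_eq_zero]
    filter_upwards [e1] with x a1
    rw [a1, hz]
  choose S hS hSM using hM
  have huniq' : ∀ F Y : HillL2, (Y, F + lam • Y) ∈ hillGraph q → S F = Y := by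
    intro F Y hY
    refine sub_eq_zero.1 (huniq _ ?_)
    convert! hillGraph_add (hS F) (hillGraph_smul (-1) hY) using 1
    ext1
    · simp [sub_eq_add_neg]
    · simp [smul_sub]
      abel
  refine ⟨LinearMap.mkContinuous
    { toFun := S
      map_add' := fun F G => huniq' _ _ ?_
      map_smul' := fun a F => huniq' _ _ ?_ } M hSM, fun F Y => ⟨?_, huniq' F Y⟩⟩
  · convert! hillGraph_add (hS F) (hS G) using 1
    ext1
    · rfl
    · simp only [Prod.snd_add, smul_add]
      abel
  · convert! hillGraph_smul a (hS F) using 1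
    ext1
    · rfl
    · simp only [Prod.smul_snd, smul_add, RingHom.id_apply]
      rw [smul_comm]
  · rintro rfl
    exact hS F

end Resolvent

/-! ### Division of entire functions -/

section EntireFunctions

open Filter Topology

/-- An entire function is divisible by another one if it vanishes to at least the same orders. -/
theorem exists_entire_quotient {N h : ℂ → ℂ} (hN : Differentiable ℂ N) (hh : Differentiable ℂ h)
    (h0 : ∃ z, h z ≠ 0) (hord : ∀ z, analyticOrderAt h z ≤ analyticOrderAt N z) :
    ∃ Q : ℂ → ℂ, Differentiable ℂ Q ∧ ∀ z, N z = Q z * h z := by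
  have aN : ∀ z, AnalyticAt ℂ N z := fun z => hN.analyticAt z
  have ah : ∀ z, AnalyticAt ℂ h z := fun z => hh.analyticAt z
  have hm : MeromorphicOn (N / h) Set.univ := fun z _ =>
    (aN z).meromorphicAt.div (ah z).meromorphicAt
  have hne : ∀ z, ∀ᶠ w in 𝓝[≠] z, h w ≠ 0 := by
    intro z
    rcases (ah z).eventually_eq_zero_or_eventually_ne_zero with h1 | h1
    · obtain ⟨w, hw⟩ := h0
      exact absurd (congrFun (AnalyticOnNhd.eq_of_eventuallyEq (f := h) (g := 0)
        (fun z _ => ah z) (fun z _ => analyticAt_const) h1) w) hw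
    · exact h1
  set Q := toMeromorphicNFOn (N / h) Set.univ with hQ
  have hQa : ∀ z, AnalyticAt ℂ Q z := by
    intro z
    rw [← (meromorphicNFOn_toMeromorphicNFOn (N / h) Set.univ
      (Set.mem_univ z)).meromorphicOrderAt_nonneg_iff_analyticAt,
      meromorphicOrderAt_toMeromorphicNFOn hm (Set.mem_univ z),
      meromorphicOrderAt_div (aN z).meromorphicAt (ah z).meromorphicAt,
      (aN z).meromorphicOrderAt_eq, (ah z).meromorphicOrderAt_eq]
    have h1 : analyticOrderAt h z ≠ ⊤ := by
      intro ht
      rw [analyticOrderAt_eq_top] at ht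
      obtain ⟨w, hw1, hw2⟩ := ((ht.filter_mono nhdsWithin_le_nhds).and (hne z)).exists
      exact hw2 hw1
    have h2 := hord z
    obtain ⟨m, hm⟩ := ENat.ne_top_iff_exists.1 h1
    rw [← hm] at h2 ⊢
    cases hn : analyticOrderAt N z with
    | top => simp
    | coe n =>
      rw [hn] at h2
      have h3 : m ≤ n := by exact_mod_cast h2
      simp only [ENat.map_natCast]
      have h4 : (0 : ℤ) ≤ (n : ℤ) - m := by omega
      exact_mod_cast h4
  refine ⟨Q, fun z => (hQa z).differentiableAt, fun z => ?_⟩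
  have h1 : N =ᶠ[𝓝[≠] z] fun w => Q w * h w := by
    filter_upwards [hm.toMeromorphicNFOn_eq_self_on_nhdsNE (Set.mem_univ z), hne z] with w e1 e2
    rw [hQ, e1, Pi.div_apply, div_mul_cancel₀ _ e2]
  exact ((hN z).continuousAt.eventuallyEq_nhds_iff_eventuallyEq_nhdsNE
    ((hQa z).continuousAt.mul (hh z).continuousAt)).1 h1 |>.eq_of_nhds

/-- At a zero of `4 - D²` of order `m` the derivative of `D` vanishes to order `m - 1`. If all zeros
of `4 - D²` off `lam₀` are multiple, then `(D')² (lam - lam₀)` is therefore divisible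
by `4 - D²`. -/
theorem analyticOrderAt_four_sub_sq_le {D : ℂ → ℂ} (hD : Differentiable ℂ D) {lam₀ : ℂ}
    (h : ∀ μ, μ ≠ lam₀ → D μ ^ 2 = 4 → deriv D μ = 0) (z : ℂ) :
    analyticOrderAt (fun w => 4 - D w ^ 2) z ≤
      analyticOrderAt (fun w => deriv D w ^ 2 * (w - lam₀)) z := by
  have aD := hD.analyticAt z
  have aD' := aD.deriv
  by_cases h4 : D z ^ 2 = 4
  · have hDz : D z ≠ 0 := by rintro h0; norm_num [h0] at h4
    have e1 : analyticOrderAt (fun w => 4 - D w ^ 2) z = analyticOrderAt (deriv D) z + 1 := by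
      have e : (fun w => 4 - D w ^ 2) = (fun w => D w - D z) * fun w => -(D w + D z) := by
        funext w
        simp only [Pi.mul_apply]
        linear_combination -h4
      have e0 : analyticOrderAt (fun w => -(D w + D z)) z = 0 :=
        (AnalyticAt.analyticOrderAt_eq_zero (by fun_prop)).2 (by
          rw [← two_mul]; exact neg_ne_zero.2 (mul_ne_zero two_ne_zero hDz))
      rw [e, analyticOrderAt_mul (by fun_prop) (by fun_prop), e0, add_zero,
        aD.analyticOrderAt_deriv_add_one]
    have e2 : analyticOrderAt (fun w => deriv D w ^ 2 * (w - lam₀)) z =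
        analyticOrderAt (deriv D) z + analyticOrderAt (deriv D) z +
          analyticOrderAt (fun w => w - lam₀) z := by
      have e : (fun w => deriv D w ^ 2 * (w - lam₀)) =
          (deriv D * deriv D) * fun w => w - lam₀ := by
        funext w; simp only [Pi.mul_apply]; ring
      rw [e, analyticOrderAt_mul (aD'.mul aD') (by fun_prop), analyticOrderAt_mul aD' aD']
    rw [e1, e2]
    by_cases hz : z = lam₀
    · have : 1 ≤ analyticOrderAt (fun w => w - lam₀) z := by
        rw [Order.one_le_iff_ne_zero, AnalyticAt.analyticOrderAt_ne_zero (by fun_prop), hz,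
          sub_self]
      exact add_le_add le_self_add this
    · have : 1 ≤ analyticOrderAt (deriv D) z := by
        rw [Order.one_le_iff_ne_zero, aD'.analyticOrderAt_ne_zero]
        exact h z hz h4
      exact (add_le_add le_rfl this).trans le_self_add
  · have : analyticOrderAt (fun w => 4 - D w ^ 2) z = 0 :=
      (AnalyticAt.analyticOrderAt_eq_zero (by fun_prop)).2 (sub_ne_zero.2 (Ne.symm h4))
    rw [this]
    exact zero_le

theorem hasDerivAt_comp_add_sq {D : ℂ → ℂ} (hD : Differentiable ℂ D) (a z : ℂ) :
    HasDerivAt (fun z => D (a + z ^ 2)) (2 * z * deriv D (a + z ^ 2)) z := by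
  have h := (hD (a + z ^ 2)).hasDerivAt.comp z (((hasDerivAt_id z).pow 2).const_add a)
  refine h.congr_deriv ?_
  simp
  ring

/-- The differential equation `(D')² (lam - lam₀) = π² (4 - D²)` forces
`D = ±2 cos (2π √(lam - lam₀))`: in the variable `z = √(lam - lam₀)` it becomes the energy
identity `f'² + 4π² f² = 16π²` of the harmonic oscillator `f'' = -4π² f`. -/
theorem eq_two_cos_or_neg_of_ode {D : ℂ → ℂ} (hD : Differentiable ℂ D) {lam₀ : ℂ}
    (h0 : ∃ z, 4 - D z ^ 2 ≠ 0)
    (hode : ∀ lam, deriv D lam ^ 2 * (lam - lam₀) = Real.pi ^ 2 * (4 - D lam ^ 2)) :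
    ∃ σ : ℂ, (σ = 1 ∨ σ = -1) ∧
      ∀ z, D (lam₀ + z ^ 2) = σ * (2 * Complex.cos (2 * Real.pi * z)) := by
  have hπ : (Real.pi : ℂ) ≠ 0 := Complex.ofReal_ne_zero.2 Real.pi_ne_zero
  have h4π : 4 * (Real.pi : ℂ) ^ 2 ≠ 0 := mul_ne_zero (by norm_num) (pow_ne_zero 2 hπ)
  set f : ℂ → ℂ := fun z => D (lam₀ + z ^ 2) with hf
  set f₁ : ℂ → ℂ := fun z => 2 * z * deriv D (lam₀ + z ^ 2) with hf₁
  have hfd : ∀ z, HasDerivAt f (f₁ z) z := hasDerivAt_comp_add_sq hD lam₀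
  have hfdiff : Differentiable ℂ f := fun z => (hfd z).differentiableAt
  have hf₁diff : Differentiable ℂ f₁ := by
    have : f₁ = deriv f := funext fun z => (hfd z).deriv.symm
    rw [this]
    exact fun z => (hfdiff.analyticAt z).deriv.differentiableAt
  have hen : ∀ z, f₁ z ^ 2 = 4 * Real.pi ^ 2 * (4 - f z ^ 2) := fun z => by
    have := hode (lam₀ + z ^ 2)
    simp only [hf, hf₁]
    linear_combination 4 * this
  have hf₁d : ∀ z, HasDerivAt f₁ (deriv f₁ z) z := fun z => (hf₁diff z).hasDerivAt
  have hprod : ∀ z, f₁ z * (deriv f₁ z + 4 * Real.pi ^ 2 * f z) = 0 := by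
    intro z
    have h1 : HasDerivAt (fun z => f₁ z ^ 2) (2 * f₁ z * deriv f₁ z) z := by
      refine ((hf₁d z).pow 2).congr_deriv ?_
      norm_num
    have h2 : HasDerivAt (fun z => 4 * Real.pi ^ 2 * (4 - f z ^ 2))
        (4 * Real.pi ^ 2 * -(2 * f z * f₁ z)) z := by
      refine (((hfd z).pow 2).const_sub 4).const_mul (4 * (Real.pi : ℂ) ^ 2) |>.congr_deriv ?_
      norm_num
    have h3 := h1.unique (h2.congr_of_eventuallyEq (.of_forall hen))
    linear_combination h3 / 2
  have hzero := AnalyticOnNhd.eq_zero_or_eq_zero_of_mul_eq_zero (U := Set.univ) (f := f₁)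
    (g := fun z => deriv f₁ z + 4 * Real.pi ^ 2 * f z)
    (fun z _ => hf₁diff.analyticAt z)
    (fun z _ => ((hf₁diff.analyticAt z).deriv).add (analyticAt_const.mul (hfdiff.analyticAt z)))
    (fun z _ => hprod z) isPreconnected_univ
  have hf₂ : ∀ z, deriv f₁ z = -(4 * Real.pi ^ 2 * f z) := by
    rcases hzero with h1 | h1
    · obtain ⟨w, hw⟩ := h0
      obtain ⟨s, hs⟩ := IsAlgClosed.exists_pow_nat_eq (w - lam₀) two_pos
      have h2 := hen s
      rw [h1 s (Set.mem_univ s)] at h2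
      have h3 : f s = D w := by simp only [hf, hs]; ring_nf
      rw [h3] at h2
      exact absurd ((mul_eq_zero.1 (by linear_combination -h2 :
        (4 * (Real.pi : ℂ) ^ 2) * (4 - D w ^ 2) = 0)).resolve_left h4π) hw
    · exact fun z => eq_neg_of_add_eq_zero_left (h1 z (Set.mem_univ z))
  have hc : ∀ z : ℂ, HasDerivAt (fun z : ℂ => Complex.cos (2 * Real.pi * z))
      (-(2 * Real.pi * Complex.sin (2 * Real.pi * z))) z := fun z => by
    have := (Complex.hasDerivAt_cos (2 * Real.pi * z)).comp z
      ((hasDerivAt_id z).const_mul (2 * (Real.pi : ℂ)))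
    refine this.congr_deriv ?_
    ring
  have hs : ∀ z : ℂ, HasDerivAt (fun z : ℂ => Complex.sin (2 * Real.pi * z))
      (2 * Real.pi * Complex.cos (2 * Real.pi * z)) z := fun z => by
    have := (Complex.hasDerivAt_sin (2 * Real.pi * z)).comp z
      ((hasDerivAt_id z).const_mul (2 * (Real.pi : ℂ)))
    refine this.congr_deriv ?_
    ring
  -- the two first integrals of the oscillator
  set A : ℂ → ℂ := fun z => f z * Complex.cos (2 * Real.pi * z) -
    f₁ z * Complex.sin (2 * Real.pi * z) / (2 * Real.pi) with hA
  set B : ℂ → ℂ := fun z => f z * Complex.sin (2 * Real.pi * z) +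
    f₁ z * Complex.cos (2 * Real.pi * z) / (2 * Real.pi) with hB
  have hAd : ∀ z, HasDerivAt A 0 z := fun z => by
    refine (((hfd z).mul (hc z)).sub (((hf₁d z).mul (hs z)).div_const (2 * Real.pi))).congr_deriv ?_
    rw [hf₂]
    field_simp
    ring
  have hBd : ∀ z, HasDerivAt B 0 z := fun z => by
    refine (((hfd z).mul (hs z)).add (((hf₁d z).mul (hc z)).div_const (2 * Real.pi))).congr_deriv ?_
    rw [hf₂]
    field_simp
    ring
  have hAc : ∀ z, A z = f 0 := fun z => by
    rw [is_const_of_deriv_eq_zero (fun z => (hAd z).differentiableAt) (fun z => (hAd z).deriv) z 0]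
    simp [hA]
  have hBc : ∀ z, B z = 0 := fun z => by
    rw [is_const_of_deriv_eq_zero (fun z => (hBd z).differentiableAt) (fun z => (hBd z).deriv) z 0]
    simp [hB, hf₁]
  have hfz : ∀ z, f z = f 0 * Complex.cos (2 * Real.pi * z) := fun z => by
    have h1 := hAc z
    have h2 := hBc z
    simp only [hA, hB] at h1 h2
    linear_combination Complex.cos (2 * Real.pi * z) * h1 + Complex.sin (2 * Real.pi * z) * h2 -
      f z * Complex.sin_sq_add_cos_sq (2 * Real.pi * z)
  have hf0 : (f 0 - 2) * (f 0 + 2) = 0 := by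
    have h1 := hen 0
    have h2 : f₁ 0 = 0 := by simp [hf₁]
    rw [h2] at h1
    have h3 := (mul_eq_zero.1 (by linear_combination -h1 :
      (4 * (Real.pi : ℂ) ^ 2) * (4 - f 0 ^ 2) = 0)).resolve_left h4π
    linear_combination -h3
  rcases mul_eq_zero.1 hf0 with h | h
  · refine ⟨1, Or.inl rfl, fun z => ?_⟩
    have := hfz z
    rw [sub_eq_zero.1 h] at this
    rw [one_mul]
    exact this
  · refine ⟨-1, Or.inr rfl, fun z => ?_⟩
    have := hfz z
    rw [eq_neg_of_add_eq_zero_left h] at this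
    rw [← mul_assoc, neg_one_mul]
    exact this

end EntireFunctions

/-! ### Functions asymptotic to `2 cos (2π √lam)` -/

section AsymptoticallyCosine

open Filter Topology

theorem norm_cos_two_pi_mul_le (k : ℂ) :
    ‖Complex.cos (2 * Real.pi * k)‖ ≤ Real.exp (2 * Real.pi * |k.im|) := by
  have := norm_cos_mul_le k Real.two_pi_pos.le
  push_cast at this
  rwa [mul_comm k, mul_comm |k.im|] at this

theorem norm_sin_two_pi_mul_le (k : ℂ) :
    ‖Complex.sin (2 * Real.pi * k)‖ ≤ Real.exp (2 * Real.pi * |k.im|) := by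
  have := norm_sin_mul_le k Real.two_pi_pos.le
  push_cast at this
  rwa [mul_comm k, mul_comm |k.im|] at this

theorem exp_neg_le_half {x : ℝ} (hx : 1 ≤ |x|) :
    Real.exp (-(2 * Real.pi * |x|)) ≤ Real.exp (2 * Real.pi * |x|) / 2 := by
  have h1 : 2 * Real.pi * |x| ≥ 6 := by nlinarith [Real.pi_gt_three]
  have h2 : Real.exp (-(2 * Real.pi * |x|)) ≤ 1 := Real.exp_le_one_iff.2 (by linarith)
  linarith [Real.add_one_le_exp (2 * Real.pi * |x|)]

/-- Away from the real axis, sine and cosine are bounded below by an exponential. -/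
theorem le_norm_trig_of_one_le_abs_im {k : ℂ} (hk : 1 ≤ |k.im|) :
    Real.exp (2 * Real.pi * |k.im|) / 4 ≤ ‖Complex.sin (2 * Real.pi * k)‖ ∧
      Real.exp (2 * Real.pi * |k.im|) / 4 ≤ ‖Complex.cos (2 * Real.pi * k)‖ := by
  have h1 : ‖Complex.exp (2 * Real.pi * k * Complex.I)‖ = Real.exp (-(2 * Real.pi * k.im)) := by
    rw [Complex.norm_exp]; simp
  have h2 : ‖Complex.exp (-(2 * Real.pi * k) * Complex.I)‖ = Real.exp (2 * Real.pi * k.im) := by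
    rw [Complex.norm_exp]; simp
  have h3 := exp_neg_le_half hk
  rw [Complex.sin, Complex.cos, norm_div, norm_div, norm_mul, Complex.norm_I, mul_one,
    Complex.norm_ofNat]
  set a := Complex.exp (2 * Real.pi * k * Complex.I)
  set b := Complex.exp (-(2 * Real.pi * k) * Complex.I)
  have n1 := norm_sub_norm_le b a
  have n2 := norm_sub_norm_le a b
  have n3 : ‖b‖ - ‖a‖ ≤ ‖a + b‖ := by
    have := norm_sub_norm_le b (-a)
    rwa [norm_neg, sub_neg_eq_add, add_comm b a] at this
  have n4 : ‖a‖ - ‖b‖ ≤ ‖a + b‖ := by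
    have := norm_sub_norm_le a (-b)
    rwa [norm_neg, sub_neg_eq_add] at this
  rw [norm_sub_rev a b] at n2
  rcases abs_cases k.im with ⟨h, -⟩ | ⟨h, -⟩
  · rw [h] at h3 ⊢
    constructor <;> linarith
  · rw [h] at h3 ⊢
    simp only [mul_neg, neg_neg] at h3 ⊢
    constructor <;> linarith

/-- On the lines `Re k = n + 1/4` the sine is a hyperbolic cosine. -/
theorem sin_two_pi_mul_of_re {k : ℂ} {n : ℤ} (hk : k.re = n + 1 / 4) :
    Complex.sin (2 * Real.pi * k) = Complex.cosh (2 * Real.pi * k.im) := by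
  have h : 2 * Real.pi * k = 2 * Real.pi * k.im * Complex.I + Real.pi / 2 + n * (2 * Real.pi) := by
    conv_lhs => rw [← Complex.re_add_im k, hk]
    push_cast
    ring
  rw [h, Complex.sin_add_int_mul_two_pi, Complex.sin_add_pi_div_two, Complex.cos_mul_I]

theorem le_norm_sin_of_re {k : ℂ} {n : ℕ} (hk : |k.re| = n + 1 / 4) :
    Real.exp (2 * Real.pi * |k.im|) / 4 ≤ ‖Complex.sin (2 * Real.pi * k)‖ := by
  have key : ∀ w : ℂ, w.re = n + 1 / 4 →
      Real.exp (2 * Real.pi * |w.im|) / 4 ≤ ‖Complex.sin (2 * Real.pi * w)‖ := by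
    intro w hw
    have h1 : Complex.cosh (2 * Real.pi * w.im) = (Real.cosh (2 * Real.pi * w.im) : ℂ) := by
      push_cast; rfl
    rw [sin_two_pi_mul_of_re (n := n) (by simpa using hw), h1, Complex.norm_real,
      Real.norm_of_nonneg (Real.cosh_pos _).le, ← Real.cosh_abs, abs_mul,
      abs_of_pos Real.two_pi_pos, Real.cosh_eq]
    linarith [Real.exp_pos (2 * Real.pi * |w.im|), Real.exp_pos (-(2 * Real.pi * |w.im|))]
  rcases abs_cases k.re with ⟨h, -⟩ | ⟨h, -⟩
  · exact key k (by rw [← h, hk])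
  · have := key (-k) (by rw [Complex.neg_re, ← h, hk])
    rwa [Complex.neg_im, abs_neg, mul_neg, Complex.sin_neg, norm_neg] at this

theorem cos_two_pi_mul_quarter (n : ℕ) :
    Complex.cos (2 * Real.pi * ((n : ℂ) + 1 / 4)) = 0 := by
  have h : 2 * Real.pi * ((n : ℂ) + 1 / 4) = Real.pi / 2 + n * (2 * Real.pi) := by ring
  rw [h, Complex.cos_add_nat_mul_two_pi, Complex.cos_pi_div_two]

/-- `D(k²) = 2 cos (2πk) + O(exp (2π |Im k|) / |k|)` as `|k| → ∞`. -/
def AsymptoticallyCosine (D : ℂ → ℂ) : Prop :=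
  ∃ C K : ℝ, 0 ≤ C ∧ 1 ≤ K ∧ ∀ k : ℂ, K ≤ ‖k‖ →
    ‖D (k ^ 2) - 2 * Complex.cos (2 * Real.pi * k)‖ ≤ C * Real.exp (2 * Real.pi * |k.im|) / ‖k‖

namespace AsymptoticallyCosine

variable {D : ℂ → ℂ}

/-- By Cauchy's estimate the asymptotics may be differentiated. -/
theorem exists_deriv_bound (hD : Differentiable ℂ D) (h : AsymptoticallyCosine D) :
    ∃ C K : ℝ, 0 ≤ C ∧ 1 ≤ K ∧ ∀ k : ℂ, K ≤ ‖k‖ →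
      ‖D (k ^ 2) - 2 * Complex.cos (2 * Real.pi * k)‖ ≤
        C / ‖k‖ * Real.exp (2 * Real.pi * |k.im|) ∧
      ‖2 * k * deriv D (k ^ 2) + 4 * Real.pi * Complex.sin (2 * Real.pi * k)‖ ≤
        C / ‖k‖ * Real.exp (2 * Real.pi * |k.im|) := by
  obtain ⟨C, K, hC, hK, hCK⟩ := h
  have hE : 1 ≤ Real.exp (2 * Real.pi) := Real.one_le_exp Real.two_pi_pos.le
  refine ⟨2 * C * Real.exp (2 * Real.pi), K + 1, by positivity, by linarith, fun k hk => ?_⟩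
  have hk0 : 0 < ‖k‖ := by linarith
  have he := Real.exp_pos (2 * Real.pi * |k.im|)
  constructor
  · refine (hCK k (by linarith)).trans ?_
    rw [mul_div_right_comm]
    gcongr
    nlinarith
  · set g : ℂ → ℂ := fun w => D (w ^ 2) - 2 * Complex.cos (2 * Real.pi * w) with hg
    have hgd : ∀ w, HasDerivAt g
        (2 * w * deriv D (w ^ 2) + 4 * Real.pi * Complex.sin (2 * Real.pi * w)) w := fun w => by
      have h1 := hasDerivAt_comp_add_sq hD 0 w
      simp only [zero_add] at h1
      have h2 := ((Complex.hasDerivAt_cos (2 * Real.pi * w)).comp w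
        ((hasDerivAt_id w).const_mul (2 * (Real.pi : ℂ)))).const_mul 2
      refine (h1.sub h2).congr_deriv ?_
      ring
    rw [← (hgd k).deriv]
    refine (Complex.norm_deriv_le_of_forall_mem_sphere_norm_le one_pos
      (Differentiable.diffContOnCl fun w => (hgd w).differentiableAt)
      (C := 2 * C * Real.exp (2 * Real.pi) / ‖k‖ * Real.exp (2 * Real.pi * |k.im|))
      fun w hw => ?_).trans (by rw [div_one])
    rw [mem_sphere_iff_norm] at hw
    have h1 : ‖k‖ - 1 ≤ ‖w‖ := by
      have := norm_sub_norm_le k w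
      rw [norm_sub_rev, hw] at this
      linarith
    have h2 : |w.im| ≤ 1 + |k.im| := by
      have h3 := Complex.abs_im_le_norm (w - k)
      rw [hw, Complex.sub_im] at h3
      have := abs_sub_abs_le_abs_sub w.im k.im
      linarith
    refine (hCK w (by linarith)).trans ?_
    have h3 : ‖k‖ / 2 ≤ ‖w‖ := by linarith
    calc C * Real.exp (2 * Real.pi * |w.im|) / ‖w‖
        ≤ C * Real.exp (2 * Real.pi * (1 + |k.im|)) / (‖k‖ / 2) := by
          gcongr
      _ = _ := by
          rw [mul_add, Real.exp_add, mul_one]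
          field_simp

theorem exists_four_sub_sq_ne_zero (h : AsymptoticallyCosine D) : ∃ z, 4 - D z ^ 2 ≠ 0 := by
  obtain ⟨C, K, hC, hK, hCK⟩ := h
  obtain ⟨n, hn⟩ := exists_nat_gt (max C K)
  have hn1 := (le_max_left C K).trans_lt hn
  have hn2 := (le_max_right C K).trans_lt hn
  have hkn : ((n : ℂ) + 1 / 4) = ((n + 1 / 4 : ℝ) : ℂ) := by push_cast; rfl
  have hnorm : ‖(n : ℂ) + 1 / 4‖ = n + 1 / 4 := by
    rw [hkn, Complex.norm_real, Real.norm_of_nonneg (by positivity)]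
  have hk := hCK ((n : ℂ) + 1 / 4) (by rw [hnorm]; linarith)
  rw [cos_two_pi_mul_quarter, mul_zero, sub_zero, hnorm] at hk
  have him : ((n : ℂ) + 1 / 4).im = 0 := by rw [hkn, Complex.ofReal_im]
  rw [him, abs_zero, mul_zero, Real.exp_zero, mul_one] at hk
  refine ⟨((n : ℂ) + 1 / 4) ^ 2, fun h0 => ?_⟩
  have h1 : ‖D (((n : ℂ) + 1 / 4) ^ 2)‖ < 1 := by
    refine hk.trans_lt ?_
    rw [div_lt_one (by positivity)]
    linarith
  have h2 : ‖D (((n : ℂ) + 1 / 4) ^ 2)‖ ^ 2 = 4 := by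
    rw [← norm_pow, ← sub_eq_zero.1 h0]; simp
  nlinarith [norm_nonneg (D (((n : ℂ) + 1 / 4) ^ 2))]

end AsymptoticallyCosine

/-- Where `sin (2πk)` is bounded below, so is `4 - D²` for `D` close to `2 cos (2πk)`. -/
theorem le_norm_four_sub_sq {s c g : ℂ} {e C r : ℝ} (he : 0 < e) (hr : 1 ≤ r) (hC : 0 ≤ C)
    (hrC : 100 * C ≤ r) (hsc : s ^ 2 + c ^ 2 = 1) (hc : ‖c‖ ≤ e) (hse : e / 4 ≤ ‖s‖)
    (hg : ‖g‖ ≤ C / r * e) : e ^ 2 / 8 ≤ ‖4 - (2 * c + g) ^ 2‖ := by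
  have hr0 : 0 < r := by linarith
  set δ := C / r with hδ
  have hδ0 : 0 ≤ δ := by positivity
  have hδ1 : δ ≤ 1 / 100 := by rw [hδ, div_le_iff₀ hr0]; linarith
  have hHs : 4 - (2 * c + g) ^ 2 = 4 * s ^ 2 - (4 * c * g + g ^ 2) := by
    linear_combination -4 * hsc
  have h1 : ‖4 * c * g + g ^ 2‖ ≤ 4 * e * (δ * e) + (δ * e) ^ 2 := by
    refine (norm_add_le _ _).trans ?_
    rw [norm_mul, norm_mul, norm_pow, Complex.norm_ofNat]
    gcongr
  have h2 := norm_sub_norm_le (4 * s ^ 2) (4 * c * g + g ^ 2)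
  rw [← hHs, norm_mul, norm_pow, Complex.norm_ofNat] at h2
  have h3 : (e / 4) ^ 2 ≤ ‖s‖ ^ 2 := by gcongr
  nlinarith [sq_nonneg e, mul_le_mul_of_nonneg_right hδ1 (sq_nonneg e),
    mul_le_mul_of_nonneg_right (mul_le_mul hδ1 hδ1 hδ0 (by norm_num)) (sq_nonneg e)]

/-- The algebra behind the comparison of `(D')² (lam - lam₀)` with `π² (4 - D²)`: `s`, `c` are
`sin (2πk)`, `cos (2πk)`, and `g`, `g₁` the deviations of `D(k²)` and of its `k`-derivative from
those of `2 cos (2πk)`. -/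
theorem norm_quotient_sub_le {s c g g₁ k N H lam₀ : ℂ} {e C r : ℝ} (he : 0 < e)
    (hk : k ≠ 0) (hkr : r ≤ ‖k‖) (hr : 1 ≤ r) (hC : 0 ≤ C) (hrC : 100 * C ≤ r)
    (hsc : s ^ 2 + c ^ 2 = 1)
    (hs : ‖s‖ ≤ e) (hc : ‖c‖ ≤ e) (hse : e / 4 ≤ ‖s‖) (hg : ‖g‖ ≤ C / r * e)
    (hg₁ : ‖g₁‖ ≤ C / r * e)
    (hN : 4 * k ^ 2 * N = (g₁ - 4 * Real.pi * s) ^ 2 * (k ^ 2 - lam₀))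
    (hH : H = 4 - (2 * c + g) ^ 2) :
    ‖N - Real.pi ^ 2 * H‖ ≤ 8 * (100 * C + 100 * ‖lam₀‖) / r * ‖H‖ := by
  have hr0 : 0 < r := by linarith
  set δ := C / r with hδ
  have hδ0 : 0 ≤ δ := by positivity
  have hδ1 : δ ≤ 1 / 100 := by rw [hδ, div_le_iff₀ hr0]; linarith
  have hπ := Real.pi_pos
  have hπ4 := Real.pi_lt_four
  have hπ3 : Real.pi < 3.15 := Real.pi_lt_d2
  have hHs : H = 4 * s ^ 2 - (4 * c * g + g ^ 2) := by rw [hH]; linear_combination -4 * hsc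
  have hHl : e ^ 2 / 8 ≤ ‖H‖ := hH ▸ le_norm_four_sub_sq he hr hC hrC hsc hc hse hg
  have hE : N - Real.pi ^ 2 * H = -(2 * Real.pi * s * g₁) + g₁ ^ 2 / 4 +
      4 * Real.pi ^ 2 * c * g + Real.pi ^ 2 * g ^ 2 -
      lam₀ * (g₁ - 4 * Real.pi * s) ^ 2 / (4 * k ^ 2) := by
    have hN' : N = (g₁ - 4 * Real.pi * s) ^ 2 * (k ^ 2 - lam₀) / (4 * k ^ 2) := by
      field_simp
      linear_combination hN
    rw [hN', hHs]
    field_simp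
    ring
  have hEl : ‖N - Real.pi ^ 2 * H‖ ≤ (100 * C + 100 * ‖lam₀‖) / r * e ^ 2 := by
    have b1 : ‖2 * Real.pi * s * g₁‖ ≤ 2 * Real.pi * e * (δ * e) := by
      rw [norm_mul, norm_mul, norm_mul, Complex.norm_ofNat, Complex.norm_real,
        Real.norm_of_nonneg hπ.le]
      gcongr
    have b2 : ‖g₁ ^ 2 / 4‖ ≤ (δ * e) ^ 2 / 4 := by
      rw [norm_div, norm_pow, Complex.norm_ofNat]
      gcongr
    have b3 : ‖4 * Real.pi ^ 2 * c * g‖ ≤ 4 * Real.pi ^ 2 * e * (δ * e) := by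
      rw [norm_mul, norm_mul, norm_mul, Complex.norm_ofNat, norm_pow, Complex.norm_real,
        Real.norm_of_nonneg hπ.le]
      gcongr
    have b4 : ‖Real.pi ^ 2 * g ^ 2‖ ≤ Real.pi ^ 2 * (δ * e) ^ 2 := by
      rw [norm_mul, norm_pow, norm_pow, Complex.norm_real, Real.norm_of_nonneg hπ.le]
      gcongr
    have b5 : ‖lam₀ * (g₁ - 4 * Real.pi * s) ^ 2 / (4 * k ^ 2)‖ ≤
        ‖lam₀‖ * (δ * e + 4 * Real.pi * e) ^ 2 / (4 * r ^ 2) := by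
      rw [norm_div, norm_mul, norm_mul, norm_pow, norm_pow, Complex.norm_ofNat]
      gcongr
      refine (norm_sub_le _ _).trans ?_
      rw [norm_mul, norm_mul, Complex.norm_ofNat, Complex.norm_real, Real.norm_of_nonneg hπ.le]
      gcongr
    have b6 : ‖lam₀‖ * (δ * e + 4 * Real.pi * e) ^ 2 / (4 * r ^ 2) ≤ 100 * ‖lam₀‖ / r * e ^ 2 := by
      have h1 : (δ * e + 4 * Real.pi * e) ^ 2 ≤ (20 * e) ^ 2 := by
        gcongr
        nlinarith
      calc _ ≤ ‖lam₀‖ * (20 * e) ^ 2 / (4 * r ^ 2) := by gcongr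
        _ = 100 * ‖lam₀‖ / r * e ^ 2 * (1 / r) := by field_simp; ring
        _ ≤ 100 * ‖lam₀‖ / r * e ^ 2 * 1 := by
          gcongr
          rw [div_le_one hr0]
          exact hr
        _ = _ := mul_one _
    have b7 : 2 * Real.pi * e * (δ * e) + (δ * e) ^ 2 / 4 + 4 * Real.pi ^ 2 * e * (δ * e) +
        Real.pi ^ 2 * (δ * e) ^ 2 ≤ 100 * δ * e ^ 2 := by
      have h2 : Real.pi ^ 2 ≤ 10 := by nlinarith
      have h1 : 2 * Real.pi + δ / 4 + 4 * Real.pi ^ 2 + Real.pi ^ 2 * δ ≤ 100 := by nlinarith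
      calc _ = (2 * Real.pi + δ / 4 + 4 * Real.pi ^ 2 + Real.pi ^ 2 * δ) * (δ * e ^ 2) := by ring
        _ ≤ 100 * (δ * e ^ 2) := by gcongr
        _ = _ := by ring
    rw [hE]
    have t1 := norm_sub_le (-(2 * Real.pi * s * g₁) + g₁ ^ 2 / 4 +
      4 * Real.pi ^ 2 * c * g + Real.pi ^ 2 * g ^ 2)
      (lam₀ * (g₁ - 4 * Real.pi * s) ^ 2 / (4 * k ^ 2))
    have t2 := norm_add_le (-(2 * Real.pi * s * g₁) + g₁ ^ 2 / 4 +
      4 * Real.pi ^ 2 * c * g) (Real.pi ^ 2 * g ^ 2)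
    have t3 := norm_add_le (-(2 * Real.pi * s * g₁) + g₁ ^ 2 / 4) (4 * Real.pi ^ 2 * c * g)
    have t4 := norm_add_le (-(2 * Real.pi * s * g₁)) (g₁ ^ 2 / 4)
    rw [norm_neg] at t4
    have e1 : (100 * C + 100 * ‖lam₀‖) / r * e ^ 2 =
        100 * δ * e ^ 2 + 100 * ‖lam₀‖ / r * e ^ 2 := by rw [hδ]; ring
    rw [e1]
    linarith
  calc _ ≤ (100 * C + 100 * ‖lam₀‖) / r * e ^ 2 := hEl
    _ = 8 * (100 * C + 100 * ‖lam₀‖) / r * (e ^ 2 / 8) := by ring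
    _ ≤ _ := by gcongr

end AsymptoticallyCosine

/-! ### The differential equation for the discriminant -/

section AsymptoticallyCosineODE

open Filter Topology

/-- If `D` is asymptotic to `2 cos (2π √lam)` and takes the values `±2` only with multiplicity off
`lam₀`, then the entire function `(D')² (lam - lam₀) / (4 - D²)` tends to `π²` on a sequence of
growing contours, so that it equals `π²`. -/
theorem AsymptoticallyCosine.ode {D : ℂ → ℂ} (h : AsymptoticallyCosine D)
    (hD : Differentiable ℂ D) {lam₀ : ℂ}
    (hmult : ∀ μ, μ ≠ lam₀ → D μ ^ 2 = 4 → deriv D μ = 0) (lam : ℂ) :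
    deriv D lam ^ 2 * (lam - lam₀) = Real.pi ^ 2 * (4 - D lam ^ 2) := by
  have hD' : Differentiable ℂ (deriv D) := fun z => (hD.analyticAt z).deriv.differentiableAt
  obtain ⟨Q, hQ, hQeq⟩ := exists_entire_quotient (N := fun w => deriv D w ^ 2 * (w - lam₀))
    (h := fun w => 4 - D w ^ 2) (by fun_prop) (by fun_prop) h.exists_four_sub_sq_ne_zero
    (analyticOrderAt_four_sub_sq_le hD hmult)
  obtain ⟨C, K, hC, hK, hCK⟩ := h.exists_deriv_bound hD
  set M := 8 * (100 * C + 100 * ‖lam₀‖) with hM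
  obtain ⟨k₀, hk₀⟩ := IsAlgClosed.exists_pow_nat_eq lam two_pos
  have bound : ∀ n : ℕ, K + 100 * C + 1 + |k₀.re| + |k₀.im| ≤ n →
      ‖Q (k₀ ^ 2) - Real.pi ^ 2‖ ≤ M / (n + 1 / 4) := by
    intro n hn
    set r : ℝ := n + 1 / 4 with hr
    have hr1 : 1 ≤ r := by rw [hr]; linarith [abs_nonneg k₀.re, abs_nonneg k₀.im]
    have hrC : 100 * C ≤ r := by rw [hr]; linarith [abs_nonneg k₀.re, abs_nonneg k₀.im]
    have hrK : K ≤ r := by rw [hr]; linarith [abs_nonneg k₀.re, abs_nonneg k₀.im]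
    have hbd : Bornology.IsBounded (Set.Ioo (-r) r ×ℂ Set.Ioo (-r) r) :=
      (Metric.isBounded_Ioo _ _).reProdIm (Metric.isBounded_Ioo _ _)
    refine Complex.norm_le_of_forall_mem_frontier_norm_le hbd
      (f := fun k => Q (k ^ 2) - Real.pi ^ 2) (Differentiable.diffContOnCl (by fun_prop))
      (fun k hk => ?_) (subset_closure ?_)
    -- the boundary of the square `|Re k|, |Im k| < r`, on which `sin (2πk)` is bounded below
    · have hk' : (|k.im| ≤ r ∧ |k.re| = r) ∨ (|k.re| ≤ r ∧ |k.im| = r) := by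
        have hlt : -r < r := by linarith
        rw [Complex.frontier_reProdIm, closure_Ioo hlt.ne, frontier_Ioo hlt] at hk
        have e : ∀ x : ℝ, x ∈ ({-r, r} : Set ℝ) → |x| = r := by
          rintro x (rfl | rfl)
          · rw [abs_neg, abs_of_pos (by linarith)]
          · exact abs_of_pos (by linarith)
        rcases hk with hk | hk
        · exact Or.inr ⟨abs_le.2 hk.1, e _ hk.2⟩
        · exact Or.inl ⟨abs_le.2 hk.2, e _ hk.1⟩
      have hkr : r ≤ ‖k‖ := by
        rcases hk' with hk' | hk'
        · exact hk'.2.ge.trans (Complex.abs_re_le_norm k)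
        · exact hk'.2.ge.trans (Complex.abs_im_le_norm k)
      have hse : Real.exp (2 * Real.pi * |k.im|) / 4 ≤ ‖Complex.sin (2 * Real.pi * k)‖ := by
        rcases hk' with hk' | hk'
        · exact le_norm_sin_of_re hk'.2
        · exact (le_norm_trig_of_one_le_abs_im (hk'.2 ▸ hr1)).1
      have hk0 : k ≠ 0 := norm_pos_iff.1 (by linarith)
      obtain ⟨hg, hg₁⟩ := hCK k (hrK.trans hkr)
      have he := Real.exp_pos (2 * Real.pi * |k.im|)
      have hCr : C / ‖k‖ * Real.exp (2 * Real.pi * |k.im|) ≤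
          C / r * Real.exp (2 * Real.pi * |k.im|) := by gcongr
      have key := norm_quotient_sub_le (lam₀ := lam₀)
        (N := deriv D (k ^ 2) ^ 2 * (k ^ 2 - lam₀)) (H := 4 - D (k ^ 2) ^ 2)
        he hk0 hkr hr1 hC hrC (Complex.sin_sq_add_cos_sq _) (norm_sin_two_pi_mul_le k)
        (norm_cos_two_pi_mul_le k) hse (hg.trans hCr) (hg₁.trans hCr) (by ring) (by ring)
      have hH : 0 < ‖4 - D (k ^ 2) ^ 2‖ := by
        have := le_norm_four_sub_sq he hr1 hC hrC (Complex.sin_sq_add_cos_sq _)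
          (norm_cos_two_pi_mul_le k) hse (hg.trans hCr)
        rw [add_sub_cancel] at this
        exact lt_of_lt_of_le (by positivity) this
      have e2 : deriv D (k ^ 2) ^ 2 * (k ^ 2 - lam₀) - Real.pi ^ 2 * (4 - D (k ^ 2) ^ 2) =
          (Q (k ^ 2) - Real.pi ^ 2) * (4 - D (k ^ 2) ^ 2) := by
        rw [sub_mul, ← hQeq]
      rw [e2, norm_mul] at key
      exact le_of_mul_le_mul_right key hH
    · have h1 : ∀ x : ℝ, |x| ≤ |k₀.re| + |k₀.im| → x ∈ Set.Ioo (-r) r := fun x hx =>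
        abs_lt.1 (by rw [hr]; linarith)
      exact ⟨h1 _ (by linarith [abs_nonneg k₀.im]), h1 _ (by linarith [abs_nonneg k₀.re])⟩
  have hlim : Tendsto (fun n : ℕ => M / ((n : ℝ) + 1 / 4)) atTop (𝓝 0) :=
    (tendsto_const_nhds (x := M)).div_atTop
      (tendsto_atTop_add_const_right _ _ tendsto_natCast_atTop_atTop)
  have h0 : ‖Q (k₀ ^ 2) - Real.pi ^ 2‖ ≤ 0 :=
    ge_of_tendsto hlim ((tendsto_natCast_atTop_atTop.eventually_ge_atTop _).mono bound)
  have h1 : Q lam = Real.pi ^ 2 := by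
    rw [← hk₀]
    exact sub_eq_zero.1 (norm_le_zero_iff.1 h0)
  rw [hQeq lam, h1]

end AsymptoticallyCosineODE

/-! ### Comparison with a constant potential -/

section Discriminant

variable {q : ℝ → ℂ}

theorem asymptoticallyCosine_hillDiscriminant (hq : LocallyIntegrable q volume) :
    AsymptoticallyCosine (hillDiscriminant q) := by
  obtain ⟨C, K, hC, hK, h⟩ := exists_hillDiscriminant_asymptotics hq
  set J := ∫ t in (0 : ℝ)..(2 * Real.pi), q t
  refine ⟨C + ‖J‖, K, by positivity, hK, fun k hk => ?_⟩
  have hk1 : 1 ≤ ‖k‖ := hK.trans hk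
  have hk0 : 0 < ‖k‖ := by linarith
  have he := Real.exp_pos (2 * Real.pi * |k.im|)
  have h1 : ‖J * (Complex.sin (2 * Real.pi * k) / k)‖ ≤
      ‖J‖ * (Real.exp (2 * Real.pi * |k.im|) / ‖k‖) := by
    rw [norm_mul, norm_div]
    gcongr
    exact norm_sin_two_pi_mul_le k
  have h2 : C * Real.exp (2 * Real.pi * |k.im|) / ‖k‖ ^ 2 ≤
      C * Real.exp (2 * Real.pi * |k.im|) / ‖k‖ := by
    gcongr
    exact le_self_pow₀ hk1 two_ne_zero
  have h3 := norm_add_le (hillDiscriminant q (k ^ 2) - 2 * Complex.cos (2 * Real.pi * k) -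
    J * (Complex.sin (2 * Real.pi * k) / k)) (J * (Complex.sin (2 * Real.pi * k) / k))
  rw [sub_add_cancel] at h3
  calc _ ≤ _ := h3
    _ ≤ C * Real.exp (2 * Real.pi * |k.im|) / ‖k‖ +
        ‖J‖ * (Real.exp (2 * Real.pi * |k.im|) / ‖k‖) := add_le_add ((h k hk).trans h2) h1
    _ = _ := by ring

theorem isHillSolution_const_of_hasDerivAt {lam₀ lam : ℂ} {y y' : ℝ → ℂ}
    (h : ∀ x, HasDerivAt y (y' x) x) (h' : ∀ x, HasDerivAt y' ((lam₀ - lam) * y x) x) :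
    IsHillSolution (fun _ => lam₀) lam y := by
  have hy : Continuous y := continuous_iff_continuousAt.2 fun x => (h x).continuousAt
  have hd : deriv y = y' := funext fun x => (h x).deriv
  refine ⟨fun x => (lam₀ - lam) * y x, ⟨(by fun_prop : Continuous _).locallyIntegrable,
    fun x => (h x).differentiableAt, fun x => ?_⟩, .of_forall fun x => by ring⟩
  rw [hd, intervalIntegral.integral_eq_sub_of_hasDerivAt (fun t _ => h' t)
    ((by fun_prop : Continuous fun x => (lam₀ - lam) * y x).intervalIntegrable _ _)]
  ring

theorem hillDiscriminant_const (lam₀ : ℂ) {z : ℂ} (hz : z ≠ 0) :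
    hillDiscriminant (fun _ => lam₀) (lam₀ + z ^ 2) = 2 * Complex.cos (2 * Real.pi * z) := by
  have hq : LocallyIntegrable (fun _ : ℝ => lam₀) volume := continuous_const.locallyIntegrable
  have hlin : ∀ x : ℝ, HasDerivAt (fun x : ℝ => z * (x : ℂ)) z x := fun x => by
    simpa using (Complex.ofRealCLM.hasDerivAt (x := x)).const_mul z
  have hc : ∀ x : ℝ, HasDerivAt (fun x : ℝ => Complex.cos (z * x))
      (-z * Complex.sin (z * x)) x := fun x => by
    have := (Complex.hasDerivAt_cos (z * x)).comp x (hlin x)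
    exact this.congr_deriv (by ring)
  have hs : ∀ x : ℝ, HasDerivAt (fun x : ℝ => Complex.sin (z * x))
      (z * Complex.cos (z * x)) x := fun x => by
    have := (Complex.hasDerivAt_sin (z * x)).comp x (hlin x)
    exact this.congr_deriv (by ring)
  have hv : ∀ x : ℝ, HasDerivAt (fun x : ℝ => Complex.sin (z * x) / z)
      (Complex.cos (z * x)) x := fun x =>
    ((hs x).div_const z).congr_deriv (by field_simp)
  have su : IsHillSolution (fun _ => lam₀) (lam₀ + z ^ 2) fun x : ℝ => Complex.cos (z * x) :=
    isHillSolution_const_of_hasDerivAt hc fun x => ((hs x).const_mul (-z)).congr_deriv (by ring)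
  have sv : IsHillSolution (fun _ => lam₀) (lam₀ + z ^ 2) fun x : ℝ => Complex.sin (z * x) / z :=
    isHillSolution_const_of_hasDerivAt hv fun x => (hc x).congr_deriv (by field_simp; ring)
  obtain ⟨hu1, hu2, hu3⟩ := isHillSolution_hillU hq (lam₀ + z ^ 2)
  obtain ⟨hv1, hv2, hv3⟩ := isHillSolution_hillV hq (lam₀ + z ^ 2)
  have eu := hu1.eq_of_initial hq su (by simp [hu2]) (by rw [hu3, (hc 0).deriv]; simp)
  have ev := hv1.eq_of_initial hq sv (by simp [hv2]) (by rw [hv3, (hv 0).deriv]; simp)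
  rw [hillDiscriminant, eu, ev, (hv _).deriv]
  push_cast
  rw [mul_comm z]
  ring

end Discriminant

section InverseTheorem

variable {q : ℝ → ℂ}

/-- The second term of the asymptotics of the discriminant determines the mean value, by comparison
with the constant potential `lam₀`; the leading term determines the sign. -/
theorem integral_eq_of_hillDiscriminant_eq (hq : LocallyIntegrable q volume) {lam₀ σ : ℂ}
    (hσ : σ = 1 ∨ σ = -1)
    (h : ∀ z : ℂ, hillDiscriminant q (lam₀ + z ^ 2) = σ * (2 * Complex.cos (2 * Real.pi * z))) :
    σ = 1 ∧ ∫ t in (0 : ℝ)..(2 * Real.pi), q t = 2 * Real.pi * lam₀ := by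
  obtain ⟨C, K, hC, hK, hCK⟩ := exists_hillDiscriminant_asymptotics hq
  obtain ⟨C', K', hC', hK', hCK'⟩ := exists_hillDiscriminant_asymptotics
    (continuous_const.locallyIntegrable : LocallyIntegrable (fun _ : ℝ => lam₀) volume)
  rw [intervalIntegral.integral_const, sub_zero, Complex.real_smul] at hCK'
  push_cast at hCK'
  set J := ∫ t in (0 : ℝ)..(2 * Real.pi), q t with hJ
  set J' := 2 * Real.pi * lam₀ with hJ'
  -- both discriminants at `-κ²`, where sine and cosine are of exponential size
  have key : ∀ κ : ℝ, K + K' + ‖lam₀‖ + 1 ≤ κ → ∃ c s : ℂ, ∃ e : ℝ, 0 < e ∧ e / 4 ≤ ‖c‖ ∧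
      e / 4 ≤ ‖s‖ ∧ ‖s‖ ≤ e ∧ ∃ k D : ℂ, ‖k‖ = κ ∧
      ‖σ * D - 2 * c - J * (s / k)‖ ≤ C * e / κ ^ 2 ∧
      ‖D - 2 * c - J' * (s / k)‖ ≤ C' * e / κ ^ 2 := by
    intro κ hκ
    have hl := norm_nonneg lam₀
    have hκ0 : 0 < κ := by linarith
    have hκn : ‖(κ : ℂ) * Complex.I‖ = κ := by simp [abs_of_pos hκ0]
    have him : |((κ : ℂ) * Complex.I).im| = κ := by simp [abs_of_pos hκ0]
    obtain ⟨z, hz⟩ := IsAlgClosed.exists_pow_nat_eq (((κ : ℂ) * Complex.I) ^ 2 - lam₀) two_pos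
    have hz0 : z ≠ 0 := by
      rintro rfl
      have h1 : ‖((κ : ℂ) * Complex.I) ^ 2‖ = ‖lam₀‖ := by
        congr 1
        linear_combination -hz
      rw [norm_pow, hκn] at h1
      nlinarith
    have hlz : lam₀ + z ^ 2 = ((κ : ℂ) * Complex.I) ^ 2 := by rw [hz]; ring
    have h1 := h z
    have h2 := hillDiscriminant_const lam₀ hz0
    rw [← h2, hlz] at h1
    have b1 := hCK ((κ : ℂ) * Complex.I) (by rw [hκn]; linarith)
    have b2 := hCK' ((κ : ℂ) * Complex.I) (by rw [hκn]; linarith)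
    rw [hκn] at b1 b2
    rw [h1] at b1
    obtain ⟨l1, l2⟩ := le_norm_trig_of_one_le_abs_im (k := (κ : ℂ) * Complex.I)
      (by rw [him]; linarith)
    exact ⟨_, _, _, Real.exp_pos _, l2, l1, norm_sin_two_pi_mul_le _, _, _, hκn, b1, b2⟩
  rcases hσ with rfl | rfl
  · refine ⟨rfl, sub_eq_zero.1 (norm_le_zero_iff.1 (le_of_forall_pos_le_add fun ε hε => ?_))⟩
    obtain ⟨c, s, e, he, -, hs, -, k, D, hk, b1, b2⟩ :=
      key (K + K' + ‖lam₀‖ + 1 + 4 * (C + C') / ε) (by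
        have : 0 ≤ 4 * (C + C') / ε := by positivity
        linarith)
    set κ := K + K' + ‖lam₀‖ + 1 + 4 * (C + C') / ε with hκ
    have hl := norm_nonneg lam₀
    have hq0 : 0 ≤ 4 * (C + C') / ε := by positivity
    have hκ0 : 0 < κ := by linarith
    have h3 := norm_sub_le (D - 2 * c - J' * (s / k)) (1 * D - 2 * c - J * (s / k))
    have e3 : D - 2 * c - J' * (s / k) - (1 * D - 2 * c - J * (s / k)) = (J - J') * (s / k) := by
      ring
    rw [e3, norm_mul, norm_div, hk] at h3
    have h4 : ‖J - J'‖ * (e / 4 / κ) ≤ (C + C') * e / κ ^ 2 := by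
      calc _ ≤ ‖J - J'‖ * (‖s‖ / κ) := by gcongr
        _ ≤ C' * e / κ ^ 2 + C * e / κ ^ 2 := by linarith
        _ = _ := by ring
    have h5 : ‖J - J'‖ * κ ≤ 4 * (C + C') := by
      have e5 : ‖J - J'‖ * κ = ‖J - J'‖ * (e / 4 / κ) * (4 * κ ^ 2 / e) := by field_simp
      have e6 : 4 * (C + C') = (C + C') * e / κ ^ 2 * (4 * κ ^ 2 / e) := by field_simp
      rw [e5, e6]
      gcongr
    rw [zero_add]
    have h6 : 4 * (C + C') ≤ ε * κ := by
      have : ε * (4 * (C + C') / ε) = 4 * (C + C') := by field_simp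
      rw [← this]
      gcongr
      linarith
    exact le_of_mul_le_mul_right (h5.trans h6) hκ0
  · exfalso
    obtain ⟨c, s, e, he, hc, -, hs, k, D, hk, b1, b2⟩ :=
      key (K + K' + ‖lam₀‖ + 1 + (C + C') + ‖J + J'‖) (by
        linarith [norm_nonneg (J + J')])
    set κ := K + K' + ‖lam₀‖ + 1 + (C + C') + ‖J + J'‖ with hκ
    have hl := norm_nonneg lam₀
    have hJJ := norm_nonneg (J + J')
    have hκ0 : 0 < κ := by linarith
    have hκ1 : 1 ≤ κ := by linarith
    have h3 := norm_add_le (-1 * D - 2 * c - J * (s / k)) (D - 2 * c - J' * (s / k))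
    have h4 := norm_sub_le
      ((-1 * D - 2 * c - J * (s / k)) + (D - 2 * c - J' * (s / k))) (-((J + J') * (s / k)))
    have e4 : (-1 * D - 2 * c - J * (s / k)) + (D - 2 * c - J' * (s / k)) -
      -((J + J') * (s / k)) = -(4 * c) := by ring
    rw [e4, norm_neg, norm_neg, norm_mul, norm_mul, norm_div, hk, Complex.norm_ofNat] at h4
    have h5 : ‖J + J'‖ * (‖s‖ / κ) ≤ ‖J + J'‖ * (e / κ) := by gcongr
    have h6 : (C + C') * e / κ ^ 2 ≤ (C + C') * e / κ := by
      gcongr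
      exact le_self_pow₀ hκ1 two_ne_zero
    have e6 : (C + C') * e / κ ^ 2 = C * e / κ ^ 2 + C' * e / κ ^ 2 := by ring
    have h7 : e ≤ (C + C' + ‖J + J'‖) / κ * e := by
      have : (C + C' + ‖J + J'‖) / κ * e = (C + C') * e / κ + ‖J + J'‖ * (e / κ) := by ring
      linarith
    have h8 : (C + C' + ‖J + J'‖) / κ < 1 := by
      rw [div_lt_one hκ0]
      linarith
    nlinarith

/-- If `Δ` takes the values `±2` only with multiplicity off `lam₀`, then `Δ` is the discriminant of
the constant potential `lam₀`, and `lam₀` is the mean value of `q`. -/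
theorem hillMean_eq_and_hillDiscriminant_eq (hq : LocallyIntegrable q volume) {lam₀ : ℂ}
    (hmult : ∀ μ, μ ≠ lam₀ → hillDiscriminant q μ ^ 2 = 4 → deriv (hillDiscriminant q) μ = 0) :
    hillMean q = lam₀ ∧
      ∀ z : ℂ, hillDiscriminant q (lam₀ + z ^ 2) = 2 * Complex.cos (2 * Real.pi * z) := by
  have hD := differentiable_hillDiscriminant hq
  have has := asymptoticallyCosine_hillDiscriminant hq
  obtain ⟨σ, hσ, h⟩ := eq_two_cos_or_neg_of_ode hD has.exists_four_sub_sq_ne_zero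
    (has.ode hD hmult)
  obtain ⟨rfl, h1⟩ := integral_eq_of_hillDiscriminant_eq hq hσ h
  refine ⟨?_, fun z => by rw [h z, one_mul]⟩
  have hπ : (Real.pi : ℂ) ≠ 0 := Complex.ofReal_ne_zero.2 Real.pi_ne_zero
  rw [hillMean, h1]
  field_simp

end InverseTheorem

/-! ### Unboundedness of the spectrum -/

section Unbounded

open Filter Topology

theorem exists_pos_le_norm_cos_on_sphere : ∃ c : ℝ, 0 < c ∧ ∀ (n : ℕ) (z : ℂ),
    z ∈ Metric.sphere ((n : ℂ) + 1 / 4) (1 / 8) → c ≤ ‖Complex.cos (2 * Real.pi * z)‖ := by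
  have hcomp : IsCompact (Metric.sphere (1 / 4 : ℂ) (1 / 8)) := isCompact_sphere _ _
  obtain ⟨w, hw, hmin⟩ := hcomp.exists_isMinOn (NormedSpace.sphere_nonempty.2 (by norm_num))
    (f := fun z : ℂ => ‖Complex.cos (2 * Real.pi * z)‖) (by fun_prop)
  refine ⟨‖Complex.cos (2 * Real.pi * w)‖, norm_pos_iff.2 fun h0 => ?_, fun n z hz => ?_⟩
  · obtain ⟨m, hm⟩ := Complex.cos_eq_zero_iff.1 h0
    have hπ : (Real.pi : ℂ) ≠ 0 := Complex.ofReal_ne_zero.2 Real.pi_ne_zero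
    have hw2 : w - 1 / 4 = ((m / 2 : ℝ) : ℂ) := by
      push_cast
      have : (4 * Real.pi : ℂ) * (w - 1 / 4 - m / 2) = 0 := by linear_combination 2 * hm
      exact sub_eq_zero.1 ((mul_eq_zero.1 this).resolve_left (mul_ne_zero (by norm_num) hπ))
    rw [mem_sphere_iff_norm, hw2, Complex.norm_real, Real.norm_eq_abs, abs_div,
      abs_of_pos (two_pos : (0 : ℝ) < 2)] at hw
    have h4 : (4 : ℝ) * |(m : ℝ)| = 1 := by linarith
    have h5 : 4 * |m| = 1 := by exact_mod_cast h4
    omega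
  · have h1 : z - n ∈ Metric.sphere (1 / 4 : ℂ) (1 / 8) := by
      rw [mem_sphere_iff_norm] at hz ⊢
      rw [← hz]
      congr 1
      ring
    have h2 := hmin h1
    have e : 2 * Real.pi * z = 2 * Real.pi * (z - n) + n * (2 * Real.pi) := by ring
    rw [e, Complex.cos_add_nat_mul_two_pi]
    exact h2

/-- Near each large `n + 1/4`, a zero of `2 cos (2πk)`, the function `D(k²)` has a zero. -/
theorem AsymptoticallyCosine.exists_large_zero {D : ℂ → ℂ} (h : AsymptoticallyCosine D)
    (hD : Differentiable ℂ D) (R : ℝ) : ∃ lam, R ≤ ‖lam‖ ∧ D lam = 0 := by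
  obtain ⟨C, K, hC, hK, hCK⟩ := h
  obtain ⟨c, hc, hcos⟩ := exists_pos_le_norm_cos_on_sphere
  -- on the disc of radius `1/8` about `n + 1/4` the deviation from the cosine is at most `A / n`,
  -- which for large `n` is small compared to the cosine on the circle
  set A := C * Real.exp (2 * Real.pi) with hA
  have hA0 : 0 ≤ A := by positivity
  obtain ⟨n, hn⟩ := exists_nat_gt (K + |R| + 3 * A / c + 1)
  have hAc : 0 ≤ 3 * A / c := by positivity
  have hR := abs_nonneg R
  have hn1 : 1 ≤ (n : ℝ) := by linarith
  set z₀ : ℂ := (n : ℂ) + 1 / 4 with hz₀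
  set f : ℂ → ℂ := fun w => D (w ^ 2) with hf
  have hz₀n : ‖z₀‖ = n + 1 / 4 := by
    have : z₀ = ((n + 1 / 4 : ℝ) : ℂ) := by rw [hz₀]; push_cast; rfl
    rw [this, Complex.norm_real, Real.norm_of_nonneg (by positivity)]
  have hz₀i : z₀.im = 0 := by
    have : z₀ = ((n + 1 / 4 : ℝ) : ℂ) := by rw [hz₀]; push_cast; rfl
    rw [this, Complex.ofReal_im]
  have hnorm : ∀ z ∈ Metric.closedBall z₀ (1 / 8), (n : ℝ) ≤ ‖z‖ := fun z hz => by
    rw [mem_closedBall_iff_norm] at hz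
    have := norm_sub_norm_le z₀ z
    rw [norm_sub_rev] at this
    linarith
  have happ : ∀ z ∈ Metric.closedBall z₀ (1 / 8),
      ‖f z - 2 * Complex.cos (2 * Real.pi * z)‖ ≤ A / n := fun z hz => by
    have h1 := hnorm z hz
    refine (hCK z (by linarith)).trans ?_
    have h2 : |z.im| ≤ 1 := by
      rw [mem_closedBall_iff_norm] at hz
      have := Complex.abs_im_le_norm (z - z₀)
      rw [Complex.sub_im, hz₀i, sub_zero] at this
      linarith
    have h3 : 2 * Real.pi * |z.im| ≤ 2 * Real.pi := mul_le_of_le_one_right Real.two_pi_pos.le h2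
    rw [hA]
    gcongr
  have hAn : A / n < c / 3 := by
    rw [div_lt_iff₀ (by linarith)]
    have : 3 * A / c < n := by linarith
    rw [div_lt_iff₀ hc] at this
    linarith
  have hfz₀ : ‖f z₀‖ ≤ A / n := by
    have := happ z₀ (Metric.mem_closedBall_self (by norm_num))
    rwa [hz₀, cos_two_pi_mul_quarter, mul_zero, sub_zero, ← hz₀] at this
  have hsph : ∀ z ∈ Metric.sphere z₀ (1 / 8), c ≤ ‖f z - f z₀‖ := fun z hz => by
    have h1 := happ z (Metric.sphere_subset_closedBall hz)
    have h2 := hcos n z hz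
    have h3 := norm_add_le (f z - f z₀) (f z₀)
    have h4 := norm_sub_le (f z) (f z - 2 * Complex.cos (2 * Real.pi * z))
    rw [sub_sub_cancel, norm_mul, Complex.norm_ofNat] at h4
    rw [sub_add_cancel] at h3
    linarith
  have hfd : Differentiable ℂ f := by fun_prop
  have hfreq : ∃ᶠ z in 𝓝 z₀, f z ≠ f z₀ := by
    intro hev
    have hconst : f = fun _ => f z₀ := AnalyticOnNhd.eq_of_eventuallyEq (z₀ := z₀)
      (fun z _ => hfd.analyticAt z) (fun z _ => analyticAt_const)
      (hev.mono fun z hz => not_not.1 hz)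
    obtain ⟨z, hz⟩ := NormedSpace.sphere_nonempty (x := z₀) (r := 1 / 8) |>.2 (by norm_num)
    have := hsph z hz
    rw [congrFun hconst z, sub_self, norm_zero] at this
    linarith
  have hball := hfd.diffContOnCl.ball_subset_image_closedBall (by norm_num) hsph hfreq
  obtain ⟨z, hz, hz0⟩ := hball (show (0 : ℂ) ∈ Metric.ball (f z₀) (c / 2) by
    rw [mem_ball_iff_norm, zero_sub, norm_neg]
    linarith)
  refine ⟨z ^ 2, ?_, hz0⟩
  have h1 := hnorm z hz
  rw [norm_pow]
  nlinarith [le_abs_self R]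

theorem not_isBounded_hillSpectrum {q : ℝ → ℂ} (hq : LocallyIntegrable q volume)
    (hper : Function.Periodic q (2 * Real.pi)) : ¬ Bornology.IsBounded (hillSpectrum q) := by
  intro hb
  obtain ⟨R, hR⟩ := hb.exists_norm_le
  obtain ⟨lam, h1, h2⟩ := (asymptoticallyCosine_hillDiscriminant hq).exists_large_zero
    (differentiable_hillDiscriminant hq) (R + 1)
  have := hR lam (mem_hillSpectrum_of_abs_le hq hper (D := 0) (by norm_num) (by simpa using h2))
  linarith

end Unbounded

/-! ### Analytic arcs -/

section Arc

open Filter Topology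

/-- A real-valued function with values in `[-2, 2]` on an arc has a critical point wherever it takes
one of the values `±2` in the interior of the arc. -/
theorem deriv_eq_zero_of_arc {D : ℂ → ℂ} {γ : ℝ → ℂ} {t : ℝ} (hD : DifferentiableAt ℂ D (γ t))
    (hγ : DifferentiableAt ℝ γ t) (hγ' : deriv γ t ≠ 0)
    (hreal : ∀ᶠ s in 𝓝 t, ∃ d : ℝ, |d| ≤ 2 ∧ D (γ s) = d) (h4 : D (γ t) ^ 2 = 4) :
    deriv D (γ t) = 0 := by
  have h1 : HasDerivAt (fun s => D (γ s)) (deriv γ t • deriv D (γ t)) t :=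
    hD.hasDerivAt.scomp t hγ.hasDerivAt
  have hre : HasDerivAt (fun s => (D (γ s)).re) (deriv γ t • deriv D (γ t)).re t :=
    Complex.reCLM.hasFDerivAt.comp_hasDerivAt t h1
  have him : HasDerivAt (fun s => (D (γ s)).im) (deriv γ t • deriv D (γ t)).im t :=
    Complex.imCLM.hasFDerivAt.comp_hasDerivAt t h1
  have him0 : (deriv γ t • deriv D (γ t)).im = 0 := by
    refine him.unique ((hasDerivAt_const t (0 : ℝ)).congr_of_eventuallyEq ?_)
    filter_upwards [hreal] with s ⟨d, _, hd⟩
    rw [hd, Complex.ofReal_im]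
  have hbd : ∀ᶠ s in 𝓝 t, |(D (γ s)).re| ≤ 2 := by
    filter_upwards [hreal] with s ⟨d, hd2, hd⟩
    rwa [hd, Complex.ofReal_re]
  have hre0 : (deriv γ t • deriv D (γ t)).re = 0 := by
    have h5 : (D (γ t) - 2) * (D (γ t) + 2) = 0 := by linear_combination h4
    rcases mul_eq_zero.1 h5 with h | h
    · have h6 : (D (γ t)).re = 2 := by rw [sub_eq_zero.1 h]; rfl
      refine IsLocalMax.hasDerivAt_eq_zero (f := fun s => (D (γ s)).re) ?_ hre
      filter_upwards [hbd] with s hs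
      rw [h6]
      exact (abs_le.1 hs).2
    · have h6 : (D (γ t)).re = -2 := by rw [eq_neg_of_add_eq_zero_left h]; simp
      refine IsLocalMin.hasDerivAt_eq_zero (f := fun s => (D (γ s)).re) ?_ hre
      filter_upwards [hbd] with s hs
      rw [h6]
      exact (abs_le.1 hs).1
  have h0 : deriv γ t • deriv D (γ t) = 0 := Complex.ext hre0 him0
  exact (smul_eq_zero.1 h0).resolve_left hγ'

theorem eq_Icc_of_mem_diff_interior {I : Set ℝ} (hI : I.OrdConnected) {a b : ℝ} (hab : a < b)
    (ha : a ∈ I \ interior I) (hb : b ∈ I \ interior I) : I = Set.Icc a b := by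
  refine Set.Subset.antisymm (fun x hx => ?_) (hI.out ha.1 hb.1)
  by_contra hx'
  rw [Set.mem_Icc, not_and_or, not_le, not_le] at hx'
  rcases hx' with h | h
  · exact ha.2 (interior_maximal (Set.Ioo_subset_Icc_self.trans (hI.out hx hb.1)) isOpen_Ioo
      ⟨h, hab⟩)
  · exact hb.2 (interior_maximal (Set.Ioo_subset_Icc_self.trans (hI.out ha.1 hx)) isOpen_Ioo
      ⟨hab, h⟩)

/-- A non-compact arc has at most one endpoint. -/
theorem IsAnalyticArc.subsingleton {s E : Set ℂ} (h : IsAnalyticArc s E)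
    (hs : ¬ Bornology.IsBounded s) : E.Subsingleton := by
  obtain ⟨I, γ, hI, -, hemb, -, -, rfl, rfl⟩ := h
  refine Set.Subsingleton.image (Set.not_nontrivial_iff.1 fun hnt => hs ?_) γ
  obtain ⟨a, ha, b, hb, hab⟩ := hnt.exists_lt
  have hcpt : IsCompact I := eq_Icc_of_mem_diff_interior hI hab ha hb ▸ isCompact_Icc
  exact (hcpt.image_of_continuousOn
    (continuousOn_iff_continuous_domRestrict.2 hemb.continuous)).isBounded

/-- On a spectrum which is an analytic arc, the values `±2` of the discriminant are multiple away
from the endpoints. -/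
theorem IsAnalyticArc.deriv_hillDiscriminant_eq_zero {q : ℝ → ℂ} {E : Set ℂ}
    (hq : LocallyIntegrable q volume) (hper : Function.Periodic q (2 * Real.pi))
    (h : IsAnalyticArc (hillSpectrum q) E) {μ : ℂ} (hμ : μ ∉ E)
    (h4 : hillDiscriminant q μ ^ 2 = 4) : deriv (hillDiscriminant q) μ = 0 := by
  obtain ⟨I, γ, -, -, -, han, hγ', hI, rfl⟩ := h
  have hmem : μ ∈ hillSpectrum q := by
    have h5 : (hillDiscriminant q μ - 2) * (hillDiscriminant q μ + 2) = 0 := by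
      linear_combination h4
    rcases mul_eq_zero.1 h5 with h | h
    · exact mem_hillSpectrum_of_abs_le hq hper (D := 2) (by norm_num)
        (by rw [sub_eq_zero.1 h]; norm_num)
    · exact mem_hillSpectrum_of_abs_le hq hper (D := -2) (by norm_num)
        (by rw [eq_neg_of_add_eq_zero_left h]; norm_num)
  rw [← hI] at hmem
  obtain ⟨t, htI, rfl⟩ := hmem
  have ht : t ∈ interior I := by
    by_contra ht
    exact hμ ⟨t, ⟨htI, ht⟩, rfl⟩
  refine deriv_eq_zero_of_arc (differentiable_hillDiscriminant hq _) (han t ht).differentiableAt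
    (hγ' t ht) ?_ h4
  filter_upwards [mem_interior_iff_mem_nhds.1 ht] with s hs
  exact exists_abs_le_of_mem_hillSpectrum hq hper (hI ▸ Set.mem_image_of_mem γ hs)

end Arc

/-! ### The discriminant `2 cos (2π √(lam - lam₀))` -/

section CosineDiscriminant

variable {q : ℝ → ℂ} {lam₀ : ℂ}

theorem hillSpectrum_eq_of_hillDiscriminant (hq : LocallyIntegrable q volume)
    (hper : Function.Periodic q (2 * Real.pi))
    (h : ∀ z : ℂ, hillDiscriminant q (lam₀ + z ^ 2) = 2 * Complex.cos (2 * Real.pi * z)) :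
    hillSpectrum q = (fun x : ℝ => lam₀ + (x : ℂ)) '' Set.Ici 0 := by
  ext lam
  constructor
  · intro hlam
    obtain ⟨D, hD, hDeq⟩ := exists_abs_le_of_mem_hillSpectrum hq hper hlam
    obtain ⟨k, hk⟩ := IsAlgClosed.exists_pow_nat_eq (lam - lam₀) two_pos
    have hlk : lam₀ + k ^ 2 = lam := by rw [hk]; ring
    have h1 := h k
    rw [hlk, hDeq] at h1
    obtain ⟨hD1, hD2⟩ := abs_le.1 hD
    have h2 : Complex.cos (2 * Real.pi * k) = Complex.cos (Real.arccos (D / 2) : ℝ) := by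
      rw [← Complex.ofReal_cos, Real.cos_arccos (by linarith) (by linarith)]
      push_cast
      linear_combination -h1 / 2
    -- hence `k` is real
    obtain ⟨r, hr⟩ : ∃ r : ℝ, k = r := by
      have hπ : (Real.pi : ℂ) ≠ 0 := Complex.ofReal_ne_zero.2 Real.pi_ne_zero
      obtain ⟨m, hm | hm⟩ := Complex.cos_eq_cos_iff.1 h2
      · refine ⟨(Real.arccos (D / 2) - 2 * m * Real.pi) / (2 * Real.pi), ?_⟩
        push_cast
        rw [hm]
        field_simp
        ring
      · refine ⟨(2 * m * Real.pi - Real.arccos (D / 2)) / (2 * Real.pi), ?_⟩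
        push_cast
        rw [hm]
        field_simp
        ring
    refine ⟨r ^ 2, sq_nonneg r, ?_⟩
    rw [← hlk, hr]
    push_cast
    rfl
  · rintro ⟨x, hx, rfl⟩
    have hx' : (x : ℂ) = (Real.sqrt x : ℂ) ^ 2 := by
      rw [← Complex.ofReal_pow, Real.sq_sqrt hx]
    refine mem_hillSpectrum_of_abs_le hq hper (D := 2 * Real.cos (2 * Real.pi * Real.sqrt x)) ?_ ?_
    · rw [abs_mul, abs_two]
      linarith [Real.abs_cos_le_one (2 * Real.pi * Real.sqrt x)]
    · simp only [hx', h]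
      push_cast
      rfl

/-- Both sides of `f'(z) = 2 z Δ'(lam₀ + z²)`, where `f(z) = 2 cos (2πz)`, are differentiated at
`z = 0`. -/
theorem deriv_hillDiscriminant_of_eq (hq : LocallyIntegrable q volume)
    (h : ∀ z : ℂ, hillDiscriminant q (lam₀ + z ^ 2) = 2 * Complex.cos (2 * Real.pi * z)) :
    deriv (hillDiscriminant q) lam₀ = -(4 * Real.pi ^ 2) := by
  have hD := differentiable_hillDiscriminant hq
  have hD' : Differentiable ℂ (deriv (hillDiscriminant q)) := fun z =>
    (hD.analyticAt z).deriv.differentiableAt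
  have hlin : ∀ z : ℂ, HasDerivAt (fun z : ℂ => 2 * Real.pi * z) (2 * Real.pi) z := fun z => by
    simpa using (hasDerivAt_id z).const_mul (2 * (Real.pi : ℂ))
  have h1 : ∀ z : ℂ, z * deriv (hillDiscriminant q) (lam₀ + z ^ 2) =
      -2 * Real.pi * Complex.sin (2 * Real.pi * z) := fun z => by
    have e1 := hasDerivAt_comp_add_sq hD lam₀ z
    have e2 := ((Complex.hasDerivAt_cos (2 * Real.pi * z)).comp z (hlin z)).const_mul 2
    have e3 := e1.unique (e2.congr_of_eventuallyEq (.of_forall h))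
    linear_combination e3 / 2
  have h2 : HasDerivAt (fun z : ℂ => z * deriv (hillDiscriminant q) (lam₀ + z ^ 2))
      (deriv (hillDiscriminant q) lam₀) 0 := by
    have e := (hasDerivAt_id (0 : ℂ)).mul
      (show DifferentiableAt ℂ (fun z => deriv (hillDiscriminant q) (lam₀ + z ^ 2)) 0 by
        fun_prop).hasDerivAt
    refine e.congr_deriv ?_
    simp
  have h3 := (((Complex.hasDerivAt_sin (2 * Real.pi * 0)).comp 0 (hlin 0)).const_mul
    (-2 * (Real.pi : ℂ))).congr_of_eventuallyEq (.of_forall h1)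
  rw [h2.unique h3]
  simp
  ring

end CosineDiscriminant

theorem mainTheorem3 (q : ℝ → ℂ) (hper : Function.Periodic q (2 * Real.pi))
    (hq : MemLp q 2 (volume.restrict (Set.Ioc 0 (2 * Real.pi))))
    (E : Set ℂ) (harc : IsAnalyticArc (hillSpectrum q) E) :
    ∃ lam₀ : ℂ, E = {lam₀} ∧
      hillMean q = lam₀ ∧
      (∀ lam k : ℂ, k ^ 2 = lam - lam₀ →
        hillDiscriminant q lam = 2 * Complex.cos (2 * Real.pi * k)) ∧
      hillSpectrum q = (fun x : ℝ => hillMean q + (x : ℂ)) '' Set.Ici 0 ∧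
      IsPeriodicEigenvalue q lam₀ ∧ ¬ HillCoexistence q lam₀ := by
  have hloc : LocallyIntegrable q volume := locallyIntegrable_of_periodic hper hq
  have hsub := harc.subsingleton (not_isBounded_hillSpectrum hloc hper)
  -- without endpoints, every number would be the mean value of `q`
  have hne : E.Nonempty := by
    by_contra hE
    have hmean : ∀ c : ℂ, hillMean q = c := fun c =>
      (hillMean_eq_and_hillDiscriminant_eq hloc fun μ _ h4 =>
        harc.deriv_hillDiscriminant_eq_zero hloc hper (fun hμ => hE ⟨μ, hμ⟩) h4).1
    exact zero_ne_one ((hmean 0).symm.trans (hmean 1))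
  obtain ⟨lam₀, hE⟩ := Set.exists_eq_singleton_iff_nonempty_subsingleton.2 ⟨hne, hsub⟩
  obtain ⟨hmean, hΔ⟩ := hillMean_eq_and_hillDiscriminant_eq hloc (lam₀ := lam₀) fun μ hμ h4 =>
    harc.deriv_hillDiscriminant_eq_zero hloc hper (by rw [hE]; exact hμ) h4
  have hΔ0 : hillDiscriminant q lam₀ = 2 := by simpa using hΔ 0
  refine ⟨lam₀, hE, hmean, fun lam k hk => ?_, ?_, ?_, fun hco => ?_⟩
  · rw [← hΔ k, hk, add_sub_cancel]
  · rw [hmean]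
    exact hillSpectrum_eq_of_hillDiscriminant hloc hper hΔ
  · exact exists_isFloquetSolution hloc hper (by rw [hΔ0]; norm_num)
  · have h0 := deriv_hillDiscriminant_of_coexistence hloc hper hΔ0 hco
    rw [deriv_hillDiscriminant_of_eq hloc hΔ] at h0
    have hπ : (Real.pi : ℂ) ≠ 0 := Complex.ofReal_ne_zero.2 Real.pi_ne_zero
    exact neg_ne_zero.2 (mul_ne_zero (by norm_num) (pow_ne_zero 2 hπ)) h0
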